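/- Let $n\ge 2$, let $D\subset\mathbb R^n$ be a bounded open set with boundary of class $C^2$ and outer unit normal $\nu$, and let $f(u)=u-u^3$. **Noise.** Let $(W(t))_{t\ge 0}$ and $(\widetilde W(t))_{t\ge 0}$ be independent Brownian motions on a probability space, put $W(t)=\widetilde W(-t)$ for $t<0$, let $\rho\ge 0$ be a smooth even function supported in $[-1,1]$ with $\int\rho=1$, let $0<\gamma<\frac23$, $\rho^\varepsilon(x)=\varepsilon^{-\gamma}\rho(x/\varepsilon^\gamma)$, and $\xi^\varepsilon=\frac{d}{dt}(W*\rho^\varepsilon)$. Consider $$\partial_t u=\Delta u+\varepsilon^{-2}f(u)+\varepsilon^{-1}\xi^\varepsilon(t)\ \text{ in } D,\qquad \partial_\nu u=0\ \text{ on }\partial D. \tag{1}$$ Solutions, subsolutions and supersolutions on $[0,\tau]$ are classical: continuous on $\overline D\times[0,\tau]$, $C^2$ in $x$ and differentiable in $t$ on $D\times(0,\tau)$; for a supersolution (subsolution) the two equalities in (1) are replaced by $\ge$ ($\le$), and a solution, subsolution or supersolution satisfies its relation in $D\times(0,\tau)$ and on $\partial D\times(0,\tau)$. **Travelling wave.**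 Let $\delta_0>0$, let $m_\pm$ be continuous on $[-\delta_0,\delta_0]$ with $f(m_\pm(\delta))+\delta=0$ and $m_\pm(0)=\pm1$, and let $m(x,\delta)$, $c(\delta)$, $|\delta|\le\delta_0$, satisfy $$\partial_x^2m+c(\delta)\,\partial_xm+f(m)+\delta=0,\qquad m(\pm\infty,\delta)=m_\pm(\delta),$$ with $m$ strictly increasing in $x$ and smooth in $(x,\delta)\in\mathbb R\times[-\delta_0,\delta_0]$. **Surfaces.** Let $1<\beta<2$ and $N>0$. For $\eta>0$ and either sign let $\Sigma^{\pm}(t)=\partial U^{\pm}(t)\neq\emptyset$, $0\le t\le\tau^\pm$, be hypersurfaces whose $\eta$-neighbourhoods lie in an open set $\mathcal O^\pm\subset D$, such that the signed distance $d^\pm(x,t)$ to $\Sigma^\pm(t)$ (negative in $U^\pm(t)$) is, on $\mathcal O^\pm$, jointly continuous for $t\in[0,\tau^\pm]$, $C^2$ in $x$ for each $t\in[0,\tau^\pm]$, and differentiable in $t$ for $t\in(0,\tau^\pm)$. Suppose that the principal curvatures of $\Sigma^\pm(t)$ are bounded by $N$ for $0\le t\le\tau^\pm$, and that for $0<t<\tau^\pm$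 the velocity $V=-\partial_td^\pm$ of $\Sigma^\pm(t)$ in the direction of the exterior normal of $U^\pm(t)$ is $$V=(n-1)\kappa+\varepsilon^{-1}c(\varepsilon\xi^\varepsilon(t)\pm\varepsilon^\beta),\qquad (n-1)\kappa=-\Delta d^\pm,$$ so that the mean curvature $\kappa$ is negative for spheres bounding balls. (Thus $\tau^\pm$ is any time up to the stopping time until which such an evolution exists with principal curvatures bounded by $N$.) Let $\tilde d^\pm$ be an extension of $d^\pm$ from $\mathcal O^\pm\times[0,\tau^\pm]$ to $\overline D\times[0,\tau^\pm]$ that is continuous on $\overline D\times[0,\tau^\pm]$, and $C^2$ in $x$ and differentiable in $t$ on $D\times(0,\tau^\pm)$, with $\tilde d^\pm\le-\eta$ on $(D\cap U^\pm(t))\setminus\mathcal O^\pm$, $\tilde d^\pm\ge\eta$ on $D\setminus(U^\pm(t)\cup\mathcal O^\pm)$, $|\nabla\tilde d^\pm|\le1$ on $D\times(0,\tau^\pm)$, with $\tilde d^\pm(\cdot,t)$ constant near each point of $\partial D$, and with $|\partial_t\tilde d^\pm|,|\Delta\tilde d^\pm|\le K\varepsilon^{-p}$ on $D\times(0,\tau^\pm)$,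 where $K$ and $p$ do not depend on $\varepsilon$. For $a,c_1>0$ put $$u^{\varepsilon,\pm}(x,t)=m\Bigl(\frac{\tilde d^\pm(x,t)\pm\varepsilon^ae^{c_1t}}{\varepsilon},\ \varepsilon\xi^\varepsilon(t)\pm\varepsilon^\beta\Bigr).$$ **Claim.** There are constants $a>0$ and $c_1>0$ such that almost surely the following holds: for all $\eta,K,T>0$ and $p\in\mathbb N$ there is a (random) $\varepsilon_0>0$ such that for all $0<\varepsilon\le\varepsilon_0$ and all surfaces $\Sigma^\pm$ and extensions $\tilde d^\pm$ as above with $0\le\tau^\pm\le T$, 1. $u^{\varepsilon,-}$ is a subsolution of (1) on $[0,\tau^-]$ and $u^{\varepsilon,+}$ is a supersolution of (1) on $[0,\tau^+]$; 2. for every solution $u$ of (1) on some interval $[0,\tau]$ with $u^{\varepsilon,-}(x,0)\le u(x,0)\le u^{\varepsilon,+}(x,0)$ for all $x\in D$, one has, for all $x\in D$ and $t\in[0,\tau]$, $u^{\varepsilon,-}(x,t)\le u(x,t)$ if $t\le\tau^-$ and $u(x,t)\le u^{\varepsilon,+}(x,t)$ if $t\le\tau^+$. -/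

import Mathlib

open Set Filter Topology MeasureTheory ProbabilityTheory
open scoped NNReal Laplacian Gradient

noncomputable section

namespace AllenCahn

/-- The (negative derivative of the) double-well potential `F u = (u ^ 2 - 1) ^ 2 / 4`. -/
def f (u : ℝ) : ℝ := u - u ^ 3

/-! ### The noise -/

/-- A mollifying kernel: smooth, nonnegative, symmetric, supported in `[-1, 1]`, of mass one. -/
structure IsMollifier (ρ : ℝ → ℝ) : Prop where
  smooth : ContDiff ℝ (⊤ : ℕ∞) ρ
  nonneg : ∀ x, 0 ≤ ρ x
  symm : ∀ x, ρ (-x) = ρ x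
  support : ∀ x, x ∉ Icc (-1 : ℝ) 1 → ρ x = 0
  mass : ∫ x, ρ x = 1

/-- The two-sided process that equals `B t` for `t ≥ 0` and `B' (-t)` for `t < 0`. -/
def twoSided {Ω : Type*} (B B' : ℝ≥0 → Ω → ℝ) (t : ℝ) (ω : Ω) : ℝ :=
  if 0 ≤ t then B t.toNNReal ω else B' (-t).toNNReal ω

/-- `ρ^ε(x) = ε^{-γ} ρ(x / ε^γ)`. -/
def rescaledKernel (ρ : ℝ → ℝ) (γ ε x : ℝ) : ℝ := ε ^ (-γ) * ρ (x / ε ^ γ)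

/-- The mollified path `w ∗ ρ^ε`. -/
def mollifiedPath (ρ : ℝ → ℝ) (γ : ℝ) (w : ℝ → ℝ) (ε t : ℝ) : ℝ :=
  ∫ s, rescaledKernel ρ γ ε (t - s) * w s

/-- The noise `ξ^ε`: the time derivative of the mollified path. -/
def noise (ρ : ℝ → ℝ) (γ : ℝ) (w : ℝ → ℝ) (ε t : ℝ) : ℝ :=
  deriv (mollifiedPath ρ γ w ε) t

/-! ### Travelling waves -/

/-- `m (·, δ)` and `c δ`, `|δ| ≤ δ₀`, are increasing travelling waves and their speeds for the
reaction term `f + δ`; they connect the zeros `mMinus δ`, `mPlus δ` of `f + δ` which continue the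
stable zeros `-1`, `1` of `f`, and the profile is smooth in both variables. -/
structure IsTravellingWave (δ₀ : ℝ) (mMinus mPlus : ℝ → ℝ) (m : ℝ → ℝ → ℝ) (c : ℝ → ℝ) :
    Prop where
  pos : 0 < δ₀
  mMinus_cont : ContinuousOn mMinus (Icc (-δ₀) δ₀)
  mPlus_cont : ContinuousOn mPlus (Icc (-δ₀) δ₀)
  mMinus_zero : mMinus 0 = -1
  mPlus_zero : mPlus 0 = 1
  mMinus_root : ∀ δ ∈ Icc (-δ₀) δ₀, f (mMinus δ) + δ = 0
  mPlus_root : ∀ δ ∈ Icc (-δ₀) δ₀, f (mPlus δ) + δ = 0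
  smooth : ContDiffOn ℝ (⊤ : ℕ∞) (fun q : ℝ × ℝ => m q.1 q.2) (univ ×ˢ Icc (-δ₀) δ₀)
  increasing : ∀ δ ∈ Icc (-δ₀) δ₀, StrictMono fun x => m x δ
  ode : ∀ δ ∈ Icc (-δ₀) δ₀, ∀ x,
    deriv (deriv fun y => m y δ) x + c δ * deriv (fun y => m y δ) x + (f (m x δ) + δ) = 0
  tendsto_bot : ∀ δ ∈ Icc (-δ₀) δ₀, Tendsto (fun x => m x δ) atBot (𝓝 (mMinus δ))
  tendsto_top : ∀ δ ∈ Icc (-δ₀) δ₀, Tendsto (fun x => m x δ) atTop (𝓝 (mPlus δ))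

section Space

variable {n : ℕ}

/-! ### The domain and its outer normal -/

/-- `r` is a defining function of class `C²` of the open set `D`; a bounded open set has a boundary
of class `C²` exactly if it has such a function. -/
structure IsDefiningFunction (r : EuclideanSpace ℝ (Fin n) → ℝ)
    (D : Set (EuclideanSpace ℝ (Fin n))) : Prop where
  contDiff : ContDiff ℝ 2 r
  eq_neg : D = {x | r x < 0}
  gradient_ne : ∀ x, r x = 0 → ∇ r x ≠ 0

/-- The outer unit normal of `{r < 0}` at a boundary point. -/
def outerNormal (r : EuclideanSpace ℝ (Fin n) → ℝ) (x : EuclideanSpace ℝ (Fin n)) :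
    EuclideanSpace ℝ (Fin n) :=
  ‖∇ r x‖⁻¹ • ∇ r x

/-- At the boundary point `x` of `{r < 0}`, the function `v` on the closure of `{r < 0}` has the
outer normal derivative `q`. -/
def HasOuterNormalDeriv (r v : EuclideanSpace ℝ (Fin n) → ℝ) (x : EuclideanSpace ℝ (Fin n))
    (q : ℝ) : Prop :=
  HasDerivWithinAt (fun s : ℝ => v (x - s • outerNormal r x)) (-q) (Ici 0) 0

/-! ### Classical solutions, sub- and supersolutions of the Allen-Cahn equation -/

/-- `v` is continuous on `closure D × [0, τ]`, and on `D × (0, τ)` it is twice continuously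
differentiable in space and differentiable in time. -/
structure IsClassical (D : Set (EuclideanSpace ℝ (Fin n))) (τ : ℝ)
    (v : EuclideanSpace ℝ (Fin n) → ℝ → ℝ) : Prop where
  cont : ContinuousOn (fun q : EuclideanSpace ℝ (Fin n) × ℝ => v q.1 q.2)
    (closure D ×ˢ Icc 0 τ)
  space : ∀ t ∈ Ioo 0 τ, ContDiffOn ℝ 2 (fun x => v x t) D
  time : ∀ t ∈ Ioo 0 τ, ∀ x ∈ D, DifferentiableAt ℝ (fun s => v x s) t

/-- The residual `∂ₜ v - Δ v - ε⁻² f(v) - ε⁻¹ ξ(t)`. -/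
def residual (ε : ℝ) (ξ : ℝ → ℝ) (v : EuclideanSpace ℝ (Fin n) → ℝ → ℝ)
    (x : EuclideanSpace ℝ (Fin n)) (t : ℝ) : ℝ :=
  deriv (fun s => v x s) t - (Δ fun y => v y t) x - (ε ^ 2)⁻¹ * f (v x t) - ε⁻¹ * ξ t

/-- Classical solution on `[0, τ]`, with homogeneous Neumann boundary condition. -/
structure IsSolution (D : Set (EuclideanSpace ℝ (Fin n))) (r : EuclideanSpace ℝ (Fin n) → ℝ)
    (ε : ℝ) (ξ : ℝ → ℝ) (τ : ℝ) (v : EuclideanSpace ℝ (Fin n) → ℝ → ℝ) : Prop where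
  classical : IsClassical D τ v
  eqn : ∀ t ∈ Ioo 0 τ, ∀ x ∈ D, residual ε ξ v x t = 0
  neumann : ∀ t ∈ Ioo 0 τ, ∀ x ∈ frontier D, HasOuterNormalDeriv r (fun y => v y t) x 0

/-- Classical supersolution on `[0, τ]`. -/
structure IsSupersolution (D : Set (EuclideanSpace ℝ (Fin n)))
    (r : EuclideanSpace ℝ (Fin n) → ℝ)
    (ε : ℝ) (ξ : ℝ → ℝ) (τ : ℝ) (v : EuclideanSpace ℝ (Fin n) → ℝ → ℝ) : Prop where
  classical : IsClassical D τ v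
  ineq : ∀ t ∈ Ioo 0 τ, ∀ x ∈ D, 0 ≤ residual ε ξ v x t
  neumann : ∀ t ∈ Ioo 0 τ, ∀ x ∈ frontier D,
    ∃ q, HasOuterNormalDeriv r (fun y => v y t) x q ∧ 0 ≤ q

/-- Classical subsolution on `[0, τ]`. -/
structure IsSubsolution (D : Set (EuclideanSpace ℝ (Fin n)))
    (r : EuclideanSpace ℝ (Fin n) → ℝ)
    (ε : ℝ) (ξ : ℝ → ℝ) (τ : ℝ) (v : EuclideanSpace ℝ (Fin n) → ℝ → ℝ) : Prop where
  classical : IsClassical D τ v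
  ineq : ∀ t ∈ Ioo 0 τ, ∀ x ∈ D, residual ε ξ v x t ≤ 0
  neumann : ∀ t ∈ Ioo 0 τ, ∀ x ∈ frontier D,
    ∃ q, HasOuterNormalDeriv r (fun y => v y t) x q ∧ q ≤ 0

/-! ### Moving hypersurfaces -/

open Classical in
/-- Signed distance to the boundary of `A`, negative in `A`. -/
def signedDist (A : Set (EuclideanSpace ℝ (Fin n))) (x : EuclideanSpace ℝ (Fin n)) : ℝ :=
  if x ∈ A then -Metric.infDist x (frontier A) else Metric.infDist x (frontier A)

/-- Velocity, at `y` in the boundary of `U t`, of that boundary in the direction of its exterior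
normal (the signed distance decreases where the surface moves outwards). -/
def normalVelocity (U : ℝ → Set (EuclideanSpace ℝ (Fin n))) (t : ℝ)
    (y : EuclideanSpace ℝ (Fin n)) : ℝ :=
  -deriv (fun s => signedDist (U s) y) t

/-- Mean curvature (average of the principal curvatures) of the boundary of `A` at `y` with respect
to the exterior normal, with the sign that makes it negative for spheres bounding balls. The Hessian
of the signed distance `d` has the normal in its kernel and is, on the tangent space, minus the
second fundamental form; so the sum of the principal curvatures is `-Δ d`. -/
def meanCurvature (A : Set (EuclideanSpace ℝ (Fin n))) (y : EuclideanSpace ℝ (Fin n)) : ℝ :=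
  -(Δ (signedDist A)) y / ((n : ℝ) - 1)

/-- All principal curvatures of the boundary of `A` at `y` are at most `N` in absolute value:
the second fundamental form is bounded by `N` on the tangent space. -/
def PrincipalCurvaturesLE (A : Set (EuclideanSpace ℝ (Fin n))) (N : ℝ)
    (y : EuclideanSpace ℝ (Fin n)) : Prop :=
  ∀ v, fderiv ℝ (signedDist A) y v = 0 →
    |fderiv ℝ (fderiv ℝ (signedDist A)) y v v| ≤ N * ‖v‖ ^ 2

/-- The hypersurfaces `frontier (U t)`, `0 ≤ t ≤ τ`, evolve classically with normal velocity
`V = (n - 1) κ + g t`, their principal curvatures remain bounded by `N`, and their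
`η`-neighbourhoods remain in the open set `O ⊆ D`, in which the signed distance is regular. -/
structure IsForcedCurvatureFlow (D O : Set (EuclideanSpace ℝ (Fin n)))
    (U : ℝ → Set (EuclideanSpace ℝ (Fin n))) (g : ℝ → ℝ) (N η τ : ℝ) : Prop where
  isOpen : IsOpen O
  subset : O ⊆ D
  nonempty : ∀ t ∈ Icc 0 τ, (frontier (U t)).Nonempty
  nbhd : ∀ t ∈ Icc 0 τ, Metric.thickening η (frontier (U t)) ⊆ O
  cont : ContinuousOn (fun q : EuclideanSpace ℝ (Fin n) × ℝ => signedDist (U q.2) q.1)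
    (O ×ˢ Icc 0 τ)
  space : ∀ t ∈ Icc 0 τ, ContDiffOn ℝ 2 (signedDist (U t)) O
  time : ∀ t ∈ Ioo 0 τ, ∀ x ∈ O, DifferentiableAt ℝ (fun s => signedDist (U s) x) t
  velocity : ∀ t ∈ Ioo 0 τ, ∀ y ∈ frontier (U t),
    normalVelocity U t y = ((n : ℝ) - 1) * meanCurvature (U t) y + g t
  curvature : ∀ t ∈ Icc 0 τ, ∀ y ∈ frontier (U t), PrincipalCurvaturesLE (U t) N y

/-- `d` extends the signed distance functions of the surfaces `frontier (U t)` from `O` to `D`: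
it is at most `-η` in `U t` and at least `η` outside `U t` off `O`, its gradient has length at most
one, it is constant near each boundary point of `D`, and its time derivative and Laplacian are
bounded by `L`. -/
structure IsDistanceExtension (D O : Set (EuclideanSpace ℝ (Fin n)))
    (U : ℝ → Set (EuclideanSpace ℝ (Fin n))) (η L τ : ℝ)
    (d : EuclideanSpace ℝ (Fin n) → ℝ → ℝ) : Prop where
  classical : IsClassical D τ d
  eq_signedDist : ∀ t ∈ Icc 0 τ, ∀ x ∈ O, d x t = signedDist (U t) x
  inside : ∀ t ∈ Icc 0 τ, ∀ x ∈ D, x ∈ U t → x ∉ O → d x t ≤ -η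
  outside : ∀ t ∈ Icc 0 τ, ∀ x ∈ D, x ∉ U t → x ∉ O → η ≤ d x t
  gradient_le : ∀ t ∈ Ioo 0 τ, ∀ x ∈ D, ‖∇ (fun y => d y t) x‖ ≤ 1
  const_near : ∀ t ∈ Icc 0 τ, ∀ x ∈ frontier D, ∀ᶠ y in 𝓝[closure D] x, d y t = d x t
  time_le : ∀ t ∈ Ioo 0 τ, ∀ x ∈ D, |deriv (fun s => d x s) t| ≤ L
  laplacian_le : ∀ t ∈ Ioo 0 τ, ∀ x ∈ D, |(Δ fun y => d y t) x| ≤ L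

/-- `m ((d + σ ε^a e^{c₁ t}) / ε, ε ξ(t) + σ ε^β)`, the barrier `u^+` for `σ = 1` and `u^-` for
`σ = -1`. -/
def barrier (m : ℝ → ℝ → ℝ) (σ a c₁ β ε : ℝ) (ξ : ℝ → ℝ)
    (d : EuclideanSpace ℝ (Fin n) → ℝ → ℝ) (x : EuclideanSpace ℝ (Fin n)) (t : ℝ) : ℝ :=
  m ((d x t + σ * (ε ^ a * Real.exp (c₁ * t))) / ε) (ε * ξ t + σ * ε ^ β)

end Space

/-- The forcing `ε⁻¹ c (ε ξ(t) + σ ε^β)` of the surfaces, `σ = ±1`. -/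
def forcing (c : ℝ → ℝ) (σ β ε : ℝ) (ξ : ℝ → ℝ) (t : ℝ) : ℝ :=
  ε⁻¹ * c (ε * ξ t + σ * ε ^ β)

end AllenCahn

end

namespace AllenCahn

/-! ### Hölder regularity of Brownian paths -/

/-! Write `σ = ±1`, `δ = ε ξ + σ ε^β`, `z = (d + σ ε^a e^{c₁ t}) / ε`. Inserting `m(z, δ)` in the
equation and eliminating `f(m)` by the wave equation leaves (`residual_barrier`) `σ ε^{β-2} + m_δ ·
ε ξ' + ε⁻¹ m_x (∂ₜd - Δd + ε⁻¹ c(δ) + σ c₁ ε^a e^{c₁ t}) + ε⁻² m_xx (1 - |∇d|²)`. The first term has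
the desired sign and diverges because `β < 2`; everything else of the wrong sign has to stay
bounded.

Noise term: Brownian paths are `α`-Hölder for every `α < 1/2`, so mollification at scale `ε^γ` gives
`ε ξ' = O(ε^{1 + γ(α - 2)})`, which is bounded for suitable `α` exactly because `γ < 2/3`
(`noise_bounds`). The factor `m_δ` is bounded uniformly in `z` (`IsTravellingWave.exists_bounds`).

Near the surface: `|∇d| = 1`, and the flow equation on the surface extends to parallel surfaces with
an error `2 n N² |d|` (`IsForcedCurvatureFlow.abs_deriv_sub_laplacian_le`), because time derivatives
at a point and at its foot agree and the Laplacian varies slowly along normals. Since `|d| ≤ ε |z| +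
ε^a e^{c₁ t}`, the choice `c₁ = 2 n N²` absorbs the shift, and the remaining `c₁ |z| m_x` is bounded
by exponential decay of `m_x`.

Far from the surface: `|z|` is of order at least `1/ε`, so `m_x` and `m_xx` are exponentially small
and beat every power of `ε`, in particular the bounds on `∂ₜd` and `Δd`.

At `∂D` the barriers are locally constant in space, so the Neumann condition is trivial. The
ordering of solutions and barriers then follows from a parabolic maximum principle (`comparison`).
-/

lemma dyadic_step {w : ℝ → ℝ} {M θ : ℝ} {J : ℕ}
    (hinc : ∀ j ≥ J, ∀ k : ℕ, (k : ℝ) < M * 2 ^ j →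
      |w (((k + 1 : ℕ) : ℝ) / 2 ^ j) - w ((k : ℝ) / 2 ^ j)| ≤ θ ^ j) (hθ : 0 ≤ θ)
    {s : ℝ} (hs : 0 ≤ s) (hsM : s < M) {j : ℕ} (hj : J ≤ j) :
    |w ((⌊s * 2 ^ (j + 1)⌋₊ : ℝ) / 2 ^ (j + 1)) - w ((⌊s * 2 ^ j⌋₊ : ℝ) / 2 ^ j)|
      ≤ θ ^ (j + 1) := by
  set k := ⌊s * 2 ^ j⌋₊ with hk
  have hk1 : (k : ℝ) ≤ s * 2 ^ j := Nat.floor_le (by positivity)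
  have hk2 : s * 2 ^ j < k + 1 := Nat.lt_floor_add_one _
  have h0 : ((2 * k : ℕ) : ℝ) / 2 ^ (j + 1) = (k : ℝ) / 2 ^ j := by
    push_cast; field_simp; ring
  have hlo : 2 * k ≤ ⌊s * 2 ^ (j + 1)⌋₊ := by
    apply Nat.le_floor; push_cast; rw [pow_succ]; linarith
  have hhi : ⌊s * 2 ^ (j + 1)⌋₊ < 2 * k + 2 := by
    rw [Nat.floor_lt (by positivity)]; push_cast; rw [pow_succ]; linarith
  rcases (show ⌊s * 2 ^ (j + 1)⌋₊ = 2 * k ∨ ⌊s * 2 ^ (j + 1)⌋₊ = 2 * k + 1 by omega) with h | h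
  · rw [h, h0]; simp; positivity
  · rw [h, ← h0]
    apply hinc (j + 1) (by omega) (2 * k)
    push_cast
    have : s * 2 ^ j < M * 2 ^ j := by gcongr
    rw [pow_succ]; linarith

/-- Chaining: passing from one dyadic level to the next moves the rounded point by at most one grid
step, so the increments sum to a geometric series; continuity of `w` passes to the limit. -/
lemma dyadic_approx {w : ℝ → ℝ} (hw : Continuous w) {M θ : ℝ} {J : ℕ}
    (hinc : ∀ j ≥ J, ∀ k : ℕ, (k : ℝ) < M * 2 ^ j →
      |w (((k + 1 : ℕ) : ℝ) / 2 ^ j) - w ((k : ℝ) / 2 ^ j)| ≤ θ ^ j) (hθ : 0 ≤ θ) (hθ' : θ < 1)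
    {s : ℝ} (hs : 0 ≤ s) (hsM : s < M) {j : ℕ} (hj : J ≤ j) :
    |w s - w ((⌊s * 2 ^ j⌋₊ : ℝ) / 2 ^ j)| ≤ θ ^ j / (1 - θ) := by
  have h1 : 0 < 1 - θ := by linarith
  -- The bound is the sum of `θ ^ j, …, θ ^ (j + i - 1)`; the actual increments are smaller by a
  -- factor `θ`.
  have key : ∀ i : ℕ, |w ((⌊s * 2 ^ (j + i)⌋₊ : ℝ) / 2 ^ (j + i)) - w ((⌊s * 2 ^ j⌋₊ : ℝ) / 2 ^ j)|
      ≤ (θ ^ j - θ ^ (j + i)) / (1 - θ) := by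
    intro i
    induction i with
    | zero => simp
    | succ i ih =>
      have h2 := dyadic_step hinc hθ hs hsM (j := j + i) (by omega)
      have h3 : θ ^ (j + i + 1) ≤ θ ^ (j + i) := pow_le_pow_of_le_one hθ hθ'.le (by omega)
      have h4 : (θ ^ j - θ ^ (j + (i + 1))) / (1 - θ)
          = (θ ^ j - θ ^ (j + i)) / (1 - θ) + θ ^ (j + i) := by
        field_simp; ring
      rw [h4]
      refine (abs_sub_le _ (w ((⌊s * 2 ^ (j + i)⌋₊ : ℝ) / 2 ^ (j + i))) _).trans ?_
      rw [← add_assoc]; linarith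
  have hlim : Tendsto (fun i : ℕ => (⌊s * 2 ^ (j + i)⌋₊ : ℝ) / 2 ^ (j + i)) atTop (𝓝 s) := by
    have h2 : Tendsto (fun i : ℕ => (2 : ℝ) ^ (j + i)) atTop atTop := by
      simpa only [add_comm] using (tendsto_add_atTop_iff_nat j).2
        (tendsto_pow_atTop_atTop_of_one_lt (one_lt_two : (1 : ℝ) < 2))
    exact (tendsto_nat_floor_mul_div_atTop (R := ℝ) hs).comp h2
  have h5 : Tendsto (fun i : ℕ =>
      |w ((⌊s * 2 ^ (j + i)⌋₊ : ℝ) / 2 ^ (j + i)) - w ((⌊s * 2 ^ j⌋₊ : ℝ) / 2 ^ j)|) atTop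
      (𝓝 |w s - w ((⌊s * 2 ^ j⌋₊ : ℝ) / 2 ^ j)|) :=
    (((hw.tendsto s).comp hlim).sub_const _).abs
  refine le_of_tendsto h5 (Eventually.of_forall fun i => (key i).trans ?_)
  have : 0 ≤ θ ^ (j + i) := by positivity
  gcongr; linarith

/-- If `2^{-(j+1)} < t - s ≤ 2^{-j}`, the level-`j` roundings of `s` and `t` coincide or are
neighbours. One grid increment and two chaining errors give the factor `1 + 2 / (1 - θ)`; the factor
`θ⁻¹` comes from comparing `θ ^ j` with `(t - s) ^ α > θ ^ (j + 1)`. -/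
lemma holder_of_dyadic {w : ℝ → ℝ} (hw : Continuous w) {M α : ℝ} (hα : 0 < α) {J : ℕ}
    (hinc : ∀ j ≥ J, ∀ k : ℕ, (k : ℝ) < M * 2 ^ j →
      |w (((k + 1 : ℕ) : ℝ) / 2 ^ j) - w ((k : ℝ) / 2 ^ j)| ≤ ((2 : ℝ) ^ (-α)) ^ j) :
    ∃ C : ℝ, 0 < C ∧ ∃ h : ℝ, 0 < h ∧ ∀ s ∈ Ico 0 M, ∀ t ∈ Ico 0 M, |t - s| < h →
      |w t - w s| ≤ C * |t - s| ^ α := by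
  set θ : ℝ := (2 : ℝ) ^ (-α) with hθdef
  have hθ : 0 < θ := by positivity
  have hθ' : θ < 1 := Real.rpow_lt_one_of_one_lt_of_neg one_lt_two (by linarith)
  have h1 : 0 < 1 - θ := by linarith
  refine ⟨(1 + 2 / (1 - θ)) * θ⁻¹, by positivity, (2⁻¹ : ℝ) ^ J, by positivity, ?_⟩
  have main : ∀ s ∈ Ico 0 M, ∀ t ∈ Ico 0 M, s < t → t - s < (2⁻¹ : ℝ) ^ J →
      |w t - w s| ≤ (1 + 2 / (1 - θ)) * θ⁻¹ * (t - s) ^ α := by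
    intro s hs t ht hst hd
    obtain ⟨j, hj1, hj2⟩ := exists_nat_pow_near_of_lt_one (x := t - s) (y := (2⁻¹ : ℝ))
      (by linarith) (hd.le.trans (pow_le_one₀ (by norm_num) (by norm_num))) (by norm_num)
      (by norm_num)
    have hJ : J ≤ j := by
      have := (pow_lt_pow_iff_right_of_lt_one₀ (by norm_num : (0 : ℝ) < 2⁻¹) (by norm_num)).1
        (lt_trans hj1 hd)
      omega
    rw [inv_pow] at hj1 hj2
    have hs1 := dyadic_approx hw hinc hθ.le hθ' hs.1 hs.2 hJ
    have ht1 := dyadic_approx hw hinc hθ.le hθ' ht.1 ht.2 hJ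
    set k := ⌊s * 2 ^ j⌋₊ with hk
    have hk1 : (k : ℝ) ≤ s * 2 ^ j := Nat.floor_le (mul_nonneg hs.1 (by positivity))
    have hk2 : s * 2 ^ j < k + 1 := Nat.lt_floor_add_one _
    have hlo : k ≤ ⌊t * 2 ^ j⌋₊ := Nat.floor_mono (by gcongr)
    have hts : t * 2 ^ j ≤ s * 2 ^ j + 1 := by
      have h2 : (t - s) * 2 ^ j ≤ (2 ^ j)⁻¹ * 2 ^ j := by gcongr
      rw [inv_mul_cancel₀ (by positivity)] at h2
      linarith
    have hhi : ⌊t * 2 ^ j⌋₊ < k + 2 := by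
      rw [Nat.floor_lt (mul_nonneg ht.1 (by positivity))]; push_cast; linarith
    have hmid : |w ((⌊t * 2 ^ j⌋₊ : ℝ) / 2 ^ j) - w ((k : ℝ) / 2 ^ j)| ≤ θ ^ j := by
      rcases (show ⌊t * 2 ^ j⌋₊ = k ∨ ⌊t * 2 ^ j⌋₊ = k + 1 by omega) with h | h
      · rw [h]; simp; positivity
      · rw [h]
        refine hinc j hJ k (hk1.trans_lt ?_)
        have := hs.2
        gcongr
    have h3 : |w t - w s| ≤ (1 + 2 / (1 - θ)) * θ ^ j := by
      rw [abs_le] at *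
      have : (1 + 2 / (1 - θ)) * θ ^ j = θ ^ j + θ ^ j / (1 - θ) + θ ^ j / (1 - θ) := by ring
      constructor <;> linarith [hs1.1, hs1.2, ht1.1, ht1.2, hmid.1, hmid.2]
    refine h3.trans ?_
    rw [mul_assoc]
    gcongr
    rw [le_inv_mul_iff₀ hθ, mul_comm, ← pow_succ]
    calc θ ^ (j + 1) = (((2 : ℝ) ^ (j + 1))⁻¹) ^ α := by
          rw [hθdef, ← Real.rpow_natCast, ← Real.rpow_natCast, ← Real.rpow_mul (by norm_num),
            ← Real.rpow_neg (by norm_num), ← Real.rpow_mul (by norm_num)]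
          congr 1; ring
      _ ≤ (t - s) ^ α := by gcongr
  intro s hs t ht hd
  rcases lt_trichotomy s t with h | h | h
  · rw [abs_of_pos (sub_pos.2 h)] at hd ⊢
    exact main s hs t ht h hd
  · subst h; simp [Real.zero_rpow hα.ne']
  · rw [abs_sub_comm] at hd
    rw [abs_sub_comm, abs_sub_comm t s]
    rw [abs_of_pos (sub_pos.2 h)] at hd ⊢
    exact main t ht s hs h hd

/-- Markov's inequality for the `q`-th moment; by scaling, the moment of the standard Gaussian is
the only constant. -/
lemma measure_ge_of_hasLaw_gaussianReal {Ω : Type*} [MeasurableSpace Ω] {P : Measure Ω}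
    {X : Ω → ℝ} {v : ℝ≥0} (hX : HasLaw X (gaussianReal 0 v) P) {q : ℕ} (hq : q ≠ 0) {b : ℝ}
    (hb : 0 < b) :
    P {ω | b ≤ |X ω|} ≤ ENNReal.ofReal ((√v / b) ^ q) *
      eLpNorm id q (gaussianReal 0 1) ^ q := by
  have h1 : eLpNorm X q P = ENNReal.ofReal √v * eLpNorm id q (gaussianReal 0 1) := by
    have h2 : gaussianReal 0 v = (gaussianReal 0 1).map (fun x => √v * x) := by
      rw [gaussianReal_map_const_mul]
      congr 1
      · simp
      · ext; simp
    have h3 : eLpNorm X q P = eLpNorm id q (gaussianReal 0 v) := by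
      rw [← hX.map_eq, eLpNorm_map_measure aestronglyMeasurable_id hX.aemeasurable]; rfl
    rw [h3, h2, eLpNorm_map_measure aestronglyMeasurable_id (by fun_prop)]
    have h4 : (id ∘ fun x : ℝ => √v * x) = √(v : ℝ) • (id : ℝ → ℝ) := by ext; simp
    rw [h4, eLpNorm_const_smul, Real.enorm_eq_ofReal (Real.sqrt_nonneg _)]
  have h5 := meas_ge_le_mul_pow_eLpNorm_enorm P (p := q) (by exact_mod_cast hq) (by simp)
    hX.aemeasurable.aestronglyMeasurable (ε := ENNReal.ofReal b) (by simpa using hb) (by simp)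
  have h6 : {ω | b ≤ |X ω|} = {ω | ENNReal.ofReal b ≤ ‖X ω‖ₑ} := by
    ext ω
    simp [Real.enorm_eq_ofReal_abs, ENNReal.ofReal_le_ofReal_iff]
  rw [h6]
  refine h5.trans (le_of_eq ?_)
  rw [h1]
  simp only [ENNReal.toReal_natCast, ENNReal.rpow_natCast]
  rw [mul_pow, ← mul_assoc, ← mul_pow, ENNReal.ofReal_pow (by positivity)]
  congr 2
  rw [← ENNReal.ofReal_inv_of_pos hb, ← ENNReal.ofReal_mul (by positivity)]
  congr 1; field_simp

/-- Brownian paths are locally Hölder continuous of every exponent below `1 / 2`. -/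
lemma brownian_holder {Ω : Type*} [MeasurableSpace Ω] {P : Measure Ω}
    {B : ℝ≥0 → Ω → ℝ} (hB : IsBrownianReal B P) {α : ℝ} (hα : 0 < α) (hα' : α < 1 / 2) :
    ∀ᵐ ω ∂P, ∀ M : ℕ, ∃ C : ℝ, 0 < C ∧ ∃ h : ℝ, 0 < h ∧
      ∀ s ∈ Ico (0 : ℝ) M, ∀ t ∈ Ico (0 : ℝ) M, |t - s| < h →
        |B t.toNNReal ω - B s.toNNReal ω| ≤ C * |t - s| ^ α := by
  rw [ae_all_iff]
  intro M
  -- With `q (1/2 - α) ≥ 2`, a single dyadic increment exceeds `θ ^ j` with probability at most `A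
  -- 2^{-2j}`. There are `M 2^j` increments at level `j`, so the bad events have summable
  -- probabilities and Borel–Cantelli applies.
  obtain ⟨q, hq⟩ := exists_nat_ge (2 / (1 / 2 - α))
  have hα2 : 0 < 1 / 2 - α := by linarith
  have hq2 : 2 ≤ q * (1 / 2 - α) := by rwa [div_le_iff₀ hα2] at hq
  have hq0 : q ≠ 0 := by rintro rfl; norm_num at hq2
  set θ : ℝ := (2 : ℝ) ^ (-α) with hθdef
  have hθ : 0 < θ := by positivity
  set A := eLpNorm id q (gaussianReal 0 1) ^ q with hA
  have hAtop : A ≠ ⊤ := ENNReal.pow_ne_top (memLp_id_gaussianReal (q : ℝ≥0)).eLpNorm_ne_top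
  set E : ℕ → Set Ω := fun j => ⋃ k ∈ Finset.range (M * 2 ^ j),
    {ω | θ ^ j ≤ |B (((k + 1 : ℕ) : ℝ) / 2 ^ j).toNNReal ω - B ((k : ℝ) / 2 ^ j).toNNReal ω|} with hE
  have hPE : ∀ j, P (E j) ≤ (M * A) * ENNReal.ofReal ((2⁻¹ : ℝ) ^ j) := by
    intro j
    have hk : ∀ k ∈ Finset.range (M * 2 ^ j), P {ω | θ ^ j ≤
        |B (((k + 1 : ℕ) : ℝ) / 2 ^ j).toNNReal ω - B ((k : ℝ) / 2 ^ j).toNNReal ω|}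
        ≤ ENNReal.ofReal ((2⁻¹ : ℝ) ^ (2 * j)) * A := by
      intro k _
      refine (measure_ge_of_hasLaw_gaussianReal (hB.hasLaw_sub _ _) hq0 (pow_pos hθ j)).trans ?_
      gcongr
      have hd : ((nndist (((k + 1 : ℕ) : ℝ) / 2 ^ j).toNNReal.1 ((k : ℝ) / 2 ^ j).toNNReal.1 : ℝ≥0)
          : ℝ) = (2 : ℝ) ^ (-(j : ℝ)) := by
        rw [coe_nndist]
        change dist ((((k + 1 : ℕ) : ℝ) / 2 ^ j).toNNReal : ℝ) (((k : ℝ) / 2 ^ j).toNNReal : ℝ) = _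
        rw [Real.coe_toNNReal _ (by positivity), Real.coe_toNNReal _ (by positivity), Real.dist_eq,
          ← sub_div, Real.rpow_neg (by norm_num), Real.rpow_natCast]
        push_cast
        rw [add_sub_cancel_left, abs_of_pos (by positivity), one_div]
      rw [hd, Real.sqrt_eq_rpow, hθdef, ← Real.rpow_natCast, ← Real.rpow_natCast,
        ← Real.rpow_natCast,
        ← Real.rpow_mul (by norm_num), ← Real.rpow_mul (by norm_num), ← Real.rpow_sub (by norm_num),
        ← Real.rpow_mul (by norm_num), Real.inv_rpow (by norm_num), ← Real.rpow_neg (by norm_num)]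
      apply Real.rpow_le_rpow_of_exponent_le (by norm_num)
      push_cast
      nlinarith [(Nat.cast_nonneg j : (0 : ℝ) ≤ j)]
    refine (measure_biUnion_finset_le _ _).trans ((Finset.sum_le_sum hk).trans (le_of_eq ?_))
    rw [Finset.sum_const, Finset.card_range, nsmul_eq_mul]
    have h2 : ENNReal.ofReal ((2⁻¹ : ℝ) ^ j) = 2 ^ j * ENNReal.ofReal ((2⁻¹ : ℝ) ^ (2 * j)) := by
      rw [show (2 : ENNReal) ^ j = ENNReal.ofReal (2 ^ j) by
        rw [ENNReal.ofReal_pow (by norm_num)]; norm_num, ← ENNReal.ofReal_mul (by positivity)]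
      congr 1
      rw [two_mul, pow_add, ← mul_assoc, ← mul_pow]; norm_num
    rw [h2]; push_cast; ring
  have hsum : ∑' j, P (E j) ≠ ⊤ := by
    refine ne_top_of_le_ne_top ?_ (ENNReal.tsum_le_tsum hPE)
    rw [ENNReal.tsum_mul_left]
    refine ENNReal.mul_ne_top (ENNReal.mul_ne_top (by simp) hAtop) ?_
    rw [← ENNReal.ofReal_tsum_of_nonneg (fun j => by positivity)
      (summable_geometric_of_lt_one (by norm_num) (by norm_num))]
    exact ENNReal.ofReal_ne_top
  filter_upwards [ae_eventually_notMem hsum, hB.cont] with ω hω hcont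
  obtain ⟨J, hJ⟩ := eventually_atTop.1 hω
  refine holder_of_dyadic (w := fun t => B t.toNNReal ω) (by fun_prop) hα (J := J) fun j hj k hk => ?_
  have := hJ j hj
  simp only [hE, mem_iUnion, not_exists, mem_ofPred_eq, not_le, Finset.mem_range] at this
  exact (this k (by exact_mod_cast hk)).le

/-- The two-sided Brownian path is continuous and locally Hölder continuous of every exponent
below `1 / 2`. -/
lemma twoSided_holder {Ω : Type*} [MeasurableSpace Ω] {P : Measure Ω}
    {B B' : ℝ≥0 → Ω → ℝ} (hB : IsBrownianReal B P) (hB' : IsBrownianReal B' P)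
    {α : ℝ} (hα : 0 < α) (hα' : α < 1 / 2) :
    ∀ᵐ ω ∂P, Continuous (fun t => twoSided B B' t ω) ∧ ∀ T : ℝ, ∃ C : ℝ, 0 < C ∧ ∃ h : ℝ, 0 < h ∧
      ∀ s ∈ Icc (-T) T, ∀ t ∈ Icc (-T) T, |t - s| < h →
        |twoSided B B' t ω - twoSided B B' s ω| ≤ C * |t - s| ^ α := by
  filter_upwards [brownian_holder hB hα hα', brownian_holder hB' hα hα', hB.cont, hB'.cont,
    hB.eval_zero_ae_eq_zero, hB'.eval_zero_ae_eq_zero] with ω h1 h2 hc hc' h0 h0'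
  refine ⟨?_, fun T => ?_⟩
  · refine Continuous.if_le (by fun_prop) (by fun_prop) continuous_const continuous_id ?_
    intro t ht
    have : t = 0 := ht.symm
    subst this; simp [h0, h0']
  obtain ⟨M, hM⟩ := exists_nat_gt T
  obtain ⟨C, hC, h, hh, H⟩ := h1 M
  obtain ⟨C', hC', h', hh', H'⟩ := h2 M
  refine ⟨C + C', by positivity, min h h', by positivity, ?_⟩
  have main : ∀ s ∈ Icc (-T) T, ∀ t ∈ Icc (-T) T, s ≤ t → |t - s| < min h h' →
        |twoSided B B' t ω - twoSided B B' s ω| ≤ (C + C') * |t - s| ^ α := by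
    intro s hs t ht hst hd
    have hd1 : |t - s| < h := hd.trans_le (min_le_left _ _)
    have hd2 : |t - s| < h' := hd.trans_le (min_le_right _ _)
    have hp : 0 ≤ |t - s| ^ α := by positivity
    simp only [twoSided]
    by_cases hs0 : 0 ≤ s
    · rw [if_pos hs0, if_pos (hs0.trans hst)]
      have := H s ⟨hs0, hs.2.trans_lt hM⟩ t ⟨hs0.trans hst, ht.2.trans_lt hM⟩ hd1
      nlinarith
    · push Not at hs0
      rw [if_neg hs0.not_ge]
      by_cases ht0 : 0 ≤ t
      -- An increment across time `0` is split there, where both Brownian motions vanish; this is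
      -- why the constant is `C + C'`.
      · rw [if_pos ht0]
        have hts : |t - s| = t - s := abs_of_nonneg (by linarith)
        have hM0 : (0 : ℝ) < M := by linarith [hs.1]
        have e1 := H 0 ⟨le_rfl, hM0⟩ t ⟨ht0, ht.2.trans_lt hM⟩
          (by rw [sub_zero, abs_of_nonneg ht0]; linarith)
        have e2 := H' 0 ⟨le_rfl, hM0⟩ (-s) ⟨by linarith, by linarith [hs.1]⟩
          (by rw [sub_zero, abs_of_nonneg (by linarith)]; linarith)
        rw [sub_zero, abs_of_nonneg ht0, Real.toNNReal_zero, h0, sub_zero] at e1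
        rw [sub_zero, abs_of_nonneg (by linarith : 0 ≤ -s), Real.toNNReal_zero, h0', sub_zero] at e2
        have e3 : t ^ α ≤ |t - s| ^ α := by gcongr; linarith
        have e4 : (-s) ^ α ≤ |t - s| ^ α := by
          apply Real.rpow_le_rpow (by linarith) (by linarith) hα.le
        calc _ ≤ |B t.toNNReal ω| + |B' (-s).toNNReal ω| := abs_sub _ _
          _ ≤ C * |t - s| ^ α + C' * |t - s| ^ α := by
            refine add_le_add (e1.trans ?_) (e2.trans ?_) <;> gcongr
          _ = _ := by ring
      · push Not at ht0
        rw [if_neg ht0.not_ge]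
        have e : -t - -s = -(t - s) := by ring
        have := H' (-s) ⟨by linarith, by linarith [hs.1]⟩ (-t) ⟨by linarith, by linarith [ht.1, hs.1]⟩
          (by rwa [e, abs_neg])
        rw [e, abs_neg] at this
        nlinarith
  intro s hs t ht hd
  rcases le_total s t with hst | hst
  · exact main s hs t ht hst hd
  · rw [abs_sub_comm] at hd
    rw [abs_sub_comm, abs_sub_comm t s]
    exact main t ht s hs hst hd

end AllenCahn

namespace AllenCahn

/-! ### Bounds for the noise -/

lemma tsupport_deriv_subset_Icc {k : ℝ → ℝ} {e : ℝ} (hk : tsupport k ⊆ Icc (-e) e) :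
    tsupport (deriv k) ⊆ Icc (-e) e :=
  (closure_minimal support_deriv_subset (isClosed_tsupport k)).trans hk

lemma hasCompactSupport_of_tsupport_subset_Icc {k : ℝ → ℝ} {e : ℝ} (hk : tsupport k ⊆ Icc (-e) e) :
    HasCompactSupport k :=
  isCompact_Icc.of_isClosed_subset (isClosed_tsupport k) hk

lemma hasDerivAt_integral_kernel_mul {k w : ℝ → ℝ} {e : ℝ} (hk : ContDiff ℝ 1 k)
    (hks : tsupport k ⊆ Icc (-e) e) (hw : Continuous w) (t : ℝ) :
    HasDerivAt (fun t => ∫ s, k (t - s) * w s) (∫ s, deriv k (t - s) * w s) t := by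
  have h := (hasCompactSupport_of_tsupport_subset_Icc hks).hasDerivAt_convolution_left
    (ContinuousLinearMap.mul ℝ ℝ) (μ := volume) hk hw.locallyIntegrable t
  have h1 : ∀ f : ℝ → ℝ, convolution f w (ContinuousLinearMap.mul ℝ ℝ) volume
      = fun t => ∫ s, f (t - s) * w s := by
    intro f; ext x; rw [convolution_eq_swap]; rfl
  rwa [h1, h1] at h

/-- The derivative of a compactly supported kernel has integral zero, so `w s` may be replaced by `w
s - w t`; only an interval of length `2 e` contributes. -/
lemma abs_integral_kernel_mul_le {k w : ℝ → ℝ} {e K H t : ℝ} (he : 0 < e) (hk : ContDiff ℝ 1 k)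
    (hks : tsupport k ⊆ Icc (-e) e) (hw : Continuous w) (hK : ∀ x, |deriv k x| ≤ K)
    (hH : ∀ s, |t - s| ≤ e → |w s - w t| ≤ H) :
    |∫ s, deriv k (t - s) * w s| ≤ 2 * e * (K * H) := by
  have hks' := tsupport_deriv_subset_Icc hks
  have hcs := hasCompactSupport_of_tsupport_subset_Icc hks'
  have hdc : Continuous (deriv k) := hk.continuous_deriv le_rfl
  have hz : ∫ s, deriv k s = 0 := by
    refine integral_eq_zero_of_hasDerivAt_of_integrable (f := k)
      (fun x => (hk.differentiable (by norm_num) x).hasDerivAt)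
      (hdc.integrable_of_hasCompactSupport hcs) ?_
    exact hk.continuous.integrable_of_hasCompactSupport (hasCompactSupport_of_tsupport_subset_Icc hks)
  have hout : ∀ s, s ∉ Icc (t - e) (t + e) → deriv k (t - s) = 0 := by
    intro s hs
    apply image_eq_zero_of_notMem_tsupport
    intro hmem
    have := hks' hmem
    exact hs ⟨by linarith [this.2], by linarith [this.1]⟩
  have hz' : ∫ s, deriv k (t - s) * w t = 0 := by
    rw [integral_mul_const, integral_sub_left_eq_self (deriv k) volume t, hz, zero_mul]
  have hint : ∀ g : ℝ → ℝ, Continuous g → Integrable (fun s => deriv k (t - s) * g s) := by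
    intro g hg
    refine Continuous.integrable_of_hasCompactSupport (by fun_prop) ?_
    exact HasCompactSupport.intro isCompact_Icc fun s hs => by rw [hout s hs, zero_mul]
  have e1 : ∫ s, deriv k (t - s) * w s = ∫ s, deriv k (t - s) * (w s - w t) := by
    simp_rw [mul_sub]
    rw [integral_sub (hint w hw) (hint _ continuous_const), hz', sub_zero]
  rw [e1, ← setIntegral_eq_integral_of_forall_compl_eq_zero (s := Icc (t - e) (t + e))
    (fun s hs => by rw [hout s hs, zero_mul])]
  have hfin : volume (Icc (t - e) (t + e)) < ⊤ := by simp
  have := norm_setIntegral_le_of_norm_le_const (C := K * H) hfin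
    (f := fun s => deriv k (t - s) * (w s - w t)) (fun s hs => by
      rw [norm_mul, Real.norm_eq_abs, Real.norm_eq_abs]
      exact mul_le_mul (hK _) (hH s (abs_le.2 ⟨by linarith [hs.2], by linarith [hs.1]⟩))
        (abs_nonneg _) ((abs_nonneg _).trans (hK 0)))
  rw [Real.norm_eq_abs, measureReal_def, Real.volume_Icc, ENNReal.toReal_ofReal (by linarith)] at this
  linarith

lemma deriv_rescale (k : ℝ → ℝ) (b e : ℝ) :
    deriv (fun x => b * k (x / e)) = fun x => (b / e) * deriv k (x / e) := by
  ext x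
  have : (fun x => b * k (x / e)) = fun x => b * (fun x => k (e⁻¹ * x)) x := by
    ext x; rw [div_eq_inv_mul]
  rw [this, deriv_const_mul_field']
  simp only
  rw [deriv_comp_mul_left, smul_eq_mul, div_eq_inv_mul x]
  ring

lemma IsMollifier.exists_deriv_bounds {ρ : ℝ → ℝ} (hρ : IsMollifier ρ) :
    ∃ K : ℝ, 0 < K ∧ (∀ x, |deriv ρ x| ≤ K) ∧ ∀ x, |deriv (deriv ρ) x| ≤ K := by
  have hs : tsupport ρ ⊆ Icc (-1) 1 :=
    closure_minimal (fun x hx => by_contra fun h => hx (hρ.support x h)) isClosed_Icc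
  have h1 := tsupport_deriv_subset_Icc hs
  have h2 := tsupport_deriv_subset_Icc h1
  have hs2 : ContDiff ℝ (1 + 1) ρ := by
    simpa [one_add_one_eq_two] using contDiff_infty.1 hρ.smooth 2
  have hd := (contDiff_succ_iff_deriv.1 hs2).2.2
  obtain ⟨K1, hK1⟩ := hd.continuous.bounded_above_of_compact_support
    (hasCompactSupport_of_tsupport_subset_Icc h1)
  obtain ⟨K2, hK2⟩ := (hd.continuous_deriv le_rfl).bounded_above_of_compact_support
    (hasCompactSupport_of_tsupport_subset_Icc h2)
  refine ⟨max (max K1 K2) 1, by positivity, fun x => ?_, fun x => ?_⟩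
  · exact (hK1 x).trans ((le_max_left _ _).trans (le_max_left _ _))
  · exact (hK2 x).trans ((le_max_right _ _).trans (le_max_left _ _))

/-- With `e = ε ^ γ`, the first two derivatives of the kernel are of size `e⁻²` and `e⁻³`; the
integration window of length `2 e` gives back one power. -/
lemma noise_differentiable {ρ : ℝ → ℝ} (hρ : IsMollifier ρ) {γ : ℝ} {w : ℝ → ℝ} (hw : Continuous w)
    {K : ℝ} (hK : 0 < K) (hK1 : ∀ x, |deriv ρ x| ≤ K) (hK2 : ∀ x, |deriv (deriv ρ) x| ≤ K)
    {ε : ℝ} (hε : 0 < ε) :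
    Differentiable ℝ (noise ρ γ w ε) ∧ ∀ t H, (∀ s, |t - s| ≤ ε ^ γ → |w s - w t| ≤ H) →
      |noise ρ γ w ε t| ≤ 2 * K * H * (ε ^ γ)⁻¹ ∧
      |deriv (noise ρ γ w ε) t| ≤ 2 * K * H * ((ε ^ γ)⁻¹) ^ 2 := by
  set e := ε ^ γ with he
  have hepos : 0 < e := by positivity
  have hker : rescaledKernel ρ γ ε = fun x => e⁻¹ * ρ (x / e) := by
    ext x; simp only [rescaledKernel, Real.rpow_neg hε.le, he]
  set k := rescaledKernel ρ γ ε with hk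
  have hk1 : deriv k = fun x => e⁻¹ / e * deriv ρ (x / e) := by rw [hker, deriv_rescale]
  have hk2 : deriv (deriv k) = fun x => e⁻¹ / e / e * deriv (deriv ρ) (x / e) := by
    rw [hk1, deriv_rescale]
  have hsm : ContDiff ℝ 2 k := by
    have h2 : ContDiff ℝ 2 ρ := by simpa using contDiff_infty.1 hρ.smooth 2
    rw [hker]; exact contDiff_const.mul (h2.comp (contDiff_id.div_const e))
  have hsm' : ContDiff ℝ 1 (deriv k) :=
    (contDiff_succ_iff_deriv (n := 1).1 (by simpa [one_add_one_eq_two] using hsm)).2.2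
  have hsm1 : ContDiff ℝ 1 k := hsm.of_le (by norm_num)
  have hs : tsupport k ⊆ Icc (-e) e := by
    refine closure_minimal (fun x hx => by_contra fun h => hx ?_) isClosed_Icc
    rw [hker]
    simp only
    rw [hρ.support, mul_zero]
    intro h3
    apply h
    rw [mem_Icc, le_div_iff₀ hepos, div_le_iff₀ hepos] at h3
    exact ⟨by linarith [h3.1], by linarith [h3.2]⟩
  have hs' := tsupport_deriv_subset_Icc hs
  have hn : noise ρ γ w ε = fun t => ∫ s, deriv k (t - s) * w s := by
    ext t; exact (hasDerivAt_integral_kernel_mul hsm1 hs hw t).deriv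
  have hn' : deriv (noise ρ γ w ε) = fun t => ∫ s, deriv (deriv k) (t - s) * w s := by
    ext t; rw [hn]; exact (hasDerivAt_integral_kernel_mul hsm' hs' hw t).deriv
  refine ⟨?_, fun t H hH => ⟨?_, ?_⟩⟩
  · rw [hn]; exact fun t => (hasDerivAt_integral_kernel_mul hsm' hs' hw t).differentiableAt
  · rw [hn]
    refine (abs_integral_kernel_mul_le (K := e⁻¹ / e * K) hepos hsm1 hs hw (fun x => ?_) hH).trans
      (le_of_eq ?_)
    · rw [hk1, abs_mul, abs_of_pos (by positivity)]; gcongr; exact hK1 _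
    · field_simp
  · rw [hn']
    refine (abs_integral_kernel_mul_le (K := e⁻¹ / e / e * K) hepos hsm' hs' hw (fun x => ?_)
      hH).trans (le_of_eq ?_)
    · rw [hk2, abs_mul, abs_of_pos (by positivity)]; gcongr; exact hK2 _
    · field_simp

/-- Almost surely, `ε ξ^ε = O(ε^γ)` and `ε ∂ₜξ^ε = O(1)` locally uniformly in time. -/
lemma noise_bounds {Ω : Type*} [MeasurableSpace Ω] {P : Measure Ω}
    {B B' : ℝ≥0 → Ω → ℝ} (hB : IsBrownianReal B P) (hB' : IsBrownianReal B' P)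
    {ρ : ℝ → ℝ} (hρ : IsMollifier ρ) {γ : ℝ} (hγ : 0 < γ) (hγ' : γ < 2 / 3) :
    ∀ᵐ ω ∂P, ∀ T : ℝ, 0 < T → ∃ C : ℝ, 0 < C ∧ ∀ᶠ ε in 𝓝[>] (0 : ℝ),
      Differentiable ℝ (noise ρ γ (fun t => twoSided B B' t ω) ε) ∧
      ∀ t ∈ Icc 0 T, |ε * noise ρ γ (fun t => twoSided B B' t ω) ε t| ≤ C * ε ^ γ ∧
        |ε * deriv (noise ρ γ (fun t => twoSided B B' t ω) ε) t| ≤ C := by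
  -- The last condition reads `α ≥ 2 - 1/γ`, and `γ < 2/3` makes `2 - 1/γ` less than `1/2`. The
  -- alternative `1/4` keeps `α` positive for small `γ`.
  obtain ⟨α, hα, hα', hαγ⟩ : ∃ α : ℝ, 0 < α ∧ α < 1 / 2 ∧ 0 ≤ 1 + γ * (α - 2) := by
    refine ⟨max (1 / 4) (2 - 1 / γ), by positivity, max_lt (by norm_num) ?_, ?_⟩
    · have : 3 / 2 < 1 / γ := by rw [lt_div_iff₀ hγ]; linarith
      linarith
    · have h1 := le_max_right (1 / 4) (2 - 1 / γ)
      have h2 : γ * (2 - 1 / γ) ≤ γ * max (1 / 4) (2 - 1 / γ) := by gcongr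
      have h3 : γ * (2 - 1 / γ) = 2 * γ - 1 := by field_simp
      linarith
  obtain ⟨K, hK, hK1, hK2⟩ := hρ.exists_deriv_bounds
  filter_upwards [twoSided_holder hB hB' hα hα'] with ω hω T hT
  obtain ⟨hc, hω⟩ := hω
  -- The kernel reaches `ε ^ γ < 1` beyond `[0, T]` on both sides, also to negative times.
  obtain ⟨C, hC, h, hh, H⟩ := hω (T + 1)
  refine ⟨2 * K * C, by positivity, ?_⟩
  have ht0 : Tendsto (fun ε : ℝ => ε ^ γ) (𝓝[>] 0) (𝓝 0) := by
    have := (Real.continuousAt_rpow_const 0 γ (Or.inr hγ.le)).tendsto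
    rw [Real.zero_rpow hγ.ne'] at this
    exact this.mono_left nhdsWithin_le_nhds
  filter_upwards [self_mem_nhdsWithin, ht0.eventually (gt_mem_nhds (show 0 < min h 1 by positivity)),
    (tendsto_nhdsWithin_of_tendsto_nhds (tendsto_id (α := ℝ)) : Tendsto id (𝓝[>] (0:ℝ)) (𝓝 0)).eventually
      (gt_mem_nhds one_pos)] with ε hε hεh hε1
  have hε : 0 < ε := hε
  have hε1 : ε < 1 := hε1
  obtain ⟨hd, hb⟩ := noise_differentiable hρ (γ := γ) hc hK hK1 hK2 hε
  refine ⟨hd, fun t ht => ?_⟩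
  have hepos : 0 < ε ^ γ := by positivity
  obtain ⟨b1, b2⟩ := hb t (C * (ε ^ γ) ^ α) (by
    intro s hs
    have hs1 := abs_le.1 hs
    have h1 : ε ^ γ < 1 := hεh.trans_le (min_le_right _ _)
    have h2 : ε ^ γ < h := hεh.trans_le (min_le_left _ _)
    rw [abs_sub_comm] at hs
    refine (H t ⟨by linarith [ht.1], by linarith [ht.2]⟩ s
      ⟨by linarith [ht.1], by linarith [ht.2]⟩ (hs.trans_lt h2)).trans ?_
    gcongr)
  -- This power count bounds `ε ∂ₜξ`; the estimate of `ε ξ` is the same up to one more factor `ε ^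
  -- γ`.
  have key : ε * ((ε ^ γ) ^ α * ((ε ^ γ)⁻¹) ^ 2) ≤ 1 := by
    have : ε * ((ε ^ γ) ^ α * ((ε ^ γ)⁻¹) ^ 2) = ε ^ (1 + γ * (α - 2)) := by
      rw [← Real.rpow_neg hε.le, ← Real.rpow_natCast, ← Real.rpow_mul hε.le, ← Real.rpow_mul hε.le,
        ← Real.rpow_add hε]
      nth_rewrite 1 [← Real.rpow_one ε]
      rw [← Real.rpow_add hε]
      congr 1; push_cast; ring
    rw [this]
    exact Real.rpow_le_one hε.le hε1.le hαγ
  rw [abs_mul, abs_mul, abs_of_pos hε]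
  constructor
  · calc ε * |noise ρ γ (fun t => twoSided B B' t ω) ε t|
        ≤ ε * (2 * K * (C * (ε ^ γ) ^ α) * (ε ^ γ)⁻¹) := by gcongr
      _ = 2 * K * C * ε ^ γ * (ε * ((ε ^ γ) ^ α * ((ε ^ γ)⁻¹) ^ 2)) := by field_simp
      _ ≤ 2 * K * C * ε ^ γ * 1 := by gcongr
      _ = _ := by ring
  · calc ε * |deriv (noise ρ γ (fun t => twoSided B B' t ω) ε) t|
        ≤ ε * (2 * K * (C * (ε ^ γ) ^ α) * ((ε ^ γ)⁻¹) ^ 2) := by gcongr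
      _ = 2 * K * C * (ε * ((ε ^ γ) ^ α * ((ε ^ γ)⁻¹) ^ 2)) := by ring
      _ ≤ 2 * K * C * 1 := by gcongr
      _ = _ := by ring

end AllenCahn

namespace AllenCahn

/-! ### One-dimensional maximum principles -/

/-- Were the second derivative positive, the point would also be a local minimum, so `w` would be
locally constant. -/
lemma deriv_deriv_nonpos_of_isLocalMax {w : ℝ → ℝ} {x : ℝ} (h : IsLocalMax w x)
    (hc : ContinuousAt w x) : deriv (deriv w) x ≤ 0 := by
  by_contra! hpos
  have hmin := isLocalMin_of_deriv_deriv_pos hpos h.deriv_eq_zero hc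
  have hconst : w =ᶠ[𝓝 x] fun _ => w x := by
    filter_upwards [h, hmin] with y h1 h2 using le_antisymm h1 h2
  have := hconst.deriv.deriv_eq
  simp at this
  linarith

/-- The conditions at `X` and at infinity force a positive supremum to be attained at an interior
point, where `w' = 0` and `w'' ≤ 0`. -/
lemma nonpos_of_tendsto_atTop {w : ℝ → ℝ} {X l : ℝ} (hw : Continuous w)
    (hlim : Tendsto w atTop (𝓝 l)) (hl : l ≤ 0) (h0 : w X ≤ 0)
    (hpos : ∀ x > X, 0 < w x → deriv w x = 0 → 0 < deriv (deriv w) x) :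
    ∀ x ≥ X, w x ≤ 0 := by
  intro x hx
  by_contra! hwx
  obtain ⟨R, hR⟩ := eventually_atTop.1 (hlim.eventually (gt_mem_nhds (hl.trans_lt hwx)))
  obtain ⟨z, hz, hmax⟩ := isCompact_Icc.exists_isMaxOn (nonempty_Icc.2 (le_max_left X (max R x)))
    hw.continuousOn
  have hxz : w x ≤ w z := hmax ⟨hx, (le_max_right _ _).trans (le_max_right _ _)⟩
  have hzX : X < z := by
    rcases hz.1.lt_or_eq with h | h
    · exact h
    · rw [← h] at hxz; linarith
  have hloc : IsLocalMax w z := by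
    filter_upwards [lt_mem_nhds hzX] with y hy
    by_cases hyR : y ≤ max X (max R x)
    · exact hmax ⟨hy.le, hyR⟩
    · push Not at hyR
      exact (hR y (((le_max_left _ _).trans (le_max_right _ _)).trans hyR.le)).le.trans hxz
  have := hpos z hzX (hwx.trans_le hxz) hloc.deriv_eq_zero
  linarith [deriv_deriv_nonpos_of_isLocalMax hloc hw.continuousAt]

/-! ### Properties of travelling waves -/

lemma f_sub_f (a b : ℝ) : f a - f b = (b - a) * (a ^ 2 + a * b + b ^ 2 - 1) := by
  simp only [f]; ring

/-- Beyond `9/10` one has `f' = 1 - 3 u² ≤ -1`. This dissipativity drives all tail estimates for the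
waves. -/
lemma le_f_sub_f {a b : ℝ} (ha : 9 / 10 ≤ a) (hab : a ≤ b) : b - a ≤ f a - f b := by
  rw [f_sub_f]
  nlinarith [mul_nonneg (sub_nonneg.2 ha) (sub_nonneg.2 ha),
    mul_nonneg (sub_nonneg.2 ha) (sub_nonneg.2 (ha.trans hab)),
    mul_nonneg (sub_nonneg.2 (ha.trans hab)) (sub_nonneg.2 (ha.trans hab)), sub_nonneg.2 hab]

lemma f_sub_f_le {a b : ℝ} (ha : 0 ≤ a) (hab : a ≤ b) (hb : b ≤ 11 / 10) :
    f a - f b ≤ 3 * (b - a) := by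
  rw [f_sub_f]
  have h1 : a ^ 2 + a * b + b ^ 2 - 1 ≤ 3 := by nlinarith
  nlinarith [sub_nonneg.2 hab]

/-- Maximum principle against `E = exp (-l (x - X))`: the reaction contributes at least `E` where
the difference is positive, while transport and diffusion of `E` cost at most `(cbar l + l²) E < E`
for this `l`. At `X` the gap is at most `11/10 - 9/10 < 1`. -/
lemma wave_sub_limit_le {μ : ℝ → ℝ} {X c δ μp cbar l : ℝ} (hμ : ContDiff ℝ 2 μ)
    (hmono : Monotone μ) (hlim : Tendsto μ atTop (𝓝 μp)) (hX : 9 / 10 ≤ μ X) (hp : μp ≤ 11 / 10)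
    (hroot : f μp + δ = 0) (hode : ∀ x, deriv (deriv μ) x + c * deriv μ x + (f (μ x) + δ) = 0)
    (hc : |c| ≤ cbar) (hl : l = (2 * (1 + cbar))⁻¹) {x : ℝ} (hx : X ≤ x) :
    μp - μ x ≤ Real.exp (-l * (x - X)) := by
  have hcb : 0 ≤ cbar := (abs_nonneg c).trans hc
  have hlpos : 0 < l := by rw [hl]; positivity
  have hl1 : l * (2 * (1 + cbar)) = 1 := by rw [hl]; exact inv_mul_cancel₀ (by positivity)
  have hle : ∀ y, μ y ≤ μp := fun y => hmono.ge_of_tendsto hlim y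
  have hd1 : Differentiable ℝ μ := hμ.differentiable (by norm_num)
  have hd2 : Differentiable ℝ (deriv μ) :=
    ((contDiff_succ_iff_deriv (n := 1)).1 (by simpa [one_add_one_eq_two] using hμ)).2.2.differentiable
      (by norm_num)
  have hE : ∀ y, HasDerivAt (fun y => Real.exp (-l * (y - X))) (-l * Real.exp (-l * (y - X))) y := by
    intro y
    have := (((hasDerivAt_id y).sub_const X).const_mul (-l)).exp
    simpa [mul_comm] using this
  have hw1 : deriv (fun y => μp - μ y - Real.exp (-l * (y - X)))
      = fun y => -deriv μ y + l * Real.exp (-l * (y - X)) := by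
    ext y
    have := (((hd1 y).hasDerivAt.const_sub μp).sub (hE y)).deriv
    simp only [sub_neg_eq_add, neg_mul] at this ⊢
    exact this
  have hw2 : ∀ y, deriv (deriv (fun y => μp - μ y - Real.exp (-l * (y - X)))) y
      = -deriv (deriv μ) y - l ^ 2 * Real.exp (-l * (y - X)) := by
    intro y
    rw [hw1]
    have := ((hd2 y).hasDerivAt.neg.add ((hE y).const_mul l)).deriv
    refine this.trans ?_
    ring
  have := nonpos_of_tendsto_atTop (w := fun y => μp - μ y - Real.exp (-l * (y - X))) (X := X)
    (l := 0) (by have := hd1.continuous; fun_prop) ?_ le_rfl ?_ ?_ x hx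
  · linarith
  · have h1 : Tendsto (fun y => Real.exp (-l * (y - X))) atTop (𝓝 0) := by
      refine Real.tendsto_exp_atBot.comp ?_
      have : Tendsto (fun y => l * (y - X)) atTop atTop :=
        (tendsto_atTop_add_const_right _ (-X) tendsto_id).const_mul_atTop hlpos
      simpa using this
    simpa using ((tendsto_const_nhds (x := μp)).sub hlim).sub h1
  · simp only [sub_self, mul_zero, Real.exp_zero]; linarith
  · intro y hy hpos hdz
    rw [hw2]
    rw [hw1] at hdz
    simp only at hdz
    set E := Real.exp (-l * (y - X))
    have hEpos : 0 < E := Real.exp_pos _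
    have h1 := le_f_sub_f (hX.trans (hmono hy.le)) (hle y)
    have h2 := hode y
    have h3 : deriv μ y = l * E := by linarith
    rw [h3] at h2
    have h4 : -(cbar * (l * E)) ≤ c * (l * E) := by
      have := (abs_le.1 hc).1
      have h5 : 0 < l * E := by positivity
      nlinarith
    have h6 : cbar * (l * E) + l ^ 2 * E < E := by
      have h7 : cbar * l + l ^ 2 < 1 := by nlinarith [mul_nonneg hcb hlpos.le]
      nlinarith
    nlinarith

/-- By the mean value theorem `μ'` is at most `E` somewhere in `(x, x + 1)`. The integrating factor
`exp (c (y - x))` carries this bound back to `x`, at the price of a reaction term of size `3 E`;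
hence `4 = 1 + 3`. The bound on `μ''` is read off the equation. -/
lemma wave_deriv_le {μ : ℝ → ℝ} {X c δ μp cbar l : ℝ} (hμ : ContDiff ℝ 2 μ)
    (hmono : Monotone μ) (hlim : Tendsto μ atTop (𝓝 μp)) (hX : 9 / 10 ≤ μ X) (hp : μp ≤ 11 / 10)
    (hroot : f μp + δ = 0) (hode : ∀ x, deriv (deriv μ) x + c * deriv μ x + (f (μ x) + δ) = 0)
    (hc : |c| ≤ cbar) (hl : l = (2 * (1 + cbar))⁻¹) {x : ℝ} (hx : X ≤ x) :
    deriv μ x ≤ 4 * Real.exp cbar * Real.exp (-l * (x - X)) ∧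
      |deriv (deriv μ) x| ≤ (cbar * (4 * Real.exp cbar) + 3) * Real.exp (-l * (x - X)) := by
  have hcb : 0 ≤ cbar := (abs_nonneg c).trans hc
  have hdec := wave_sub_limit_le hμ hmono hlim hX hp hroot hode hc hl hx
  set E := Real.exp (-l * (x - X))
  have hEpos : 0 < E := Real.exp_pos _
  have hle : ∀ y, μ y ≤ μp := fun y => hmono.ge_of_tendsto hlim y
  have hd1 : Differentiable ℝ μ := hμ.differentiable (by norm_num)
  have hd2 : Differentiable ℝ (deriv μ) :=
    ((contDiff_succ_iff_deriv (n := 1)).1 (by simpa [one_add_one_eq_two] using hμ)).2.2.differentiable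
      (by norm_num)
  have hreac : ∀ y, x ≤ y → 0 ≤ f (μ y) + δ ∧ f (μ y) + δ ≤ 3 * E := by
    intro y hy
    have h9 : 9 / 10 ≤ μ y := hX.trans (hmono (hx.trans hy))
    have h1 := le_f_sub_f h9 (hle y)
    have h2 := f_sub_f_le (by linarith) (hle y) hp
    have h3 := hmono hy
    have h4 := hle y
    constructor <;> linarith
  have hmain : deriv μ x ≤ 4 * Real.exp cbar * E := by
    obtain ⟨s, hs, hs'⟩ := exists_deriv_eq_slope μ (show x < x + 1 by linarith)
      hd1.continuous.continuousOn hd1.differentiableOn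
    have hs1 : deriv μ s ≤ E := by
      rw [hs']; rw [add_sub_cancel_left, div_one]; linarith [hle (x + 1)]
    have hh : ∀ y, HasDerivAt (fun y => Real.exp (c * (y - x)) * deriv μ y)
        (-(Real.exp (c * (y - x)) * (f (μ y) + δ))) y := by
      intro y
      have h1 := (((hasDerivAt_id y).sub_const x).const_mul c).exp.mul (hd2 y).hasDerivAt
      refine h1.congr_deriv ?_
      have := hode y
      simp only [id]
      linear_combination (Real.exp (c * (y - x))) * this
    obtain ⟨z, hz, hz'⟩ := exists_hasDerivAt_eq_slope (fun y => Real.exp (c * (y - x)) * deriv μ y)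
      _ hs.1 (fun y _ => (hh y).continuousAt.continuousWithinAt) (fun y _ => hh y)
    have hexp : ∀ y, x < y → y < x + 1 → Real.exp (c * (y - x)) ≤ Real.exp cbar := by
      intro y h1 h2
      apply Real.exp_le_exp.2
      have := (abs_le.1 hc).2
      nlinarith
    have hz1 := hexp z hz.1 (hz.2.trans hs.2)
    have hs2 := hexp s hs.1 hs.2
    have hrz := hreac z hz.1.le
    rw [eq_div_iff (by linarith [hs.1])] at hz'
    simp only [sub_self, mul_zero, Real.exp_zero, one_mul] at hz'
    have hsx : s - x ≤ 1 := by linarith [hs.2]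
    have hsx0 : 0 ≤ s - x := by linarith [hs.1]
    have h5 : Real.exp (c * (z - x)) * (f (μ z) + δ) * (s - x) ≤ Real.exp cbar * (3 * E) * 1 := by
      gcongr
      exacts [hrz.1, hrz.2]
    have h6 : Real.exp (c * (s - x)) * deriv μ s ≤ Real.exp cbar * E := by
      gcongr
      exact hmono.deriv_nonneg
    linarith
  refine ⟨hmain, ?_⟩
  have h1 : deriv (deriv μ) x = -(c * deriv μ x) - (f (μ x) + δ) := by linarith [hode x]
  rw [h1]
  have h2 := hreac x le_rfl
  have h0 : 0 ≤ deriv μ x := hmono.deriv_nonneg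
  have h3 : |c * deriv μ x| ≤ cbar * (4 * Real.exp cbar * E) := by
    rw [abs_mul, abs_of_nonneg h0]; gcongr
  calc |-(c * deriv μ x) - (f (μ x) + δ)| ≤ |c * deriv μ x| + |f (μ x) + δ| := by
        refine (abs_sub _ _).trans ?_; rw [abs_neg]
    _ ≤ cbar * (4 * Real.exp cbar * E) + 3 * E := by
        rw [abs_of_nonneg h2.1]; exact add_le_add h3 h2.2
    _ = _ := by ring

/-- Two waves differ by a multiple of `h` on a half line where the reaction is dissipative if
they do so at the end points. -/
lemma wave_sub_wave_le {μ ν : ℝ → ℝ} {X c c' δ δ' μp νp A S h : ℝ} (hμ : ContDiff ℝ 2 μ)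
    (hν : ContDiff ℝ 2 ν) (hμm : Monotone μ) (hνm : Monotone ν)
    (hμlim : Tendsto μ atTop (𝓝 μp)) (hνlim : Tendsto ν atTop (𝓝 νp))
    (hμX : 9 / 10 ≤ μ X)
    (hμo : ∀ x, deriv (deriv μ) x + c * deriv μ x + (f (μ x) + δ) = 0)
    (hνo : ∀ x, deriv (deriv ν) x + c' * deriv ν x + (f (ν x) + δ') = 0)
    (hS : ∀ x ≥ X, deriv ν x ≤ S) (hA0 : 0 ≤ A * h)
    (hA : |c' - c| * S + |δ' - δ| ≤ A * h) (hAX : ν X - μ X ≤ A * h) (hAp : νp - μp ≤ A * h)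
    {x : ℝ} (hx : X ≤ x) : ν x - μ x ≤ A * h := by
  have hμ1 : Differentiable ℝ μ := hμ.differentiable (by norm_num)
  have hν1 : Differentiable ℝ ν := hν.differentiable (by norm_num)
  have hμ2 : Differentiable ℝ (deriv μ) :=
    ((contDiff_succ_iff_deriv (n := 1)).1 (by simpa [one_add_one_eq_two] using hμ)).2.2.differentiable
      (by norm_num)
  have hν2 : Differentiable ℝ (deriv ν) :=
    ((contDiff_succ_iff_deriv (n := 1)).1 (by simpa [one_add_one_eq_two] using hν)).2.2.differentiable
      (by norm_num)
  have hw1 : deriv (fun y => ν y - μ y - A * h) = fun y => deriv ν y - deriv μ y := by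
    ext y; exact (((hν1 y).hasDerivAt.sub (hμ1 y).hasDerivAt).sub_const _).deriv
  have hw2 : ∀ y, deriv (deriv (fun y => ν y - μ y - A * h)) y
      = deriv (deriv ν) y - deriv (deriv μ) y := by
    intro y; rw [hw1]; exact ((hν2 y).hasDerivAt.sub (hμ2 y).hasDerivAt).deriv
  have := nonpos_of_tendsto_atTop (w := fun y => ν y - μ y - A * h) (X := X)
    (l := νp - μp - A * h) ?_ ((hνlim.sub hμlim).sub_const _) (by linarith) (by linarith) ?_ x hx
  · linarith
  · have := hμ1.continuous; have := hν1.continuous; fun_prop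
  · intro y hy hpos hdz
    rw [hw2]
    rw [hw1] at hdz
    simp only at hdz
    have h1 := le_f_sub_f (hμX.trans (hμm hy.le)) (show μ y ≤ ν y by linarith)
    have h2 := hμo y
    have h3 := hνo y
    have h4 : deriv μ y = deriv ν y := by linarith
    rw [h4] at h2
    have h0 : 0 ≤ deriv ν y := hνm.deriv_nonneg
    have h5 : (c' - c) * deriv ν y ≤ |c' - c| * S := by
      calc (c' - c) * deriv ν y ≤ |c' - c| * deriv ν y := by gcongr; exact le_abs_self _
        _ ≤ _ := by gcongr; exact hS y hy.le
    have h6 := le_abs_self (δ' - δ)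
    nlinarith

end AllenCahn

/-! ### Smoothness, reflection and uniform bounds of the family of waves. -/

namespace AllenCahn

open scoped ContDiff

lemma contDiffAt_partial_left {G : ℝ × ℝ → ℝ} {p : ℝ × ℝ} (hG : ContDiffAt ℝ ∞ G p) :
    ContDiffAt ℝ ∞ (fun q : ℝ × ℝ => deriv (fun y => G (y, q.2)) q.1) p := by
  have h1 : ContDiffAt ℝ ∞ (fun q => fderiv ℝ G q (1, 0)) p :=
    (hG.fderiv_right (m := ∞) (by simp)).clm_apply contDiffAt_const
  refine h1.congr_of_eventuallyEq ?_
  filter_upwards [(hG.of_le (m := 1) (by simp)).eventually (by simp)] with q hq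
  have h2 : HasDerivAt (fun y : ℝ => (y, q.2)) ((1 : ℝ), (0 : ℝ)) q.1 :=
    (hasDerivAt_id _).prodMk (hasDerivAt_const _ _)
  have h3 : HasFDerivAt G (fderiv ℝ G q) (q.1, q.2) := (hq.differentiableAt (by simp)).hasFDerivAt
  exact (h3.comp_hasDerivAt q.1 h2).deriv

lemma contDiffAt_partial_right {G : ℝ × ℝ → ℝ} {p : ℝ × ℝ} (hG : ContDiffAt ℝ ∞ G p) :
    ContDiffAt ℝ ∞ (fun q : ℝ × ℝ => deriv (fun s => G (q.1, s)) q.2) p := by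
  have h1 : ContDiffAt ℝ ∞ (fun q => fderiv ℝ G q (0, 1)) p :=
    (hG.fderiv_right (m := ∞) (by simp)).clm_apply contDiffAt_const
  refine h1.congr_of_eventuallyEq ?_
  filter_upwards [(hG.of_le (m := 1) (by simp)).eventually (by simp)] with q hq
  have h2 : HasDerivAt (fun y : ℝ => (q.1, y)) ((0 : ℝ), (1 : ℝ)) q.2 :=
    (hasDerivAt_const _ _).prodMk (hasDerivAt_id _)
  have h3 : HasFDerivAt G (fderiv ℝ G q) (q.1, q.2) := (hq.differentiableAt (by simp)).hasFDerivAt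
  exact (h3.comp_hasDerivAt q.2 h2).deriv

namespace IsTravellingWave

variable {δ₀ : ℝ} {mMinus mPlus : ℝ → ℝ} {m : ℝ → ℝ → ℝ} {c : ℝ → ℝ}

lemma contDiffAt (hm : IsTravellingWave δ₀ mMinus mPlus m c) {δ : ℝ} (hδ : δ ∈ Ioo (-δ₀) δ₀)
    (x : ℝ) : ContDiffAt ℝ ∞ (fun q : ℝ × ℝ => m q.1 q.2) (x, δ) :=
  hm.smooth.contDiffAt (prod_mem_nhds univ_mem (Icc_mem_nhds hδ.1 hδ.2))

lemma contDiff_profile (hm : IsTravellingWave δ₀ mMinus mPlus m c) {δ : ℝ}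
    (hδ : δ ∈ Ioo (-δ₀) δ₀) : ContDiff ℝ ∞ (fun x => m x δ) := by
  rw [contDiff_iff_contDiffAt]
  intro x
  exact (hm.contDiffAt hδ x).comp x (contDiffAt_id.prodMk contDiffAt_const)

lemma contDiffAt_parameter (hm : IsTravellingWave δ₀ mMinus mPlus m c) {δ : ℝ}
    (hδ : δ ∈ Ioo (-δ₀) δ₀) (x : ℝ) : ContDiffAt ℝ ∞ (fun s => m x s) δ :=
  (hm.contDiffAt hδ x).comp δ (contDiffAt_const.prodMk contDiffAt_id)

lemma contDiffAt_deriv (hm : IsTravellingWave δ₀ mMinus mPlus m c) {δ : ℝ}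
    (hδ : δ ∈ Ioo (-δ₀) δ₀) (x : ℝ) :
    ContDiffAt ℝ ∞ (fun q : ℝ × ℝ => deriv (fun y => m y q.2) q.1) (x, δ) :=
  contDiffAt_partial_left (hm.contDiffAt hδ x)

lemma contDiffAt_deriv_deriv (hm : IsTravellingWave δ₀ mMinus mPlus m c) {δ : ℝ}
    (hδ : δ ∈ Ioo (-δ₀) δ₀) (x : ℝ) :
    ContDiffAt ℝ ∞ (fun q : ℝ × ℝ => deriv (deriv (fun y => m y q.2)) q.1) (x, δ) :=
  contDiffAt_partial_left (hm.contDiffAt_deriv hδ x)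

lemma contDiffAt_deriv_parameter (hm : IsTravellingWave δ₀ mMinus mPlus m c) {δ : ℝ}
    (hδ : δ ∈ Ioo (-δ₀) δ₀) (x : ℝ) :
    ContDiffAt ℝ ∞ (fun q : ℝ × ℝ => deriv (fun s => m q.1 s) q.2) (x, δ) :=
  contDiffAt_partial_right (hm.contDiffAt hδ x)

lemma deriv_reflect (m : ℝ → ℝ → ℝ) (δ x : ℝ) :
    deriv (fun y => -m (-y) (-δ)) x = deriv (fun y => m y (-δ)) (-x) := by
  rw [deriv.fun_neg, deriv_comp_neg (fun y => m y (-δ)), neg_neg]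

lemma deriv_deriv_reflect (m : ℝ → ℝ → ℝ) (δ x : ℝ) :
    deriv (deriv (fun y => -m (-y) (-δ))) x = -deriv (deriv (fun y => m y (-δ))) (-x) := by
  rw [funext (deriv_reflect m δ), deriv_comp_neg (deriv fun y => m y (-δ))]

/-- The reflected waves `-m (-x, -δ)`, of speed `-c (-δ)`. -/
lemma reflect (hm : IsTravellingWave δ₀ mMinus mPlus m c) :
    IsTravellingWave δ₀ (fun δ => -mPlus (-δ)) (fun δ => -mMinus (-δ))
      (fun x δ => -m (-x) (-δ)) (fun δ => -c (-δ)) := by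
  have hneg : ∀ δ ∈ Icc (-δ₀) δ₀, -δ ∈ Icc (-δ₀) δ₀ := fun δ hδ =>
    ⟨by linarith [hδ.2], by linarith [hδ.1]⟩
  refine ⟨hm.pos, ?_, ?_, by simp [hm.mPlus_zero], by simp [hm.mMinus_zero], ?_, ?_, ?_, ?_, ?_,
    ?_, ?_⟩
  · exact (hm.mPlus_cont.comp continuous_neg.continuousOn hneg).neg
  · exact (hm.mMinus_cont.comp continuous_neg.continuousOn hneg).neg
  · intro δ hδ
    have := hm.mPlus_root _ (hneg δ hδ)
    simp only [f] at *; linarith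
  · intro δ hδ
    have := hm.mMinus_root _ (hneg δ hδ)
    simp only [f] at *; linarith
  · have h1 : ContDiffOn ℝ ∞ (fun q : ℝ × ℝ => (-q.1, -q.2)) (univ ×ˢ Icc (-δ₀) δ₀) :=
      (contDiff_fst.neg.prodMk contDiff_snd.neg).contDiffOn
    exact (hm.smooth.comp h1 fun q hq => ⟨mem_univ _, hneg _ hq.2⟩).neg
  · intro δ hδ x y hxy
    exact neg_lt_neg (hm.increasing _ (hneg δ hδ) (neg_lt_neg hxy))
  · intro δ hδ x
    have := hm.ode _ (hneg δ hδ) (-x)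
    rw [deriv_deriv_reflect, deriv_reflect]
    simp only [f] at *
    linarith
  · intro δ hδ
    exact ((hm.tendsto_top _ (hneg δ hδ)).comp tendsto_neg_atBot_atTop).neg
  · intro δ hδ
    exact ((hm.tendsto_bot _ (hneg δ hδ)).comp tendsto_neg_atTop_atBot).neg

lemma exists_deriv_pos (hm : IsTravellingWave δ₀ mMinus mPlus m c) :
    ∃ x, 0 < deriv (fun y => m y 0) x := by
  by_contra! h
  have h0 : (0 : ℝ) ∈ Icc (-δ₀) δ₀ := ⟨by linarith [hm.pos], hm.pos.le⟩
  have hz : ∀ x, deriv (fun y => m y 0) x = 0 := fun x =>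
    le_antisymm (h x) (hm.increasing 0 h0).monotone.deriv_nonneg
  have := is_const_of_deriv_eq_zero
    ((hm.contDiff_profile ⟨by linarith [hm.pos], hm.pos⟩).differentiable (by simp)) hz 0 1
  have h1 := hm.increasing 0 h0 (zero_lt_one (α := ℝ))
  simp only at this h1
  linarith

lemma exists_ball_of_eventually {p : ℝ → Prop} (hp : ∀ᶠ δ in 𝓝 (0 : ℝ), p δ) :
    ∃ r > 0, ∀ δ ∈ Icc (-r) r, p δ := by
  obtain ⟨r, hr, h⟩ := Metric.eventually_nhds_iff.1 hp
  refine ⟨r / 2, by positivity, fun δ hδ => h ?_⟩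
  rw [Real.dist_eq, sub_zero, abs_lt]
  constructor <;> linarith [hδ.1, hδ.2]

lemma exists_abs_sub_le_of_contDiffAt {g : ℝ → ℝ} (hg : ContDiffAt ℝ ∞ g 0) :
    ∃ K : ℝ, 0 ≤ K ∧ ∃ r > 0, ∀ δ ∈ Icc (-r) r, ∀ δ' ∈ Icc (-r) r, |g δ - g δ'| ≤ K * |δ - δ'| := by
  obtain ⟨K, t, ht, hK⟩ := (hg.of_le (m := 1) (by simp)).exists_lipschitzOnWith
  obtain ⟨r, hr, h⟩ := exists_ball_of_eventually (p := (· ∈ t)) ht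
  refine ⟨K, K.2, r, hr, fun δ hδ δ' hδ' => ?_⟩
  simpa [Real.dist_eq] using hK.dist_le_mul δ (h δ hδ) δ' (h δ' hδ')

/-- No regularity of `c` is assumed: it is recovered by solving the wave equation for `c` at a point
where `m_x` does not vanish. -/
lemma speed_contDiffAt (hm : IsTravellingWave δ₀ mMinus mPlus m c) : ContDiffAt ℝ ∞ c 0 := by
  obtain ⟨x, hx⟩ := hm.exists_deriv_pos
  have h0 : (0 : ℝ) ∈ Ioo (-δ₀) δ₀ := ⟨by linarith [hm.pos], hm.pos⟩
  have hpair : ContDiffAt ℝ ∞ (fun δ : ℝ => (x, δ)) 0 := contDiffAt_const.prodMk contDiffAt_id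
  have h1 : ContDiffAt ℝ ∞ (fun δ => deriv (fun y => m y δ) x) 0 :=
    (hm.contDiffAt_deriv h0 x).comp 0 hpair
  have h2 : ContDiffAt ℝ ∞ (fun δ => deriv (deriv (fun y => m y δ)) x) 0 :=
    (hm.contDiffAt_deriv_deriv h0 x).comp 0 hpair
  have h3 := hm.contDiffAt_parameter h0 x
  have h4 : ContDiffAt ℝ ∞ (fun δ => -(deriv (deriv (fun y => m y δ)) x
      + (m x δ - m x δ ^ 3 + δ)) / deriv (fun y => m y δ) x) 0 :=
    ((h2.add ((h3.sub (h3.pow 3)).add contDiffAt_id)).neg).div h1 hx.ne'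
  refine h4.congr_of_eventuallyEq ?_
  filter_upwards [Ioo_mem_nhds h0.1 h0.2, h1.continuousAt.eventually (lt_mem_nhds hx)] with δ hδ hp
  have := hm.ode δ ⟨hδ.1.le, hδ.2.le⟩ x
  rw [eq_div_iff (ne_of_gt hp)]
  simp only [f] at this
  linarith

/-- Near `δ = 0` the waves converge exponentially at `+∞`, and depend on `δ` in a Lipschitz way. -/
lemma exists_right_tail (hm : IsTravellingWave δ₀ mMinus mPlus m c) :
    ∃ X : ℝ, 0 ≤ X ∧ ∃ r : ℝ, 0 < r ∧ r < δ₀ ∧ ∃ A : ℝ, 0 < A ∧ ∃ l : ℝ, 0 < l ∧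
      ∀ δ ∈ Icc (-r) r, |c δ| ≤ A ∧ ∀ x ≥ X,
        deriv (fun y => m y δ) x ≤ A * Real.exp (-l * x) ∧
        |deriv (deriv fun y => m y δ) x| ≤ A * Real.exp (-l * x) ∧
        ∀ δ' ∈ Icc (-r) r, |m x δ' - m x δ| ≤ A * |δ' - δ| := by
  have h0 : (0 : ℝ) ∈ Ioo (-δ₀) δ₀ := ⟨by linarith [hm.pos], hm.pos⟩
  have h0' : (0 : ℝ) ∈ Icc (-δ₀) δ₀ := ⟨h0.1.le, h0.2.le⟩
  obtain ⟨Lc, hLc, r₁, hr₁, hc⟩ := exists_abs_sub_le_of_contDiffAt hm.speed_contDiffAt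
  -- The margin above `9/10` at `δ = 0` lets the dissipative half line `[X, ∞)` serve all nearby
  -- `δ`.
  obtain ⟨X, hX0, hX⟩ : ∃ X : ℝ, 0 ≤ X ∧ 19 / 20 < m X 0 := by
    have := hm.tendsto_top 0 h0'
    rw [hm.mPlus_zero] at this
    exact ((eventually_ge_atTop 0).and (this.eventually (lt_mem_nhds (by norm_num)))).exists
  have hcX := hm.contDiffAt_parameter h0 X
  obtain ⟨LX, hLX, r₂, hr₂, hX2⟩ := exists_abs_sub_le_of_contDiffAt hcX
  have hpc : ContinuousAt mPlus 0 := hm.mPlus_cont.continuousAt (Icc_mem_nhds h0.1 h0.2)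
  obtain ⟨r₃, hr₃, h3⟩ := exists_ball_of_eventually
    (((hcX.continuousAt.eventually (lt_mem_nhds (show 9 / 10 < m X 0 by linarith))).and
    (hpc.eventually (gt_mem_nhds (show mPlus 0 < 11 / 10 by rw [hm.mPlus_zero]; norm_num)))).and
    (Ioo_mem_nhds h0.1 h0.2))
  set r := min (min r₁ r₂) r₃ with hr
  have hrpos : 0 < r := by positivity
  have hsub : ∀ δ ∈ Icc (-r) r, δ ∈ Icc (-r₁) r₁ ∧ δ ∈ Icc (-r₂) r₂ ∧ δ ∈ Icc (-r₃) r₃ := by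
    intro δ hδ
    have e1 : r ≤ r₁ := (min_le_left _ _).trans (min_le_left _ _)
    have e2 : r ≤ r₂ := (min_le_left _ _).trans (min_le_right _ _)
    have e3 : r ≤ r₃ := min_le_right _ _
    exact ⟨⟨by linarith [hδ.1], by linarith [hδ.2]⟩, ⟨by linarith [hδ.1], by linarith [hδ.2]⟩,
      ⟨by linarith [hδ.1], by linarith [hδ.2]⟩⟩
  have hrδ : r < δ₀ := (h3 r (hsub r ⟨by linarith, le_rfl⟩).2.2).2.2
  have hmem : ∀ δ ∈ Icc (-r) r, δ ∈ Icc (-δ₀) δ₀ := fun δ hδ =>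
    ⟨by linarith [hδ.1], by linarith [hδ.2]⟩
  have hmem' : ∀ δ ∈ Icc (-r) r, δ ∈ Ioo (-δ₀) δ₀ := fun δ hδ =>
    ⟨by linarith [hδ.1], by linarith [hδ.2]⟩
  set cbar := |c 0| + Lc * r with hcbar
  have hcb0 : 0 ≤ cbar := by positivity
  have hcb : ∀ δ ∈ Icc (-r) r, |c δ| ≤ cbar := by
    intro δ hδ
    have e := hc δ (hsub δ hδ).1 0 ⟨by linarith, hr₁.le⟩
    have e2 : |δ| ≤ r := abs_le.2 hδ
    rw [sub_zero] at e
    have e3 : Lc * |δ| ≤ Lc * r := by gcongr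
    calc |c δ| = |c 0 + (c δ - c 0)| := by ring_nf
      _ ≤ |c 0| + |c δ - c 0| := abs_add_le _ _
      _ ≤ _ := by rw [hcbar]; linarith
  have h2 : ∀ δ ∈ Icc (-r) r, ContDiff ℝ 2 (fun x => m x δ) := fun δ hδ =>
    by
    simpa using contDiff_infty.1 (hm.contDiff_profile (hmem' δ hδ)) 2
  set l := (2 * (1 + cbar))⁻¹ with hl
  have hlpos : 0 < l := by positivity
  have htail := fun δ (hδ : δ ∈ Icc (-r) r) x (hx : X ≤ x) => wave_deriv_le (h2 δ hδ)
    (hm.increasing δ (hmem δ hδ)).monotone (hm.tendsto_top δ (hmem δ hδ))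
    (h3 δ (hsub δ hδ).2.2).1.1.le (h3 δ (hsub δ hδ).2.2).1.2.le (hm.mPlus_root δ (hmem δ hδ))
    (hm.ode δ (hmem δ hδ)) (hcb δ hδ) hl hx
  set S := 4 * Real.exp cbar with hS
  have hSb : ∀ δ ∈ Icc (-r) r, ∀ x ≥ X, deriv (fun y => m y δ) x ≤ S := by
    intro δ hδ x hx
    refine (htail δ hδ x hx).1.trans ?_
    have : Real.exp (-l * (x - X)) ≤ 1 := Real.exp_le_one_iff.2 (by nlinarith)
    nlinarith [Real.exp_pos cbar]
  have hlarge : ∀ δ ∈ Icc (-r) r, 9 / 10 ≤ mPlus δ := fun δ hδ =>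
    (h3 δ (hsub δ hδ).2.2).1.1.le.trans
      ((hm.increasing δ (hmem δ hδ)).monotone.ge_of_tendsto (hm.tendsto_top δ (hmem δ hδ)) X)
  -- The stable zeros have Lipschitz constant `1` in `δ`, since `f` decreases with slope at most
  -- `-1` there.
  have hplus : ∀ δ ∈ Icc (-r) r, ∀ δ' ∈ Icc (-r) r, mPlus δ' - mPlus δ ≤ |δ' - δ| := by
    intro δ hδ δ' hδ'
    rcases le_total (mPlus δ') (mPlus δ) with h | h
    · exact (by linarith : mPlus δ' - mPlus δ ≤ 0).trans (abs_nonneg _)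
    · have e1 := le_f_sub_f (hlarge δ hδ) h
      have e2 := hm.mPlus_root δ (hmem δ hδ)
      have e3 := hm.mPlus_root δ' (hmem δ' hδ')
      have := le_abs_self (δ' - δ)
      linarith
  -- `Lc * S + 1` pays for the change of speed and of the reaction term, `LX` for the difference of
  -- the waves at `X`, and `1` also covers the difference of their limits.
  set A₁ := Lc * S + 1 + LX with hA₁
  have hSpos : 0 < S := by positivity
  have hA₁pos : 0 < A₁ := by positivity
  have hlip : ∀ δ ∈ Icc (-r) r, ∀ δ' ∈ Icc (-r) r, ∀ x ≥ X, m x δ' - m x δ ≤ A₁ * |δ' - δ| := by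
    intro δ hδ δ' hδ' x hx
    have hh := abs_nonneg (δ' - δ)
    have hLS : 0 ≤ Lc * S := by positivity
    refine wave_sub_wave_le (h2 δ hδ) (h2 δ' hδ') (hm.increasing δ (hmem δ hδ)).monotone
      (hm.increasing δ' (hmem δ' hδ')).monotone (hm.tendsto_top δ (hmem δ hδ))
      (hm.tendsto_top δ' (hmem δ' hδ')) (h3 δ (hsub δ hδ).2.2).1.1.le (hm.ode δ (hmem δ hδ))
      (hm.ode δ' (hmem δ' hδ')) (hSb δ' hδ') (by positivity) ?_ ?_ ?_ hx
    · have e := hc δ' (hsub δ' hδ').1 δ (hsub δ hδ).1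
      have e2 : |c δ' - c δ| * S ≤ Lc * |δ' - δ| * S := by gcongr
      rw [hA₁]; nlinarith [mul_nonneg hLX hh]
    · have e := (le_abs_self _).trans (hX2 δ' (hsub δ' hδ').2.1 δ (hsub δ hδ).2.1)
      rw [hA₁]; nlinarith [mul_nonneg hLS hh]
    · have e := hplus δ hδ δ' hδ'
      rw [hA₁]; nlinarith [mul_nonneg hLS hh, mul_nonneg hLX hh]
  have hexp : ∀ x, Real.exp (-l * (x - X)) = Real.exp (l * X) * Real.exp (-l * x) := by
    intro x; rw [← Real.exp_add]; congr 1; ring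
  set A := cbar + (cbar * S + 3 + S) * Real.exp (l * X) + A₁ with hA
  have hEX : 0 < Real.exp (l * X) := Real.exp_pos _
  refine ⟨X, hX0, r, hrpos, hrδ, A, by positivity, l, hlpos, fun δ hδ => ⟨?_, fun x hx => ⟨?_, ?_, ?_⟩⟩⟩
  · refine (hcb δ hδ).trans ?_
    have : 0 ≤ (cbar * S + 3 + S) * Real.exp (l * X) + A₁ := by positivity
    linarith
  · refine (htail δ hδ x hx).1.trans ?_
    rw [hexp, ← mul_assoc]
    gcongr
    rw [hA]
    have : 0 ≤ (cbar * S + 3) * Real.exp (l * X) := by positivity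
    linarith
  · refine (htail δ hδ x hx).2.trans ?_
    rw [hexp, ← mul_assoc]
    gcongr
    rw [hA]
    have : 0 ≤ S * Real.exp (l * X) := by positivity
    linarith
  · intro δ' hδ'
    have hle : A₁ * |δ' - δ| ≤ A * |δ' - δ| := by
      gcongr
      have : 0 ≤ cbar + (cbar * S + 3 + S) * Real.exp (l * X) := by positivity
      linarith
    refine le_trans (abs_le.2 ⟨?_, hlip δ hδ δ' hδ' x hx⟩) hle
    have := hlip δ' hδ' δ hδ x hx
    rw [abs_sub_comm] at this
    linarith

/-- Near `δ = 0` the derivatives of the waves decay exponentially, uniformly in `δ`, and the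
parameter derivatives and the speeds are bounded. -/
lemma exists_bounds (hm : IsTravellingWave δ₀ mMinus mPlus m c) :
    ∃ δ₁ : ℝ, 0 < δ₁ ∧ δ₁ < δ₀ ∧ ∃ A : ℝ, 0 < A ∧ ∃ l : ℝ, 0 < l ∧
      ∀ δ ∈ Icc (-δ₁) δ₁, |c δ| ≤ A ∧ ∀ x, 0 ≤ deriv (fun y => m y δ) x ∧
        deriv (fun y => m y δ) x ≤ A * Real.exp (-l * |x|) ∧
        |deriv (deriv fun y => m y δ) x| ≤ A * Real.exp (-l * |x|) ∧
        |deriv (fun s => m x s) δ| ≤ A := by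
  obtain ⟨X, hX, r, hr, hrδ, A, hA, l, hl, H⟩ := hm.exists_right_tail
  -- As `f` is odd, the left tails are the right tails of the reflected waves. The compact middle
  -- region is handled by continuity.
  obtain ⟨X', hX', r', hr', hrδ', A', hA', l', hl', H'⟩ := hm.reflect.exists_right_tail
  set R := max X X' with hR
  -- Halving leaves room around each `δ`, as needed to turn Lipschitz bounds into bounds on the
  -- derivative in `δ`.
  set δ₁ := min r r' / 2 with hδ₁
  have hδ₁pos : 0 < δ₁ := by positivity
  have hδr : δ₁ < r := by have := min_le_left r r'; linarith
  have hδr' : δ₁ < r' := by have := min_le_right r r'; linarith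
  have hmem : ∀ δ ∈ Icc (-δ₁) δ₁, δ ∈ Ioo (-δ₀) δ₀ := fun δ hδ =>
    ⟨by linarith [hδ.1], by linarith [hδ.2]⟩
  have hK : IsCompact (Icc (-R) R ×ˢ Icc (-δ₁) δ₁) := isCompact_Icc.prod isCompact_Icc
  obtain ⟨B₁, hB₁⟩ := hK.exists_bound_of_continuousOn
    (f := fun q : ℝ × ℝ => deriv (fun y => m y q.2) q.1)
    fun q hq => (hm.contDiffAt_deriv (hmem _ hq.2) q.1).continuousAt.continuousWithinAt
  obtain ⟨B₂, hB₂⟩ := hK.exists_bound_of_continuousOn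
    (f := fun q : ℝ × ℝ => deriv (deriv (fun y => m y q.2)) q.1)
    fun q hq => (hm.contDiffAt_deriv_deriv (hmem _ hq.2) q.1).continuousAt.continuousWithinAt
  obtain ⟨B₃, hB₃⟩ := hK.exists_bound_of_continuousOn
    (f := fun q : ℝ × ℝ => deriv (fun s => m q.1 s) q.2)
    fun q hq => (hm.contDiffAt_deriv_parameter (hmem _ hq.2) q.1).continuousAt.continuousWithinAt
  set l₀ := min l l' with hl₀
  have hl₀pos : 0 < l₀ := by positivity
  have hR0 : 0 ≤ R := hX.trans (le_max_left _ _)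
  have hmidpt : ∀ x δ, |x| ≤ R → δ ∈ Icc (-δ₁) δ₁ → (x, δ) ∈ Icc (-R) R ×ˢ Icc (-δ₁) δ₁ :=
    fun x δ hx hδ => ⟨abs_le.1 hx, hδ⟩
  set B := |B₁| + |B₂| + |B₃| with hB
  set E := Real.exp (l₀ * R) with hE
  have hE1 : 1 ≤ E := Real.one_le_exp (by positivity)
  have hB0 : 0 ≤ B := by positivity
  have hBE : B ≤ B * E := le_mul_of_one_le_right hB0 hE1
  have hexp : ∀ x, |x| ≤ R → B ≤ B * E * Real.exp (-l₀ * |x|) := by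
    intro x hx
    rw [mul_assoc, hE, ← Real.exp_add]
    refine le_mul_of_one_le_right hB0 (Real.one_le_exp ?_)
    nlinarith
  have b1 := le_abs_self B₁
  have b2 := le_abs_self B₂
  have b3 := le_abs_self B₃
  have c1 := abs_nonneg B₁
  have c2 := abs_nonneg B₂
  have c3 := abs_nonneg B₃
  refine ⟨δ₁, hδ₁pos, by linarith, A + A' + B * E, by positivity, l₀, hl₀pos, fun δ hδ => ?_⟩
  have hδI : δ ∈ Icc (-r) r := ⟨by linarith [hδ.1], by linarith [hδ.2]⟩
  have hδI' : -δ ∈ Icc (-r') r' := ⟨by linarith [hδ.2], by linarith [hδ.1]⟩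
  refine ⟨(H δ hδI).1.trans (by nlinarith), fun x => ⟨?_, ?_⟩⟩
  · exact (hm.increasing δ ⟨(hmem δ hδ).1.le, (hmem δ hδ).2.le⟩).monotone.deriv_nonneg
  have hS : ∀ b k : ℝ, 0 < b → b ≤ A + A' + B * E → l₀ ≤ k →
      b * Real.exp (-k * |x|) ≤ (A + A' + B * E) * Real.exp (-l₀ * |x|) := by
    intro b k hb h1 h2
    have := abs_nonneg x
    have h3 : Real.exp (-k * |x|) ≤ Real.exp (-l₀ * |x|) := Real.exp_le_exp.2 (by nlinarith)
    gcongr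
  have hA1 : A ≤ A + A' + B * E := by linarith
  have hA2 : A' ≤ A + A' + B * E := by linarith
  by_cases hx : |x| ≤ R
  · have h := hmidpt x δ hx hδ
    have e1 := hB₁ _ h
    have e2 := hB₂ _ h
    have e3 := hB₃ _ h
    simp only [Real.norm_eq_abs] at e1 e2 e3
    have e4 := hexp x hx
    have e5 : B * E * Real.exp (-l₀ * |x|) ≤ (A + A' + B * E) * Real.exp (-l₀ * |x|) := by
      gcongr; linarith
    refine ⟨(le_abs_self _).trans ?_, ?_, ?_⟩ <;> linarith
  · push Not at hx
    rcases le_total 0 x with h0 | h0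
    · rw [abs_of_nonneg h0] at hx hS ⊢
      have hxX : X ≤ x := (le_max_left _ _).trans hx.le
      obtain ⟨t1, t2, t3⟩ := (H δ hδI).2 x hxX
      refine ⟨t1.trans (hS A l hA hA1 (min_le_left _ _)), t2.trans (hS A l hA hA1 (min_le_left _ _)),
        le_trans ?_ hA1⟩
      rw [← Real.norm_eq_abs]
      refine norm_deriv_le_of_lip' hA.le ?_
      filter_upwards [Ioo_mem_nhds (show -r < δ by linarith [hδ.1]) (show δ < r by linarith [hδ.2])]
        with δ' hδ' using t3 δ' ⟨hδ'.1.le, hδ'.2.le⟩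
    · rw [abs_of_nonpos h0] at hx hS ⊢
      have hxX : X' ≤ -x := (le_max_right _ _).trans hx.le
      obtain ⟨t1, t2, t3⟩ := (H' (-δ) hδI').2 (-x) hxX
      rw [deriv_reflect, neg_neg, neg_neg] at t1
      rw [deriv_deriv_reflect, neg_neg, neg_neg, abs_neg] at t2
      refine ⟨t1.trans (hS A' l' hA' hA2 (min_le_right _ _)),
        t2.trans (hS A' l' hA' hA2 (min_le_right _ _)), le_trans ?_ hA2⟩
      rw [← Real.norm_eq_abs]
      refine norm_deriv_le_of_lip' hA'.le ?_
      filter_upwards [Ioo_mem_nhds (show -r' < δ by linarith [hδ.1])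
        (show δ < r' by linarith [hδ.2])] with δ' hδ'
      have := t3 (-δ') ⟨by linarith [hδ'.2], by linarith [hδ'.1]⟩
      simp only [neg_neg] at this
      rw [Real.norm_eq_abs, Real.norm_eq_abs]
      rw [show m x δ' - m x δ = -(-m x δ' - -m x δ) by ring, abs_neg]
      rwa [show δ' - δ = -(-δ' - -δ) by ring, abs_neg]

end IsTravellingWave

end AllenCahn

namespace AllenCahn

variable {n : ℕ}

/-! ### The signed distance -/

/-- By connectedness, the segment from `x` to `y` meets the frontier. This makes the signed distance
1-Lipschitz even across the surface. -/
lemma infDist_add_infDist_le {A : Set (EuclideanSpace ℝ (Fin n))} {x y : EuclideanSpace ℝ (Fin n)}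
    (hx : x ∈ A) (hy : y ∉ A) :
    Metric.infDist x (frontier A) + Metric.infDist y (frontier A) ≤ dist x y := by
  obtain ⟨z, hz, hzA⟩ : (segment ℝ x y ∩ frontier A).Nonempty := by
    by_contra hne
    rw [not_nonempty_iff_eq_empty] at hne
    have hsub : segment ℝ x y ⊆ interior A ∪ (closure A)ᶜ := by
      intro z hz
      by_contra h
      simp only [mem_union, mem_compl_iff, not_or, not_not] at h
      have : z ∈ segment ℝ x y ∩ frontier A := ⟨hz, h.2, h.1⟩
      rw [hne] at this
      exact this
    have hx' : x ∈ interior A := by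
      rcases hsub (left_mem_segment ℝ x y) with h | h
      · exact h
      · exact absurd (subset_closure hx) h
    have hy' : y ∈ (closure A)ᶜ := by
      rcases hsub (right_mem_segment ℝ x y) with h | h
      · exact absurd (interior_subset h) hy
      · exact h
    obtain ⟨z, -, hz1, hz2⟩ := (convex_segment x y).isPreconnected _ _ isOpen_interior
      isClosed_closure.isOpen_compl hsub ⟨x, left_mem_segment ℝ x y, hx'⟩
      ⟨y, right_mem_segment ℝ x y, hy'⟩
    exact hz2 (subset_closure (interior_subset hz1))
  have h1 := Metric.infDist_le_dist_of_mem (x := x) hzA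
  have h2 := Metric.infDist_le_dist_of_mem (x := y) hzA
  have h3 := dist_add_dist_of_mem_segment hz
  rw [dist_comm y z] at h2
  linarith

lemma signedDist_sub_le (A : Set (EuclideanSpace ℝ (Fin n))) (x y : EuclideanSpace ℝ (Fin n)) :
    signedDist A x - signedDist A y ≤ dist x y := by
  have h1 : Metric.infDist x (frontier A) ≤ Metric.infDist y (frontier A) + dist x y :=
    Metric.infDist_le_infDist_add_dist
  have h2 : Metric.infDist y (frontier A) ≤ Metric.infDist x (frontier A) + dist x y := by
    rw [dist_comm]; exact Metric.infDist_le_infDist_add_dist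
  have h3 : 0 ≤ Metric.infDist x (frontier A) := Metric.infDist_nonneg
  have h4 : 0 ≤ Metric.infDist y (frontier A) := Metric.infDist_nonneg
  have h5 : 0 ≤ dist x y := dist_nonneg
  simp only [signedDist]
  split_ifs with hx hy hy
  · linarith
  · linarith
  · have := infDist_add_infDist_le hy hx
    rw [dist_comm] at this
    linarith
  · linarith

lemma lipschitzWith_signedDist (A : Set (EuclideanSpace ℝ (Fin n))) :
    LipschitzWith 1 (signedDist A) := by
  refine LipschitzWith.of_dist_le_mul fun x y => ?_
  rw [Real.dist_eq, NNReal.coe_one, one_mul, abs_le]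
  have h1 := signedDist_sub_le A x y
  have h2 := signedDist_sub_le A y x
  rw [dist_comm] at h2
  constructor <;> linarith

lemma abs_signedDist (A : Set (EuclideanSpace ℝ (Fin n))) (x : EuclideanSpace ℝ (Fin n)) :
    |signedDist A x| = Metric.infDist x (frontier A) := by
  simp only [signedDist]
  split_ifs <;> simp [abs_of_nonneg Metric.infDist_nonneg]

lemma signedDist_eq_zero_of_mem {A : Set (EuclideanSpace ℝ (Fin n))}
    {y : EuclideanSpace ℝ (Fin n)} (hy : y ∈ frontier A) : signedDist A y = 0 := by
  rw [← abs_eq_zero, abs_signedDist, Metric.infDist_zero_of_mem hy]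

lemma mem_frontier_of_signedDist_eq_zero {A : Set (EuclideanSpace ℝ (Fin n))}
    (hA : (frontier A).Nonempty) {y : EuclideanSpace ℝ (Fin n)} (hy : signedDist A y = 0) :
    y ∈ frontier A := by
  rw [isClosed_frontier.mem_iff_infDist_zero hA, ← abs_signedDist, hy, abs_zero]

lemma exists_foot {A : Set (EuclideanSpace ℝ (Fin n))} (hA : (frontier A).Nonempty)
    (x : EuclideanSpace ℝ (Fin n)) : ∃ y ∈ frontier A, ‖x - y‖ = |signedDist A x| := by
  obtain ⟨y, hy, h⟩ := isClosed_frontier.exists_infDist_eq_dist hA x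
  exact ⟨y, hy, by rw [abs_signedDist, h, dist_eq_norm]⟩

/-- The signed distance is linear on the segment from a point to a nearest boundary point. -/
lemma signedDist_segment {A : Set (EuclideanSpace ℝ (Fin n))} {x y : EuclideanSpace ℝ (Fin n)}
    (hy : y ∈ frontier A) (hxy : ‖x - y‖ = |signedDist A x|) {s : ℝ} (hs : s ∈ Icc (0 : ℝ) 1) :
    signedDist A (y + s • (x - y)) = s * signedDist A x := by
  have h0 := signedDist_eq_zero_of_mem hy
  set z := y + s • (x - y) with hz
  have d1 : dist z y = s * |signedDist A x| := by
    rw [dist_eq_norm, hz, add_sub_cancel_left, norm_smul, hxy, Real.norm_of_nonneg hs.1]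
  have d2 : dist z x = (1 - s) * |signedDist A x| := by
    rw [dist_eq_norm, hz, show y + s • (x - y) - x = -((1 - s) • (x - y)) by module, norm_neg,
      norm_smul, hxy, Real.norm_of_nonneg (by linarith [hs.2])]
  -- The Lipschitz bounds from the two end points are both sharp on the segment and together
  -- determine the value.
  have l1 := signedDist_sub_le A z y
  have l2 := signedDist_sub_le A y z
  have l3 := signedDist_sub_le A z x
  have l4 := signedDist_sub_le A x z
  rw [dist_comm] at l2 l4
  rcases le_total 0 (signedDist A x) with h | h
  · rw [abs_of_nonneg h] at d1 d2; apply le_antisymm <;> linarith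
  · rw [abs_of_nonpos h] at d1 d2; apply le_antisymm <;> linarith

lemma norm_gradient_signedDist_le (A : Set (EuclideanSpace ℝ (Fin n)))
    (x : EuclideanSpace ℝ (Fin n)) : ‖∇ (signedDist A) x‖ ≤ 1 := by
  rw [← (InnerProductSpace.toDual ℝ _).norm_map, toDual_gradient]
  exact norm_fderiv_le_of_lipschitz ℝ (lipschitzWith_signedDist A)

/-- On the segment from a point `x` to a nearest boundary point `y`, the gradient `ν` of the signed
distance satisfies `x - y = d(x) ν`. -/
lemma smul_gradient_signedDist {A : Set (EuclideanSpace ℝ (Fin n))}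
    {x y : EuclideanSpace ℝ (Fin n)} (hy : y ∈ frontier A) (hxy : ‖x - y‖ = |signedDist A x|) {s : ℝ}
    (hs : s ∈ Icc (0 : ℝ) 1) (hd : DifferentiableAt ℝ (signedDist A) (y + s • (x - y))) :
    signedDist A x • ∇ (signedDist A) (y + s • (x - y)) = x - y := by
  set z := y + s • (x - y) with hz
  have h1 : HasDerivWithinAt (fun s : ℝ => signedDist A (y + s • (x - y)))
      (fderiv ℝ (signedDist A) z (x - y)) (Icc 0 1) s := by
    have hl : HasDerivAt (fun s : ℝ => y + s • (x - y)) (x - y) s := by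
      simpa using ((hasDerivAt_id s).smul_const (x - y)).const_add y
    exact (hd.hasFDerivAt.comp_hasDerivAt s hl).hasDerivWithinAt
  have h2 : HasDerivWithinAt (fun s : ℝ => signedDist A (y + s • (x - y)))
      (signedDist A x) (Icc 0 1) s := by
    have : HasDerivWithinAt (fun s : ℝ => s * signedDist A x) (signedDist A x) (Icc 0 1) s := by
      simpa using ((hasDerivAt_id s).mul_const (signedDist A x)).hasDerivWithinAt
    exact this.congr (fun u hu => signedDist_segment hy hxy hu) (signedDist_segment hy hxy hs)
  -- Derivatives within `[0, 1]` are compared, so that the end points `s = 0` (the foot) and `s = 1`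
  -- (the point itself) are admissible.
  have h3 : fderiv ℝ (signedDist A) z (x - y) = signedDist A x :=
    (uniqueDiffOn_Icc_zero_one s hs).eq_deriv _ h1 h2
  have h4 : inner ℝ (∇ (signedDist A) z) (x - y) = signedDist A x := by
    rw [inner_gradient_left, h3]
  have h5 := norm_gradient_signedDist_le A z
  set ν := ∇ (signedDist A) z
  set l := signedDist A x
  -- Equality case of Cauchy–Schwarz: the square is `l² ‖ν‖² - 2 l² + l²`, and `‖ν‖ ≤ 1`.
  have h6 : ‖l • ν - (x - y)‖ ^ 2 ≤ 0 := by
    rw [@norm_sub_sq_real, inner_smul_left, h4, norm_smul, hxy, mul_pow, Real.norm_eq_abs, sq_abs]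
    simp only [conj_trivial]
    have h7 : ‖ν‖ ^ 2 ≤ 1 := pow_le_one₀ (norm_nonneg _) h5
    nlinarith [mul_nonneg (sq_nonneg l) (sub_nonneg.2 h7)]
  have h7 : ‖l • ν - (x - y)‖ = 0 := by
    have := sq_nonneg ‖l • ν - (x - y)‖
    exact pow_eq_zero_iff (two_ne_zero) |>.1 (le_antisymm h6 this)
  exact sub_eq_zero.1 (norm_eq_zero.1 h7)

lemma norm_gradient_signedDist_of_ne_zero {A : Set (EuclideanSpace ℝ (Fin n))}
    (hA : (frontier A).Nonempty) {x : EuclideanSpace ℝ (Fin n)} (hx : signedDist A x ≠ 0)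
    (hd : DifferentiableAt ℝ (signedDist A) x) : ‖∇ (signedDist A) x‖ = 1 := by
  obtain ⟨y, hy, hxy⟩ := exists_foot hA x
  have h := smul_gradient_signedDist hy hxy (s := 1) ⟨zero_le_one, le_rfl⟩ (by simpa using hd)
  have h1 : y + (1 : ℝ) • (x - y) = x := by simp
  rw [h1] at h
  have h2 := congrArg norm h
  rw [norm_smul, hxy, Real.norm_eq_abs] at h2
  exact mul_left_cancel₀ (abs_ne_zero.2 hx) (by rw [h2, mul_one])

lemma contDiffAt_one_gradient {g : EuclideanSpace ℝ (Fin n) → ℝ} {x : EuclideanSpace ℝ (Fin n)}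
    (hg : ContDiffAt ℝ 2 g x) : ContDiffAt ℝ 1 (∇ g) x := by
  have h1 : ContDiffAt ℝ 1 (fderiv ℝ g) x := hg.fderiv_right (by norm_num)
  exact (InnerProductSpace.toDual ℝ (EuclideanSpace ℝ (Fin n))).symm.contDiff.contDiffAt.comp x h1

/-- A hypersurface near which the signed distance is regular has no interior points. -/
lemma interior_frontier_eq_empty {A O : Set (EuclideanSpace ℝ (Fin n))}
    (hA : (frontier A).Nonempty) (hne : frontier A ≠ univ) (hO : IsOpen O) (hAO : frontier A ⊆ O)
    (hd : ContDiffOn ℝ 2 (signedDist A) O) : interior (frontier A) = ∅ := by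
  by_contra hI
  have hI' : (interior (frontier A)).Nonempty := nonempty_iff_ne_empty.2 hI
  have hI2 : interior (frontier A) ≠ univ := fun h =>
    hne (univ_subset_iff.1 (h ▸ interior_subset))
  -- At an edge point `y` of the interior, the continuous gradient would be a limit of zeros from
  -- the interior and of unit vectors from outside the surface.
  obtain ⟨y, hy⟩ := nonempty_frontier_iff.2 ⟨hI', hI2⟩
  have hyS : y ∈ frontier A := closure_minimal interior_subset isClosed_frontier hy.1
  have hyI : y ∉ interior (frontier A) := by
    have := hy.2; rwa [interior_interior] at this
  have hcd : ∀ z ∈ O, ContDiffAt ℝ 2 (signedDist A) z := fun z hz => hd.contDiffAt (hO.mem_nhds hz)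
  have hcont : ContinuousAt (fun z => ‖∇ (signedDist A) z‖) y :=
    (contDiffAt_one_gradient (hcd y (hAO hyS))).continuousAt.norm
  have h0 : ‖∇ (signedDist A) y‖ ≤ 1 / 2 := by
    by_contra! hlt
    obtain ⟨z, hz1, hz2⟩ := mem_closure_iff_nhds.1 hy.1 _ (hcont (lt_mem_nhds hlt))
    have h3 : signedDist A =ᶠ[𝓝 z] fun _ => 0 := by
      filter_upwards [isOpen_interior.mem_nhds hz2] with w hw
      exact signedDist_eq_zero_of_mem (interior_subset hw)
    have h4 : ∇ (signedDist A) z = 0 := by rw [h3.gradient_eq, gradient_fun_const]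
    have h5 : 1 / 2 < ‖∇ (signedDist A) z‖ := hz1
    rw [h4, norm_zero] at h5
    norm_num at h5
  have h1 : ∀ᶠ z in 𝓝 y, ‖∇ (signedDist A) z‖ < 1 := hcont.eventually (gt_mem_nhds (by linarith))
  have h2 : ∃ᶠ z in 𝓝 y, z ∉ frontier A := by
    rw [mem_interior_iff_mem_nhds] at hyI
    exact fun h => hyI (by filter_upwards [h] with z hz using not_not.1 hz)
  obtain ⟨z, hz1, hz2, hz3⟩ := (h2.and_eventually (h1.and (hO.mem_nhds (hAO hyS)))).exists
  have := norm_gradient_signedDist_of_ne_zero hA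
    (fun h => hz1 (mem_frontier_of_signedDist_eq_zero hA h))
    ((hcd z hz3).differentiableAt (by norm_num))
  linarith

/-- Off the surface this is the foot point identity. On the surface it follows by continuity,
because the surface has no interior. -/
lemma norm_gradient_signedDist {A O : Set (EuclideanSpace ℝ (Fin n))}
    (hA : (frontier A).Nonempty) (hne : frontier A ≠ univ) (hO : IsOpen O) (hAO : frontier A ⊆ O)
    (hd : ContDiffOn ℝ 2 (signedDist A) O) {x : EuclideanSpace ℝ (Fin n)} (hx : x ∈ O) :
    ‖∇ (signedDist A) x‖ = 1 := by
  have hcd : ∀ z ∈ O, ContDiffAt ℝ 2 (signedDist A) z := fun z hz => hd.contDiffAt (hO.mem_nhds hz)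
  by_cases h0 : signedDist A x = 0
  · have hxI : x ∉ interior (frontier A) := by
      rw [interior_frontier_eq_empty hA hne hO hAO hd]; exact notMem_empty x
    have hcont : ContinuousAt (fun z => ‖∇ (signedDist A) z‖) x :=
      (contDiffAt_one_gradient (hcd x hx)).continuousAt.norm
    have h2 : ∃ᶠ z in 𝓝 x, z ∉ frontier A := by
      rw [mem_interior_iff_mem_nhds] at hxI
      exact fun h => hxI (by filter_upwards [h] with z hz using not_not.1 hz)
    by_contra hne1
    obtain ⟨z, hz1, hz2, hz3⟩ := (h2.and_eventually
      ((hcont.eventually_ne hne1).and (hO.mem_nhds hx))).exists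
    exact hz2 (norm_gradient_signedDist_of_ne_zero hA
      (fun h => hz1 (mem_frontier_of_signedDist_eq_zero hA h))
      ((hcd z hz3).differentiableAt (by norm_num)))
  · exact norm_gradient_signedDist_of_ne_zero hA h0 ((hcd x hx).differentiableAt (by norm_num))

end AllenCahn

namespace AllenCahn

variable {n : ℕ}

/-! ### Curvature of parallel surfaces -/

lemma laplacian_eq_sum (g : EuclideanSpace ℝ (Fin n) → ℝ) (x : EuclideanSpace ℝ (Fin n)) :
    (Δ g) x = ∑ i, fderiv ℝ (fderiv ℝ g) x (EuclideanSpace.basisFun (Fin n) ℝ i)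
      (EuclideanSpace.basisFun (Fin n) ℝ i) := by
  rw [InnerProductSpace.laplacian_eq_iteratedFDeriv_orthonormalBasis g
    (EuclideanSpace.basisFun (Fin n) ℝ)]
  simp [iteratedFDeriv_two_apply]

lemma inner_fderiv_gradient {g : EuclideanSpace ℝ (Fin n) → ℝ} {x : EuclideanSpace ℝ (Fin n)}
    (hg : ContDiffAt ℝ 2 g x) (u v : EuclideanSpace ℝ (Fin n)) :
    inner ℝ (fderiv ℝ (∇ g) x u) v = fderiv ℝ (fderiv ℝ g) x u v := by
  have h1 : DifferentiableAt ℝ (∇ g) x := (contDiffAt_one_gradient hg).differentiableAt (by norm_num)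
  have h2 : HasFDerivAt (fun z => inner ℝ (∇ g z) v) (fderiv ℝ (fun z => inner ℝ (∇ g z) v) x) x :=
    (h1.inner ℝ (differentiableAt_const v)).hasFDerivAt
  have h3 : (fun z => inner ℝ (∇ g z) v) = fun z => fderiv ℝ g z v := by
    ext z; rw [inner_gradient_left]
  have h4 : DifferentiableAt ℝ (fderiv ℝ g) x :=
    (hg.fderiv_right (m := 1) (by norm_num)).differentiableAt (by norm_num)
  have h5 : fderiv ℝ (fun z => inner ℝ (∇ g z) v) x u = inner ℝ (fderiv ℝ (∇ g) x u) v := by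
    rw [fderiv_inner_apply ℝ h1 (differentiableAt_const v)]
    simp
  rw [← h5, h3, fderiv_clm_apply h4 (differentiableAt_const v)]
  simp

lemma inner_fderiv_gradient_symm {g : EuclideanSpace ℝ (Fin n) → ℝ} {x : EuclideanSpace ℝ (Fin n)}
    (hg : ContDiffAt ℝ 2 g x) (u v : EuclideanSpace ℝ (Fin n)) :
    inner ℝ (fderiv ℝ (∇ g) x u) v = inner ℝ (fderiv ℝ (∇ g) x v) u := by
  rw [inner_fderiv_gradient hg, inner_fderiv_gradient hg]
  exact (hg.isSymmSndFDerivAt (by simp)) u v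

lemma laplacian_eq_sum_inner {g : EuclideanSpace ℝ (Fin n) → ℝ} {x : EuclideanSpace ℝ (Fin n)}
    (hg : ContDiffAt ℝ 2 g x) :
    (Δ g) x = ∑ i, inner ℝ (fderiv ℝ (∇ g) x (EuclideanSpace.basisFun (Fin n) ℝ i))
      (EuclideanSpace.basisFun (Fin n) ℝ i) := by
  rw [laplacian_eq_sum]
  exact Finset.sum_congr rfl fun i _ => (inner_fderiv_gradient hg _ _).symm

/-- If the gradient has constant length near `x`, it lies in the kernel of the Hessian. -/
lemma fderiv_gradient_gradient {g : EuclideanSpace ℝ (Fin n) → ℝ} {x : EuclideanSpace ℝ (Fin n)}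
    (hg : ContDiffAt ℝ 2 g x) (h1 : ∀ᶠ z in 𝓝 x, ‖∇ g z‖ = 1) : fderiv ℝ (∇ g) x (∇ g x) = 0 := by
  have hd : DifferentiableAt ℝ (∇ g) x := (contDiffAt_one_gradient hg).differentiableAt (by norm_num)
  -- Differentiate `‖∇ g‖² = 1`; symmetry of the Hessian then moves the gradient to the other slot.
  have key : ∀ v, inner ℝ (fderiv ℝ (∇ g) x v) (∇ g x) = 0 := by
    intro v
    have hc : (fun z => inner ℝ (∇ g z) (∇ g z)) =ᶠ[𝓝 x] fun _ => (1 : ℝ) := by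
      filter_upwards [h1] with z hz
      rw [real_inner_self_eq_norm_sq, hz, one_pow]
    have h2 := congrArg (fun L => L v) (hc.fderiv_eq (𝕜 := ℝ))
    simp only [fderiv_fun_const, Pi.zero_apply, _root_.zero_apply] at h2
    rw [fderiv_inner_apply ℝ hd hd, real_inner_comm] at h2
    linarith
  refine ext_inner_right ℝ fun v => ?_
  rw [inner_fderiv_gradient_symm hg, key, inner_zero_left]

/-- A symmetric operator whose quadratic form is bounded by `N` has norm at most `N`. -/
lemma norm_le_of_abs_inner_self_le {S : EuclideanSpace ℝ (Fin n) →L[ℝ] EuclideanSpace ℝ (Fin n)}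
    {N : ℝ} (hsymm : ∀ u v, inner ℝ (S u) v = inner ℝ (S v) u)
    (hS : ∀ v, |inner ℝ (S v) v| ≤ N * ‖v‖ ^ 2) (u : EuclideanSpace ℝ (Fin n)) :
    ‖S u‖ ≤ N * ‖u‖ := by
  by_cases hu : u = 0
  · simp [hu]
  by_cases hw : S u = 0
  · have h := (abs_nonneg _).trans (hS u)
    have hu' : 0 < ‖u‖ := norm_pos_iff.2 hu
    rw [hw, norm_zero]
    have : 0 ≤ N * ‖u‖ * ‖u‖ := by linarith
    exact nonneg_of_mul_nonneg_left this hu'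
  have hu' : 0 < ‖u‖ := norm_pos_iff.2 hu
  have hw' : 0 < ‖S u‖ := norm_pos_iff.2 hw
  -- Polarization with `S u` rescaled to the length of `u`; equal lengths make the parallelogram law
  -- give the sharp constant `N`.
  set v := (‖u‖ / ‖S u‖) • S u with hv
  have hvn : ‖v‖ = ‖u‖ := by
    rw [hv, norm_smul, Real.norm_of_nonneg (by positivity)]; field_simp
  have h1 : inner ℝ (S u) v = ‖u‖ * ‖S u‖ := by
    rw [hv, inner_smul_right, real_inner_self_eq_norm_sq]; field_simp
  have h2 : 4 * inner ℝ (S u) v = inner ℝ (S (u + v)) (u + v) - inner ℝ (S (u - v)) (u - v) := by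
    simp only [map_add, map_sub, inner_add_left, inner_add_right, inner_sub_left, inner_sub_right]
    rw [hsymm v u]; ring
  have h3 := (abs_le.1 (hS (u + v))).2
  have h4 := (abs_le.1 (hS (u - v))).1
  have h5 : ‖u + v‖ ^ 2 + ‖u - v‖ ^ 2 = 4 * ‖u‖ ^ 2 := by
    have := parallelogram_law_with_norm ℝ u v
    rw [hvn] at this
    linarith
  have h6 : ‖u‖ * ‖S u‖ ≤ ‖u‖ * (N * ‖u‖) := by
    rw [h1] at h2
    have : N * ‖u + v‖ ^ 2 + N * ‖u - v‖ ^ 2 = N * (4 * ‖u‖ ^ 2) := by rw [← mul_add, h5]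
    linarith
  exact le_of_mul_le_mul_left h6 hu'

/-- The Hessians `R` and `S` of the signed distance at a point at signed distance `l` from the
surface and at its foot satisfy `R = S - l S R`. -/
lemma hessian_parallel {A O : Set (EuclideanSpace ℝ (Fin n))} {η : ℝ}
    (hA : (frontier A).Nonempty) (hne : frontier A ≠ univ) (hO : IsOpen O)
    (hη : Metric.thickening η (frontier A) ⊆ O) (hηpos : 0 < η)
    (hd : ContDiffOn ℝ 2 (signedDist A) O) {x y : EuclideanSpace ℝ (Fin n)} (hx : x ∈ O)
    (hy : y ∈ frontier A) (hxy : ‖x - y‖ = |signedDist A x|) (hl : signedDist A x ≠ 0)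
    (v : EuclideanSpace ℝ (Fin n)) :
    fderiv ℝ (∇ (signedDist A)) x v = fderiv ℝ (∇ (signedDist A)) y v -
      signedDist A x • fderiv ℝ (∇ (signedDist A)) y (fderiv ℝ (∇ (signedDist A)) x v) := by
  set d := signedDist A with hddef
  have hAO : frontier A ⊆ O := (Metric.self_subset_thickening hηpos _).trans hη
  have hcd : ∀ z ∈ O, ContDiffAt ℝ 2 d z := fun z hz => hd.contDiffAt (hO.mem_nhds hz)
  have hdiff : ∀ z ∈ O, DifferentiableAt ℝ d z := fun z hz => (hcd z hz).differentiableAt (by norm_num)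
  have hG : ∀ z ∈ O, DifferentiableAt ℝ (∇ d) z := fun z hz =>
    (contDiffAt_one_gradient (hcd z hz)).differentiableAt (by norm_num)
  have foot : ∀ z ∈ O, d z ≠ 0 → ∀ w ∈ frontier A, ‖z - w‖ = |d z| →
      z - d z • ∇ d z = w ∧ ∇ d w = ∇ d z := by
    intro z hz hz0 w hw hzw
    have e1 := smul_gradient_signedDist hw hzw (s := 1) ⟨zero_le_one, le_rfl⟩
      (by simpa using hdiff z hz)
    have e0 := smul_gradient_signedDist hw hzw (s := 0) ⟨le_rfl, zero_le_one⟩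
      (by simpa using hdiff w (hAO hw))
    simp only [one_smul, add_sub_cancel, zero_smul, add_zero] at e0 e1
    refine ⟨?_, ?_⟩
    · rw [e1]; abel
    · exact smul_right_injective _ hz0 (e0.trans e1.symm)
  obtain ⟨hfx, hgx⟩ := foot x hx hl y hy hxy
  -- The gradient is unchanged under projection to the surface. The chain rule gives `R = S (1 - d R
  -- - ∇d ⊗ Dd)`, and the rank-one term drops out because `S` annihilates the normal.
  have hev : (fun z => ∇ d (z - d z • ∇ d z)) =ᶠ[𝓝 x] ∇ d := by
    filter_upwards [hO.mem_nhds hx, (hdiff x hx).continuousAt.eventually_ne hl] with z hz hz0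
    obtain ⟨w, hw, hzw⟩ := exists_foot hA z
    obtain ⟨e1, e2⟩ := foot z hz hz0 w hw hzw
    rw [e1, e2]
  have hπ : HasFDerivAt (fun z => z - d z • ∇ d z) (ContinuousLinearMap.id ℝ _ -
      (d x • fderiv ℝ (∇ d) x + (fderiv ℝ d x).smulRight (∇ d x))) x :=
    (hasFDerivAt_id x).sub ((hdiff x hx).hasFDerivAt.smul (hG x hx).hasFDerivAt)
  have hGy : HasFDerivAt (∇ d) (fderiv ℝ (∇ d) y) (x - d x • ∇ d x) := by
    rw [hfx]; exact (hG y (hAO hy)).hasFDerivAt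
  have hcomp := (hGy.comp x hπ).fderiv
  have hcomp' : fderiv ℝ (∇ d) x = _ := hev.fderiv_eq.symm.trans hcomp
  have hker : fderiv ℝ (∇ d) y (∇ d x) = 0 := by
    rw [← hgx]
    refine fderiv_gradient_gradient (hcd y (hAO hy)) ?_
    filter_upwards [hO.mem_nhds (hAO hy)] with z hz
    exact norm_gradient_signedDist hA hne hO hAO hd hz
  have h := congrArg (fun L => L v) hcomp'
  simp only [ContinuousLinearMap.comp_apply, _root_.sub_apply,
    _root_.add_apply, _root_.smul_apply,
    ContinuousLinearMap.smulRight_apply, ContinuousLinearMap.id_apply, map_sub, map_add, map_smul,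
    hker, smul_zero, add_zero] at h
  exact h

/-- The Laplacian of the signed distance changes slowly across the parallel surfaces. -/
lemma abs_laplacian_sub_le {A O : Set (EuclideanSpace ℝ (Fin n))} {η N : ℝ}
    (hA : (frontier A).Nonempty) (hne : frontier A ≠ univ) (hO : IsOpen O)
    (hη : Metric.thickening η (frontier A) ⊆ O) (hηpos : 0 < η)
    (hd : ContDiffOn ℝ 2 (signedDist A) O) (hN : 0 < N)
    (hcurv : ∀ y ∈ frontier A, PrincipalCurvaturesLE A N y)
    {x y : EuclideanSpace ℝ (Fin n)} (hx : x ∈ O)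
    (hy : y ∈ frontier A) (hxy : ‖x - y‖ = |signedDist A x|) (hl : N * |signedDist A x| ≤ 1 / 2) :
    |(Δ (signedDist A)) x - (Δ (signedDist A)) y| ≤ 2 * n * N ^ 2 * |signedDist A x| := by
  by_cases hl0 : signedDist A x = 0
  · have : x = y := by
      rw [hl0, abs_zero, norm_eq_zero] at hxy
      exact sub_eq_zero.1 hxy
    rw [this, sub_self, abs_zero]; positivity
  have key := hessian_parallel hA hne hO hη hηpos hd hx hy hxy hl0
  set d := signedDist A with hddef
  have hAO : frontier A ⊆ O := (Metric.self_subset_thickening hηpos _).trans hη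
  have hcd : ∀ z ∈ O, ContDiffAt ℝ 2 d z := fun z hz => hd.contDiffAt (hO.mem_nhds hz)
  have hcy := hcd y (hAO hy)
  set S := fderiv ℝ (∇ d) y with hS
  set R := fderiv ℝ (∇ d) x with hR
  have hsymm := inner_fderiv_gradient_symm hcy
  have hnorm : ∀ z ∈ O, ‖∇ d z‖ = 1 := fun z hz => norm_gradient_signedDist hA hne hO hAO hd hz
  have hker : S (∇ d y) = 0 := by
    refine fderiv_gradient_gradient hcy ?_
    filter_upwards [hO.mem_nhds (hAO hy)] with z hz using hnorm z hz
  -- The curvature bound concerns tangent vectors; removing the normal component, which lies in the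
  -- kernel of `S`, extends it to all `v`.
  have hSq : ∀ v, |inner ℝ (S v) v| ≤ N * ‖v‖ ^ 2 := by
    intro v
    set ν := ∇ d y with hν
    have hν1 : ‖ν‖ = 1 := hnorm y (hAO hy)
    set b := inner ℝ ν v with hb
    have e1 : inner ℝ (S v) v = inner ℝ (S (v - b • ν)) (v - b • ν) := by
      rw [map_sub, map_smul, hker, smul_zero, sub_zero, inner_sub_right, inner_smul_right,
        hsymm v ν, hker, inner_zero_left, mul_zero, sub_zero]
    have e2 : inner ℝ ν (v - b • ν) = 0 := by
      rw [inner_sub_right, inner_smul_right, real_inner_self_eq_norm_sq, hν1, ← hb]; ring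
    have e3 := hcurv y hy (v - b • ν) (by rw [← inner_gradient_left]; exact e2)
    rw [← hddef, ← inner_fderiv_gradient hcy] at e3
    have e4 : ‖v - b • ν‖ ^ 2 ≤ ‖v‖ ^ 2 := by
      rw [@norm_sub_sq_real, inner_smul_right, real_inner_comm, ← hb, norm_smul, hν1,
        Real.norm_eq_abs, mul_one, sq_abs]
      nlinarith [sq_nonneg b]
    rw [e1]
    exact e3.trans (by gcongr)
  have hSn := norm_le_of_abs_inner_self_le hsymm hSq
  -- From `R = S - d S R` and `N |d| ≤ 1/2`: half of `‖R v‖` is absorbed on the left.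
  have hRn : ∀ v, ‖R v‖ ≤ 2 * N * ‖v‖ := by
    intro v
    have e1 : ‖R v‖ ≤ ‖S v‖ + |d x| * ‖S (R v)‖ := by
      conv_lhs => rw [key v]
      refine (norm_sub_le _ _).trans ?_
      rw [norm_smul, Real.norm_eq_abs]
    have e2 := hSn v
    have e3 : |d x| * ‖S (R v)‖ ≤ |d x| * (N * ‖R v‖) := by gcongr; exact hSn _
    have e4 : |d x| * (N * ‖R v‖) ≤ 1 / 2 * ‖R v‖ := by
      rw [← mul_assoc, mul_comm |d x|]; gcongr
    linarith
  rw [laplacian_eq_sum_inner (hcd x hx), laplacian_eq_sum_inner hcy, ← Finset.sum_sub_distrib]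
  refine (Finset.abs_sum_le_sum_abs _ _).trans ?_
  -- Each diagonal entry of `R - S = -d S R` is at most `|d| · N · 2N`.
  have hterm : ∀ i ∈ (Finset.univ : Finset (Fin n)),
      |inner ℝ (R (EuclideanSpace.basisFun (Fin n) ℝ i)) (EuclideanSpace.basisFun (Fin n) ℝ i)
      - inner ℝ (S (EuclideanSpace.basisFun (Fin n) ℝ i)) (EuclideanSpace.basisFun (Fin n) ℝ i)|
      ≤ 2 * N ^ 2 * |d x| := by
    intro i _
    set e := EuclideanSpace.basisFun (Fin n) ℝ i with he
    have hen : ‖e‖ = 1 := (EuclideanSpace.basisFun (Fin n) ℝ).orthonormal.1 i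
    rw [← inner_sub_left]
    refine (abs_real_inner_le_norm _ _).trans ?_
    rw [key e, hen, mul_one, sub_sub_cancel_left, norm_neg, norm_smul, Real.norm_eq_abs]
    have e2 : ‖S (R e)‖ ≤ N * (2 * N * 1) := by
      refine (hSn _).trans ?_
      have := hRn e
      rw [hen] at this
      gcongr
    calc |d x| * ‖S (R e)‖ ≤ |d x| * (N * (2 * N * 1)) := by gcongr
      _ = _ := by ring
  refine (Finset.sum_le_sum hterm).trans (le_of_eq ?_)
  rw [Finset.sum_const, Finset.card_univ, Fintype.card_fin, nsmul_eq_mul]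
  ring

end AllenCahn

namespace AllenCahn

variable {n : ℕ}

/-! ### The evolution equation of the signed distance near the surface. -/

section Flow

variable {D O : Set (EuclideanSpace ℝ (Fin n))} {U : ℝ → Set (EuclideanSpace ℝ (Fin n))}
  {g : ℝ → ℝ} {N η τ t : ℝ} {x : EuclideanSpace ℝ (Fin n)}

lemma IsForcedCurvatureFlow.frontier_subset (hf : IsForcedCurvatureFlow D O U g N η τ)
    (hη : 0 < η) (ht : t ∈ Icc 0 τ) : frontier (U t) ⊆ O :=
  (Metric.self_subset_thickening hη _).trans (hf.nbhd t ht)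

lemma IsForcedCurvatureFlow.frontier_ne_univ (hf : IsForcedCurvatureFlow D O U g N η τ)
    (hn : 2 ≤ n) (hD : Bornology.IsBounded D) (hη : 0 < η) (ht : t ∈ Icc 0 τ) :
    frontier (U t) ≠ univ := by
  intro h
  have : Nonempty (Fin n) := ⟨⟨0, by omega⟩⟩
  refine NormedSpace.unbounded_univ ℝ (EuclideanSpace ℝ (Fin n)) (hD.subset ?_)
  rw [← h]
  exact (hf.frontier_subset hη ht).trans hf.subset

lemma IsForcedCurvatureFlow.norm_gradient (hf : IsForcedCurvatureFlow D O U g N η τ)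
    (hn : 2 ≤ n) (hD : Bornology.IsBounded D) (hη : 0 < η) (ht : t ∈ Icc 0 τ) (hx : x ∈ O) :
    ‖∇ (signedDist (U t)) x‖ = 1 :=
  norm_gradient_signedDist (hf.nonempty t ht) (hf.frontier_ne_univ hn hD hη ht) hf.isOpen
    (hf.frontier_subset hη ht) (hf.space t ht) hx

/-- Close to the evolving surface, the signed distance almost solves the forced heat equation. -/
lemma IsForcedCurvatureFlow.abs_deriv_sub_laplacian_le (hf : IsForcedCurvatureFlow D O U g N η τ)
    (hn : 2 ≤ n) (hD : Bornology.IsBounded D) (hη : 0 < η) (hN : 0 < N) (ht : t ∈ Ioo 0 τ)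
    (hx : x ∈ O) (hl : N * |signedDist (U t) x| ≤ 1 / 2) :
    |deriv (fun s => signedDist (U s) x) t - (Δ (signedDist (U t))) x + g t|
      ≤ 2 * n * N ^ 2 * |signedDist (U t) x| := by
  have ht' : t ∈ Icc 0 τ := ⟨ht.1.le, ht.2.le⟩
  obtain ⟨y, hy, hxy⟩ := exists_foot (hf.nonempty t ht') x
  have hyO := hf.frontier_subset hη ht' hy
  have hlap := abs_laplacian_sub_le (hf.nonempty t ht') (hf.frontier_ne_univ hn hD hη ht')
    hf.isOpen (hf.nbhd t ht') hη (hf.space t ht') hN (hf.curvature t ht') hx hy hxy hl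
  have hdx := hf.time t ht x hx
  have hdy := hf.time t ht y hyO
  have hy0 : signedDist (U t) y = 0 := signedDist_eq_zero_of_mem hy
  have htime : deriv (fun s => signedDist (U s) x) t = deriv (fun s => signedDist (U s) y) t := by
    -- At every time `s` the difference is bounded by `‖x - y‖` in absolute value, and at `s = t`
    -- this bound is attained, since `y` is the foot of `x`.
    have hext : IsLocalExtr (fun s => signedDist (U s) x - signedDist (U s) y) t := by
      rcases le_total 0 (signedDist (U t) x) with h | h
      · right
        refine Eventually.of_forall fun s => ?_
        have := signedDist_sub_le (U s) x y
        rw [dist_eq_norm, hxy, abs_of_nonneg h] at this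
        simpa [hy0] using this
      · left
        refine Eventually.of_forall fun s => ?_
        have := signedDist_sub_le (U s) y x
        rw [dist_comm, dist_eq_norm, hxy, abs_of_nonpos h] at this
        simp only [hy0]
        linarith
    have := hext.deriv_eq_zero
    rw [deriv_fun_sub hdx hdy] at this
    linarith
  have hvel := hf.velocity t ht y hy
  have hn1 : (n : ℝ) - 1 ≠ 0 := by
    have : (2 : ℝ) ≤ n := by exact_mod_cast hn
    linarith
  rw [normalVelocity, meanCurvature, mul_div_cancel₀ _ hn1] at hvel
  rw [htime, abs_sub_comm] at *
  convert hlap using 2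
  linarith

end Flow

/-! ### The comparison principle -/

lemma laplacian_nonpos_of_isLocalMax {g : EuclideanSpace ℝ (Fin n) → ℝ}
    {x : EuclideanSpace ℝ (Fin n)} (hg : ContDiffAt ℝ 2 g x) (hmax : IsLocalMax g x) :
    (Δ g) x ≤ 0 := by
  rw [laplacian_eq_sum]
  refine Finset.sum_nonpos fun i _ => ?_
  set e := EuclideanSpace.basisFun (Fin n) ℝ i
  have hl : ∀ s : ℝ, HasDerivAt (fun s : ℝ => x + s • e) e s := fun s => by
    simpa using ((hasDerivAt_id s).smul_const e).const_add x
  have hx0 : x + (0 : ℝ) • e = x := by simp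
  have hlc : Tendsto (fun s : ℝ => x + s • e) (𝓝 0) (𝓝 x) := by
    have := (hl 0).continuousAt.tendsto
    rwa [hx0] at this
  have h1 : deriv (fun s : ℝ => g (x + s • e)) =ᶠ[𝓝 0] fun s => fderiv ℝ g (x + s • e) e := by
    filter_upwards [hlc.eventually ((hg.of_le (m := 1) (by norm_num)).eventually (by simp))] with s hs
    exact ((hs.differentiableAt (by norm_num)).hasFDerivAt.comp_hasDerivAt s (hl s)).deriv
  have h2 : HasDerivAt (fun s : ℝ => fderiv ℝ g (x + s • e) e) (fderiv ℝ (fderiv ℝ g) x e e) 0 := by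
    have h3 : HasFDerivAt (fderiv ℝ g) (fderiv ℝ (fderiv ℝ g) x) (x + (0 : ℝ) • e) := by
      rw [hx0]
      exact ((hg.fderiv_right (m := 1) (by norm_num)).differentiableAt (by norm_num)).hasFDerivAt
    have h4 : HasDerivAt (fun s : ℝ => fderiv ℝ g (x + s • e)) (fderiv ℝ (fderiv ℝ g) x e) 0 :=
      h3.comp_hasDerivAt (0 : ℝ) (hl 0)
    exact (ContinuousLinearMap.apply ℝ ℝ e).hasFDerivAt.comp_hasDerivAt (0 : ℝ) h4
  have h3 : deriv (deriv (fun s : ℝ => g (x + s • e))) 0 = fderiv ℝ (fderiv ℝ g) x e e := by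
    rw [h1.deriv_eq, h2.deriv]
  rw [← h3]
  refine deriv_deriv_nonpos_of_isLocalMax ?_ ?_
  · have := hlc.eventually hmax
    simpa [IsLocalMax, IsMaxFilter, hx0] using this
  · have h5 : ContinuousAt g (x + (0 : ℝ) • e) := by rw [hx0]; exact hg.continuousAt
    exact ContinuousAt.comp (f := fun s : ℝ => x + s • e) h5 (hl 0).continuousAt

lemma nonpos_of_hasDerivWithinAt_Ici {h : ℝ → ℝ} {h' b : ℝ} (hd : HasDerivWithinAt h h' (Ici b) b)
    (hle : ∀ᶠ s in 𝓝[>] b, h s ≤ h b) : h' ≤ 0 := by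
  have h1 := (hasDerivWithinAt_iff_tendsto_slope' (by simp)).1 (hd.mono Ioi_subset_Ici_self)
  refine le_of_tendsto h1 ?_
  filter_upwards [hle, self_mem_nhdsWithin] with s hs hsb
  rw [slope_def_field]
  exact div_nonpos_of_nonpos_of_nonneg (by linarith) (sub_nonneg.2 (le_of_lt hsb))

lemma nonneg_of_hasDerivAt_of_le_left {h : ℝ → ℝ} {h' b : ℝ} (hd : HasDerivAt h h' b)
    (hle : ∀ᶠ s in 𝓝[<] b, h s ≤ h b) : 0 ≤ h' := by
  have h1 := (hasDerivWithinAt_iff_tendsto_slope' (by simp)).1 (hd.hasDerivWithinAt (s := Iio b))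
  refine ge_of_tendsto h1 ?_
  filter_upwards [hle, self_mem_nhdsWithin] with s hs hsb
  rw [slope_def_field]
  exact div_nonneg_of_nonpos (by linarith) (sub_nonpos.2 (le_of_lt hsb))

namespace IsDefiningFunction

variable {D : Set (EuclideanSpace ℝ (Fin n))} {r : EuclideanSpace ℝ (Fin n) → ℝ}
  {x : EuclideanSpace ℝ (Fin n)}

lemma isOpen (hr : IsDefiningFunction r D) : IsOpen D := by
  rw [hr.eq_neg]; exact isOpen_lt hr.contDiff.continuous continuous_const

lemma eq_zero_of_mem_frontier (hr : IsDefiningFunction r D) (hx : x ∈ frontier D) : r x = 0 := by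
  rw [hr.eq_neg] at hx
  exact frontier_lt_subset_eq hr.contDiff.continuous continuous_const hx

lemma hasDerivAt_normal (hr : IsDefiningFunction r D) (hx : x ∈ frontier D) :
    HasDerivAt (fun s : ℝ => r (x - s • outerNormal r x)) (-‖∇ r x‖) 0 := by
  have hl : HasDerivAt (fun s : ℝ => x - s • outerNormal r x) (-outerNormal r x) 0 := by
    simpa using ((hasDerivAt_id (0 : ℝ)).smul_const (outerNormal r x)).const_sub x
  have hd : HasFDerivAt r (fderiv ℝ r x) (x - (0 : ℝ) • outerNormal r x) := by
    rw [zero_smul, sub_zero]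
    exact (hr.contDiff.differentiable (by norm_num) x).hasFDerivAt
  refine (hd.comp_hasDerivAt (0 : ℝ) hl).congr_deriv ?_
  have hne : ‖∇ r x‖ ≠ 0 := norm_ne_zero_iff.2 (hr.gradient_ne x (hr.eq_zero_of_mem_frontier hx))
  rw [map_neg, outerNormal, map_smul, ← inner_gradient_left, real_inner_self_eq_norm_sq, smul_eq_mul]
  field_simp

lemma eventually_normal_mem (hr : IsDefiningFunction r D) (hx : x ∈ frontier D) :
    ∀ᶠ s in 𝓝[>] (0 : ℝ), x - s • outerNormal r x ∈ D := by
  have h1 := (hasDerivWithinAt_iff_tendsto_slope' (by simp)).1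
    ((hr.hasDerivAt_normal hx).hasDerivWithinAt (s := Ioi 0))
  have hpos : 0 < ‖∇ r x‖ := norm_pos_iff.2 (hr.gradient_ne x (hr.eq_zero_of_mem_frontier hx))
  filter_upwards [h1.eventually (gt_mem_nhds (show -‖∇ r x‖ < 0 by linarith)),
    self_mem_nhdsWithin] with s hs hs0
  rw [slope_def_field, zero_smul, sub_zero, sub_zero, hr.eq_zero_of_mem_frontier hx, sub_zero] at hs
  rw [hr.eq_neg]
  have hs0 : 0 < s := hs0
  change r _ < 0
  by_contra! h
  exact absurd hs (not_lt.2 (div_nonneg h hs0.le))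

end IsDefiningFunction

/-- Since `f' ≤ 1`, the weight `exp (-ε⁻² t)` absorbs the reaction term in the comparison argument.
-/
lemma f_sub_f_le_sub {a b : ℝ} (h : b ≤ a) : f a - f b ≤ a - b := by
  rw [f_sub_f]
  nlinarith [mul_nonneg (sub_nonneg.2 h) (show 0 ≤ a ^ 2 + a * b + b ^ 2 by
    nlinarith [sq_nonneg (a + b), sq_nonneg a, sq_nonneg b])]

lemma continuous_laplacian {g : EuclideanSpace ℝ (Fin n) → ℝ} (hg : ContDiff ℝ 2 g) :
    Continuous (Δ g) := by
  rw [InnerProductSpace.laplacian_eq_iteratedFDeriv_orthonormalBasis g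
    (EuclideanSpace.basisFun (Fin n) ℝ)]
  have := hg.continuous_iteratedFDeriv (m := 2) (by norm_num)
  fun_prop

end AllenCahn

namespace AllenCahn

variable {n : ℕ} {D : Set (EuclideanSpace ℝ (Fin n))} {r : EuclideanSpace ℝ (Fin n) → ℝ}
  {ε τ : ℝ} {ξ : ℝ → ℝ} {v w : EuclideanSpace ℝ (Fin n) → ℝ → ℝ}

lemma IsClassical.continuousOn_time (hv : IsClassical D τ v) {x : EuclideanSpace ℝ (Fin n)}
    (hx : x ∈ closure D) : ContinuousOn (fun s => v x s) (Icc 0 τ) :=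
  hv.cont.comp (f := fun s : ℝ => (x, s)) (by fun_prop) fun s hs => ⟨hx, hs⟩

lemma IsClassical.continuousOn_space (hv : IsClassical D τ v) {t : ℝ} (ht : t ∈ Icc 0 τ) :
    ContinuousOn (fun x => v x t) (closure D) :=
  hv.cont.comp (f := fun x : EuclideanSpace ℝ (Fin n) => (x, t)) (by fun_prop) fun x hx => ⟨hx, ht⟩

/-- After the exponential weighting, the term `-κ (r + M + (M' + 1) s)` makes the differential
inequality strict: its heat operator is at most `-κ` as `Δ r ≤ M'`. At a maximum the heat operator
is nonnegative. -/
lemma comparison_interior (hD : IsOpen D) (hr : ContDiff ℝ 2 r) (hv : IsSubsolution D r ε ξ τ v)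
    (hw : IsSupersolution D r ε ξ τ w) {t₀ κ M M' : ℝ} {x₀ : EuclideanSpace ℝ (Fin n)}
    (ht₀ : t₀ ∈ Ioo 0 τ) (hx₀ : x₀ ∈ D) (hκ : 0 < κ) (hM' : (Δ r) x₀ ≤ M')
    (hwv : w x₀ t₀ ≤ v x₀ t₀)
    (hmax : ∀ x ∈ D, ∀ s ∈ Icc 0 t₀,
      Real.exp (-(ε ^ 2)⁻¹ * s) * (v x s - w x s) - κ * (r x + M + (M' + 1) * s) ≤
      Real.exp (-(ε ^ 2)⁻¹ * t₀) * (v x₀ t₀ - w x₀ t₀) - κ * (r x₀ + M + (M' + 1) * t₀)) :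
    False := by
  set lam := (ε ^ 2)⁻¹ with hlam
  have hlam0 : 0 ≤ lam := by positivity
  set e := Real.exp (-lam * t₀) with he
  have hepos : 0 < e := Real.exp_pos _
  have hDx : D ∈ 𝓝 x₀ := hD.mem_nhds hx₀
  have hcv : ContDiffAt ℝ 2 (fun x => v x t₀) x₀ := (hv.classical.space t₀ ht₀).contDiffAt hDx
  have hcw : ContDiffAt ℝ 2 (fun x => w x t₀) x₀ := (hw.classical.space t₀ ht₀).contDiffAt hDx
  have hcr : ContDiffAt ℝ 2 r x₀ := hr.contDiffAt
  have hcvw : ContDiffAt ℝ 2 ((fun x => v x t₀) - fun x => w x t₀) x₀ := hcv.sub hcw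
  have hce : ContDiffAt ℝ 2 (e • ((fun x => v x t₀) - fun x => w x t₀)) x₀ := hcvw.const_smul e
  have hcκ : ContDiffAt ℝ 2 (κ • r) x₀ := hcr.const_smul κ
  have hspace : e * ((Δ fun x => v x t₀) x₀ - (Δ fun x => w x t₀) x₀) - κ * (Δ r) x₀ ≤ 0 := by
    have h1 : (Δ (e • ((fun x => v x t₀) - fun x => w x t₀) - κ • r)) x₀ =
        e * ((Δ fun x => v x t₀) x₀ - (Δ fun x => w x t₀) x₀) - κ * (Δ r) x₀ := by
      rw [ContDiffAt.laplacian_sub hce hcκ,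
        InnerProductSpace.laplacian_smul e hcvw, InnerProductSpace.laplacian_smul κ hcr,
        ContDiffAt.laplacian_sub hcv hcw, smul_eq_mul, smul_eq_mul]
    rw [← h1]
    refine laplacian_nonpos_of_isLocalMax (hce.sub hcκ) ?_
    filter_upwards [hDx] with x hx
    have := hmax x hx t₀ ⟨ht₀.1.le, le_rfl⟩
    simp only [Pi.sub_apply, Pi.smul_apply, smul_eq_mul]
    linarith
  have hdv := (hv.classical.time t₀ ht₀ x₀ hx₀).hasDerivAt
  have hdw := (hw.classical.time t₀ ht₀ x₀ hx₀).hasDerivAt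
  have hE : HasDerivAt (fun s => Real.exp (-lam * s)) (e * -lam) t₀ := by
    simpa [he] using ((hasDerivAt_id t₀).const_mul (-lam)).exp
  have hlin : HasDerivAt (fun s => κ * (r x₀ + M + (M' + 1) * s)) (κ * (M' + 1)) t₀ := by
    simpa using (((hasDerivAt_id t₀).const_mul (M' + 1)).const_add (r x₀ + M)).const_mul κ
  have htime := nonneg_of_hasDerivAt_of_le_left ((hE.mul (hdv.sub hdw)).sub hlin) (by
    filter_upwards [Ioo_mem_nhdsLT ht₀.1] with s hs
    exact hmax x₀ hx₀ s ⟨hs.1.le, hs.2.le⟩)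
  simp only [Pi.sub_apply] at htime
  have h1 := hv.ineq t₀ ht₀ x₀ hx₀
  have h2 := hw.ineq t₀ ht₀ x₀ hx₀
  simp only [residual, ← hlam] at h1 h2
  have h3 : lam * (f (v x₀ t₀) - f (w x₀ t₀)) ≤ lam * (v x₀ t₀ - w x₀ t₀) := by
    exact mul_le_mul_of_nonneg_left (f_sub_f_le_sub hwv) hlam0
  have h4 : deriv (fun s => v x₀ s) t₀ - deriv (fun s => w x₀ s) t₀
      - lam * (v x₀ t₀ - w x₀ t₀) ≤ (Δ fun x => v x t₀) x₀ - (Δ fun x => w x t₀) x₀ := by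
    linarith
  have h5 := mul_le_mul_of_nonneg_left h4 hepos.le
  have h6 : κ * (Δ r) x₀ ≤ κ * M' := by gcongr
  nlinarith

/-- The term `-κ r` has strictly negative outer normal derivative `-κ ‖∇ r‖`, which excludes a
boundary maximum without appeal to the Hopf lemma. -/
lemma comparison_boundary (hr : IsDefiningFunction r D) (hv : IsSubsolution D r ε ξ τ v)
    (hw : IsSupersolution D r ε ξ τ w) {t₀ κ e b : ℝ} {x₀ : EuclideanSpace ℝ (Fin n)}
    (ht₀ : t₀ ∈ Ioo 0 τ) (hx₀ : x₀ ∈ frontier D) (hκ : 0 < κ) (he : 0 < e)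
    (hmax : ∀ x ∈ D, e * (v x t₀ - w x t₀) - κ * (r x + b) ≤
      e * (v x₀ t₀ - w x₀ t₀) - κ * (r x₀ + b)) :
    False := by
  obtain ⟨q, hq, hq0⟩ := hv.neumann t₀ ht₀ x₀ hx₀
  obtain ⟨p, hp, hp0⟩ := hw.neumann t₀ ht₀ x₀ hx₀
  have hpos : 0 < ‖∇ r x₀‖ := norm_pos_iff.2 (hr.gradient_ne x₀ (hr.eq_zero_of_mem_frontier hx₀))
  have hd := ((hq.sub hp).const_mul e).sub
    (((hr.hasDerivAt_normal hx₀).hasDerivWithinAt.add_const b).const_mul κ)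
  have := nonpos_of_hasDerivWithinAt_Ici hd (by
    filter_upwards [hr.eventually_normal_mem hx₀] with s hs
    simpa using hmax _ hs)
  nlinarith [mul_nonneg he.le (neg_nonneg.2 hq0), mul_nonneg he.le hp0, mul_pos hκ hpos]

/-- A subsolution that is initially below a supersolution stays below it. -/
theorem comparison (hD : Bornology.IsBounded D) (hr : IsDefiningFunction r D)
    (hv : IsSubsolution D r ε ξ τ v) (hw : IsSupersolution D r ε ξ τ w)
    (h0 : ∀ x ∈ D, v x 0 ≤ w x 0) : ∀ x ∈ D, ∀ t ∈ Icc 0 τ, v x t ≤ w x t := by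
  have hK : IsCompact (closure D) := hD.isCompact_closure
  obtain ⟨M, hM⟩ := hK.exists_bound_of_continuousOn hr.contDiff.continuous.continuousOn
  obtain ⟨M', hM'⟩ := hK.exists_bound_of_continuousOn
    (continuous_laplacian hr.contDiff).continuousOn
  -- For `t₁ < τ` a maximum at the final time `t₁` still lies where the differential inequalities
  -- hold; `t = τ` follows by continuity.
  have main : ∀ t₁ ∈ Ioo 0 τ, ∀ x ∈ D, v x t₁ ≤ w x t₁ := by
    intro t₁ ht₁ x hx
    have h0' : ∀ y ∈ closure D, v y 0 ≤ w y 0 := by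
      have hτ : (0 : ℝ) ∈ Icc 0 τ := ⟨le_rfl, (ht₁.1.trans ht₁.2).le⟩
      intro y hy
      exact ContinuousWithinAt.closure_le (f := fun x => v x 0) (g := fun x => w x 0) hy
        ((hv.classical.continuousOn_space hτ y hy).mono subset_closure)
        ((hw.classical.continuousOn_space hτ y hy).mono subset_closure) h0
    have hsub : Icc 0 t₁ ⊆ Icc 0 τ := Icc_subset_Icc_right ht₁.2.le
    have hM0 : 0 ≤ M' := (norm_nonneg _).trans (hM' x (subset_closure hx))
    have key : ∀ κ > 0, Real.exp (-(ε ^ 2)⁻¹ * t₁) * (v x t₁ - w x t₁)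
        - κ * (r x + M + (M' + 1) * t₁) ≤ 0 := by
      intro κ hκ
      have hcont : ContinuousOn (fun q : EuclideanSpace ℝ (Fin n) × ℝ =>
          Real.exp (-(ε ^ 2)⁻¹ * q.2) * (v q.1 q.2 - w q.1 q.2)
          - κ * (r q.1 + M + (M' + 1) * q.2)) (closure D ×ˢ Icc 0 t₁) := by
        have c1 := hv.classical.cont.mono (prod_mono_right (s := closure D) hsub)
        have c2 := hw.classical.cont.mono (prod_mono_right (s := closure D) hsub)
        have c3 := hr.contDiff.continuous
        refine ContinuousOn.sub (ContinuousOn.mul (by fun_prop) (c1.sub c2)) ?_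
        fun_prop
      obtain ⟨⟨x₀, t₀⟩, ⟨hx₀, ht₀⟩, hmax⟩ := (hK.prod isCompact_Icc).exists_isMaxOn
        ⟨(x, t₁), subset_closure hx, ht₁.1.le, le_rfl⟩ hcont
      have hmax' : ∀ y ∈ closure D, ∀ s ∈ Icc 0 t₁,
          Real.exp (-(ε ^ 2)⁻¹ * s) * (v y s - w y s) - κ * (r y + M + (M' + 1) * s) ≤
          Real.exp (-(ε ^ 2)⁻¹ * t₀) * (v x₀ t₀ - w x₀ t₀) - κ * (r x₀ + M + (M' + 1) * t₀) :=
        fun y hy s hs => hmax (show (y, s) ∈ closure D ×ˢ Icc 0 t₁ from ⟨hy, hs⟩)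
      by_contra! hpos
      have hpos₀ := hpos.trans_le (hmax' x (subset_closure hx) t₁ ⟨ht₁.1.le, le_rfl⟩)
      simp only at hx₀ ht₀
      -- `M` makes the subtracted function nonnegative, so a positive maximum can only occur where
      -- `v > w`.
      have hb : 0 ≤ r x₀ + M + (M' + 1) * t₀ := by
        have h1 := (abs_le.1 (hM x₀ hx₀)).1
        have h2 : 0 ≤ (M' + 1) * t₀ := mul_nonneg (by linarith) ht₀.1
        linarith
      have hE : 0 < Real.exp (-(ε ^ 2)⁻¹ * t₀) := Real.exp_pos _
      have hvw : w x₀ t₀ < v x₀ t₀ := by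
        by_contra! h
        nlinarith [mul_nonneg hκ.le hb, mul_nonneg hE.le (sub_nonneg.2 h)]
      have ht₀pos : 0 < t₀ := by
        rcases ht₀.1.lt_or_eq with h | h
        · exact h
        · rw [← h] at hvw; exact absurd (h0' x₀ hx₀) (not_le.2 hvw)
      have ht₀' : t₀ ∈ Ioo 0 τ := ⟨ht₀pos, ht₀.2.trans_lt ht₁.2⟩
      by_cases hxD : x₀ ∈ D
      · refine comparison_interior hr.isOpen hr.contDiff hv hw ht₀' hxD hκ
          ((le_abs_self _).trans (hM' x₀ hx₀)) hvw.le (M := M) fun y hy s hs => ?_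
        exact hmax' y (subset_closure hy) s ⟨hs.1, hs.2.trans ht₀.2⟩
      · have hxF : x₀ ∈ frontier D := ⟨hx₀, by rwa [hr.isOpen.interior_eq]⟩
        refine comparison_boundary hr hv hw ht₀' hxF hκ hE (b := M + (M' + 1) * t₀) fun y hy => ?_
        have := hmax' y (subset_closure hy) t₀ ht₀
        simpa only [add_assoc] using this
    have hlim : Tendsto (fun κ : ℝ => Real.exp (-(ε ^ 2)⁻¹ * t₁) * (v x t₁ - w x t₁)
        - κ * (r x + M + (M' + 1) * t₁)) (𝓝[>] 0)
        (𝓝 (Real.exp (-(ε ^ 2)⁻¹ * t₁) * (v x t₁ - w x t₁)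
        - 0 * (r x + M + (M' + 1) * t₁))) :=
      ((continuous_const.sub (continuous_id.mul continuous_const)).tendsto 0).mono_left
        nhdsWithin_le_nhds
    have := le_of_tendsto hlim (by filter_upwards [self_mem_nhdsWithin] with κ hκ using key κ hκ)
    rw [zero_mul, sub_zero] at this
    by_contra! h
    nlinarith [mul_pos (Real.exp_pos (-(ε ^ 2)⁻¹ * t₁)) (sub_pos.2 h)]
  intro x hx t ht
  rcases ht.1.lt_or_eq with h | h
  · rcases ht.2.lt_or_eq with h' | h'
    · exact main t ⟨h, h'⟩ x hx
    · subst h'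
      have c1 := (hv.classical.continuousOn_time (subset_closure hx) t ht).mono Ioo_subset_Icc_self
      have c2 := (hw.classical.continuousOn_time (subset_closure hx) t ht).mono Ioo_subset_Icc_self
      refine ContinuousWithinAt.closure_le ?_ c1 c2 fun s hs => main s hs x hx
      rw [closure_Ioo h.ne]; exact ht
  · rw [← h]; exact h0 x hx

lemma IsClassical.mono {τ' : ℝ} (hv : IsClassical D τ v) (h : τ' ≤ τ) : IsClassical D τ' v where
  cont := hv.cont.mono (prod_mono_right (Icc_subset_Icc_right h))
  space t ht := hv.space t (Ioo_subset_Ioo_right h ht)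
  time t ht := hv.time t (Ioo_subset_Ioo_right h ht)

lemma IsSubsolution.mono {τ' : ℝ} (hv : IsSubsolution D r ε ξ τ v) (h : τ' ≤ τ) :
    IsSubsolution D r ε ξ τ' v where
  classical := hv.classical.mono h
  ineq t ht := hv.ineq t (Ioo_subset_Ioo_right h ht)
  neumann t ht := hv.neumann t (Ioo_subset_Ioo_right h ht)

lemma IsSupersolution.mono {τ' : ℝ} (hv : IsSupersolution D r ε ξ τ v) (h : τ' ≤ τ) :
    IsSupersolution D r ε ξ τ' v where
  classical := hv.classical.mono h
  ineq t ht := hv.ineq t (Ioo_subset_Ioo_right h ht)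
  neumann t ht := hv.neumann t (Ioo_subset_Ioo_right h ht)

lemma IsSolution.isSubsolution (hv : IsSolution D r ε ξ τ v) : IsSubsolution D r ε ξ τ v where
  classical := hv.classical
  ineq t ht x hx := (hv.eqn t ht x hx).le
  neumann t ht x hx := ⟨0, hv.neumann t ht x hx, le_rfl⟩

lemma IsSolution.isSupersolution (hv : IsSolution D r ε ξ τ v) : IsSupersolution D r ε ξ τ v where
  classical := hv.classical
  ineq t ht x hx := (hv.eqn t ht x hx).ge
  neumann t ht x hx := ⟨0, hv.neumann t ht x hx, le_rfl⟩

end AllenCahn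

namespace AllenCahn

open scoped ContDiff

variable {n : ℕ}

/-! ### The residual of the barriers -/

lemma laplacian_comp {φ : ℝ → ℝ} {h : EuclideanSpace ℝ (Fin n) → ℝ} {x : EuclideanSpace ℝ (Fin n)}
    (hφ : ContDiff ℝ 2 φ) (hh : ContDiffAt ℝ 2 h x) :
    (Δ fun y => φ (h y)) x
      = deriv (deriv φ) (h x) * ‖∇ h x‖ ^ 2 + deriv φ (h x) * (Δ h) x := by
  have hφ1 : Differentiable ℝ φ := hφ.differentiable (by norm_num)
  have hφ2 : Differentiable ℝ (deriv φ) :=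
    ((contDiff_succ_iff_deriv (n := 1)).1 (by simpa [one_add_one_eq_two] using hφ)).2.2.differentiable
      (by norm_num)
  have hh1 : DifferentiableAt ℝ h x := hh.differentiableAt (by norm_num)
  have hh2 : DifferentiableAt ℝ (fderiv ℝ h) x :=
    (hh.fderiv_right (m := 1) (by norm_num)).differentiableAt (by norm_num)
  have h1 : fderiv ℝ (fun y => φ (h y)) =ᶠ[𝓝 x] fun y => deriv φ (h y) • fderiv ℝ h y := by
    filter_upwards [(hh.of_le (m := 1) (by norm_num)).eventually (by simp)] with y hy
    exact ((hφ1 (h y)).hasDerivAt.comp_hasFDerivAt y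
      (hy.differentiableAt (by norm_num)).hasFDerivAt).fderiv
  have h2 : HasFDerivAt (fun y => deriv φ (h y)) (deriv (deriv φ) (h x) • fderiv ℝ h x) x :=
    (hφ2 (h x)).hasDerivAt.comp_hasFDerivAt x hh1.hasFDerivAt
  have h3 : fderiv ℝ (fderiv ℝ fun y => φ (h y)) x = deriv φ (h x) • fderiv ℝ (fderiv ℝ h) x
      + (deriv (deriv φ) (h x) • fderiv ℝ h x).smulRight (fderiv ℝ h x) := by
    rw [h1.fderiv_eq]; exact (h2.smul hh2.hasFDerivAt).fderiv
  have h4 : ‖∇ h x‖ ^ 2 = ∑ i, fderiv ℝ h x (EuclideanSpace.basisFun (Fin n) ℝ i) ^ 2 := by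
    rw [EuclideanSpace.norm_sq_eq]
    refine Finset.sum_congr rfl fun i _ => ?_
    rw [← inner_gradient_left, real_inner_comm, EuclideanSpace.basisFun_inner, Real.norm_eq_abs,
      sq_abs]
  rw [laplacian_eq_sum, laplacian_eq_sum, h3, h4, Finset.mul_sum, Finset.mul_sum,
    ← Finset.sum_add_distrib]
  refine Finset.sum_congr rfl fun i _ => ?_
  simp only [_root_.add_apply, _root_.smul_apply, ContinuousLinearMap.smulRight_apply, smul_eq_mul]
  ring

lemma hasDerivAt_comp_pair {G : ℝ × ℝ → ℝ} {p q : ℝ → ℝ} {p' q' t : ℝ}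
    (hG : DifferentiableAt ℝ G (p t, q t)) (hp : HasDerivAt p p' t) (hq : HasDerivAt q q' t) :
    HasDerivAt (fun s => G (p s, q s))
      (deriv (fun y => G (y, q t)) (p t) * p' + deriv (fun s => G (p t, s)) (q t) * q') t := by
  have h1 : deriv (fun y => G (y, q t)) (p t) = fderiv ℝ G (p t, q t) (1, 0) :=
    (hG.hasFDerivAt.comp_hasDerivAt (p t)
      ((hasDerivAt_id (p t)).prodMk (hasDerivAt_const (p t) (q t)))).deriv
  have h2 : deriv (fun s => G (p t, s)) (q t) = fderiv ℝ G (p t, q t) (0, 1) :=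
    (hG.hasFDerivAt.comp_hasDerivAt (q t)
      ((hasDerivAt_const (q t) (p t)).prodMk (hasDerivAt_id (q t)))).deriv
  refine (hG.hasFDerivAt.comp_hasDerivAt t (hp.prodMk hq)).congr_deriv ?_
  rw [h1, h2, show (p', q') = p' • ((1 : ℝ), (0 : ℝ)) + q' • ((0 : ℝ), (1 : ℝ)) by simp,
    map_add, map_smul, map_smul, smul_eq_mul, smul_eq_mul]
  ring

section Barrier

variable {δ₀ : ℝ} {mMinus mPlus : ℝ → ℝ} {m : ℝ → ℝ → ℝ} {c : ℝ → ℝ}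
  {D O : Set (EuclideanSpace ℝ (Fin n))} {r : EuclideanSpace ℝ (Fin n) → ℝ}
  {d : EuclideanSpace ℝ (Fin n) → ℝ → ℝ} {σ a c₁ β ε τ t : ℝ} {ξ : ℝ → ℝ}
  {x : EuclideanSpace ℝ (Fin n)}

lemma hasDerivAt_barrier_argument (hd : DifferentiableAt ℝ (fun s => d x s) t) :
    HasDerivAt (fun s => (d x s + σ * (ε ^ a * Real.exp (c₁ * s))) / ε)
      ((deriv (fun s => d x s) t + σ * (ε ^ a * (c₁ * Real.exp (c₁ * t)))) / ε) t := by
  have h1 : HasDerivAt (fun s => Real.exp (c₁ * s)) (c₁ * Real.exp (c₁ * t)) t := by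
    have := ((hasDerivAt_id t).const_mul c₁).exp
    simpa [mul_comm] using this
  exact (hd.hasDerivAt.add ((h1.const_mul (ε ^ a)).const_mul σ)).div_const ε

lemma hasDerivAt_barrier (hm : IsTravellingWave δ₀ mMinus mPlus m c)
    (hδ : ε * ξ t + σ * ε ^ β ∈ Ioo (-δ₀) δ₀) (hξ : DifferentiableAt ℝ ξ t)
    (hd : DifferentiableAt ℝ (fun s => d x s) t) :
    HasDerivAt (fun s => barrier m σ a c₁ β ε ξ d x s)
      (deriv (fun y => m y (ε * ξ t + σ * ε ^ β))
          ((d x t + σ * (ε ^ a * Real.exp (c₁ * t))) / ε) *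
        ((deriv (fun s => d x s) t + σ * (ε ^ a * (c₁ * Real.exp (c₁ * t)))) / ε) +
      deriv (fun s => m ((d x t + σ * (ε ^ a * Real.exp (c₁ * t))) / ε) s)
        (ε * ξ t + σ * ε ^ β) * (ε * deriv ξ t)) t :=
  hasDerivAt_comp_pair (G := fun q => m q.1 q.2)
    (p := fun s => (d x s + σ * (ε ^ a * Real.exp (c₁ * s))) / ε)
    (q := fun s => ε * ξ s + σ * ε ^ β)
    ((hm.contDiffAt hδ _).differentiableAt (by simp)) (hasDerivAt_barrier_argument hd)
    ((hξ.hasDerivAt.const_mul ε).add_const _)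

lemma contDiffAt_barrier_argument (hd : ContDiffAt ℝ 2 (fun y => d y t) x) :
    ContDiffAt ℝ 2 (fun y => (d y t + σ * (ε ^ a * Real.exp (c₁ * t))) / ε) x :=
  (hd.add contDiffAt_const).div_const ε

lemma contDiff_two_profile (hm : IsTravellingWave δ₀ mMinus mPlus m c) {δ : ℝ}
    (hδ : δ ∈ Ioo (-δ₀) δ₀) : ContDiff ℝ 2 (fun y => m y δ) := by
  simpa using contDiff_infty.1 (hm.contDiff_profile hδ) 2

lemma laplacian_barrier_argument (hd : ContDiffAt ℝ 2 (fun y => d y t) x) :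
    (Δ fun y => (d y t + σ * (ε ^ a * Real.exp (c₁ * t))) / ε) x = (Δ fun y => d y t) x / ε ∧
    ‖∇ (fun y => (d y t + σ * (ε ^ a * Real.exp (c₁ * t))) / ε) x‖ ^ 2
      = ‖∇ (fun y => d y t) x‖ ^ 2 / ε ^ 2 := by
  set b := σ * (ε ^ a * Real.exp (c₁ * t))
  have hφ : ContDiff ℝ 2 (fun s : ℝ => (s + b) / ε) := (contDiff_id.add contDiff_const).div_const ε
  have h1 : deriv (fun s : ℝ => (s + b) / ε) = fun _ => 1 / ε := by
    ext s; exact (((hasDerivAt_id s).add_const b).div_const ε).deriv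
  have hdd : DifferentiableAt ℝ (fun y => d y t) x := hd.differentiableAt (by norm_num)
  constructor
  · rw [laplacian_comp hφ hd, h1]; simp; ring
  · have h2 : HasFDerivAt (fun y => (d y t + b) / ε) (ε⁻¹ • fderiv ℝ (fun y => d y t) x) x := by
      simpa [div_eq_inv_mul] using (hdd.hasFDerivAt.add_const b).const_mul ε⁻¹
    have h3 : ∇ (fun y => (d y t + b) / ε) x = ε⁻¹ • ∇ (fun y => d y t) x := by
      simp only [gradient]; rw [h2.fderiv, map_smul]
    rw [h3, norm_smul, mul_pow, Real.norm_eq_abs, sq_abs, inv_pow]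
    ring

/-- The wave equation eliminates `f(m)`. Its constant `δ` cancels the noise `ε⁻¹ ξ` up to the offset
`σ ε^β`, which produces the gain `σ ε^{β-2}`. -/
lemma residual_barrier (hm : IsTravellingWave δ₀ mMinus mPlus m c) (hε : 0 < ε)
    (hδ : ε * ξ t + σ * ε ^ β ∈ Ioo (-δ₀) δ₀) (hξ : DifferentiableAt ℝ ξ t)
    (hdt : DifferentiableAt ℝ (fun s => d x s) t) (hdx : ContDiffAt ℝ 2 (fun y => d y t) x) {z δ : ℝ}
    (hz : z = (d x t + σ * (ε ^ a * Real.exp (c₁ * t))) / ε) (hδe : δ = ε * ξ t + σ * ε ^ β) :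
    residual ε ξ (barrier m σ a c₁ β ε ξ d) x t =
      σ * (ε ^ β * (ε ^ 2)⁻¹) + deriv (fun s => m z s) δ * (ε * deriv ξ t)
      + deriv (fun y => m y δ) z * ε⁻¹ * (deriv (fun s => d x s) t - (Δ fun y => d y t) x
        + ε⁻¹ * c δ + σ * (c₁ * (ε ^ a * Real.exp (c₁ * t))))
      + deriv (deriv fun y => m y δ) z * (ε ^ 2)⁻¹ * (1 - ‖∇ (fun y => d y t) x‖ ^ 2) := by
  have h1 := (hasDerivAt_barrier (a := a) (c₁ := c₁) hm hδ hξ hdt).deriv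
  have hb : (fun y => barrier m σ a c₁ β ε ξ d y t) = fun y =>
      m ((d y t + σ * (ε ^ a * Real.exp (c₁ * t))) / ε) (ε * ξ t + σ * ε ^ β) := rfl
  have h2 := laplacian_comp (φ := fun y => m y (ε * ξ t + σ * ε ^ β))
    (h := fun y => (d y t + σ * (ε ^ a * Real.exp (c₁ * t))) / ε) (contDiff_two_profile hm hδ)
      (contDiffAt_barrier_argument (σ := σ) (ε := ε) (a := a) (c₁ := c₁) hdx)
  obtain ⟨h3, h4⟩ := laplacian_barrier_argument (σ := σ) (ε := ε) (a := a) (c₁ := c₁) hdx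
  rw [h3, h4, ← hb] at h2
  have h5 := hm.ode _ ⟨hδ.1.le, hδ.2.le⟩ z
  have h6 : barrier m σ a c₁ β ε ξ d x t = m z δ := by rw [hz, hδe]; rfl
  simp only [← hz, ← hδe] at h1 h2 h5
  simp only [residual]
  rw [h1, h2, h6]
  have h7 : f (m z δ) = -(deriv (deriv fun y => m y δ) z) - c δ * deriv (fun y => m y δ) z - δ := by
    linarith
  rw [h7]
  have h8 : ε⁻¹ * ξ t = (ε ^ 2)⁻¹ * (δ - σ * ε ^ β) := by
    rw [hδe]; field_simp; ring
  rw [h8]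
  field_simp
  ring

lemma barrier_isClassical (hm : IsTravellingWave δ₀ mMinus mPlus m c) (hD : IsOpen D)
    (hd : IsClassical D τ d) (hξ : Differentiable ℝ ξ)
    (hδ : ∀ t ∈ Icc 0 τ, ε * ξ t + σ * ε ^ β ∈ Ioo (-δ₀) δ₀) :
    IsClassical D τ (barrier m σ a c₁ β ε ξ d) where
  cont := by
    have h1 : ContinuousOn (fun q : EuclideanSpace ℝ (Fin n) × ℝ =>
        ((d q.1 q.2 + σ * (ε ^ a * Real.exp (c₁ * q.2))) / ε, ε * ξ q.2 + σ * ε ^ β))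
        (closure D ×ˢ Icc 0 τ) := by
      have h2 := hξ.continuous
      have h3 := hd.cont
      refine ContinuousOn.prodMk ((h3.add ?_).div_const ε) ?_ <;> fun_prop
    refine hm.smooth.continuousOn.comp h1 fun q hq => ⟨mem_univ _, ?_⟩
    exact ⟨(hδ q.2 hq.2).1.le, (hδ q.2 hq.2).2.le⟩
  space t ht x hx := by
    have h1 := contDiffAt_barrier_argument (σ := σ) (ε := ε) (a := a) (c₁ := c₁)
      ((hd.space t ht).contDiffAt (hD.mem_nhds hx))
    exact ((contDiff_two_profile hm (hδ t ⟨ht.1.le, ht.2.le⟩)).contDiffAt.comp x h1).contDiffWithinAt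
  time t ht x hx :=
    (hasDerivAt_barrier hm (hδ t ⟨ht.1.le, ht.2.le⟩) (hξ t) (hd.time t ht x hx)).differentiableAt

lemma barrier_neumann (hr : IsDefiningFunction r D) (hx : x ∈ frontier D)
    (hd : ∀ᶠ y in 𝓝[closure D] x, d y t = d x t) :
    HasOuterNormalDeriv r (fun y => barrier m σ a c₁ β ε ξ d y t) x 0 := by
  have hl : Tendsto (fun s : ℝ => x - s • outerNormal r x) (𝓝[>] 0) (𝓝[closure D] x) := by
    rw [tendsto_nhdsWithin_iff]
    refine ⟨?_, (hr.eventually_normal_mem hx).mono fun s hs => subset_closure hs⟩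
    have : Continuous fun s : ℝ => x - s • outerNormal r x := by fun_prop
    have h := this.tendsto 0
    simp only [zero_smul, sub_zero] at h
    exact h.mono_left nhdsWithin_le_nhds
  have h1 : ∀ᶠ s in 𝓝[>] (0 : ℝ), d (x - s • outerNormal r x) t = d x t := hl.eventually hd
  unfold HasOuterNormalDeriv
  rw [neg_zero, ← hasDerivWithinAt_Ioi_iff_Ici]
  refine (hasDerivWithinAt_const (0 : ℝ) (Ioi 0)
    (barrier m σ a c₁ β ε ξ d x t)).congr_of_eventuallyEq ?_ (by simp)
  filter_upwards [h1] with s hs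
  simp only [barrier, hs]

end Barrier

end AllenCahn

namespace AllenCahn

variable {n : ℕ}

/-! ### The sign of the residual for small `ε`. -/

section Sign

variable {δ₀ δ₁ A l N η K L T Cξ : ℝ} {mMinus mPlus : ℝ → ℝ} {m : ℝ → ℝ → ℝ} {c : ℝ → ℝ}
  {D O : Set (EuclideanSpace ℝ (Fin n))} {U : ℝ → Set (EuclideanSpace ℝ (Fin n))}
  {r : EuclideanSpace ℝ (Fin n) → ℝ}
  {d : EuclideanSpace ℝ (Fin n) → ℝ → ℝ} {σ a c₁ β ε τ t : ℝ} {ξ : ℝ → ℝ}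
  {x : EuclideanSpace ℝ (Fin n)}

lemma IsDistanceExtension.mem_of_abs_lt (hext : IsDistanceExtension D O U η L τ d)
    (ht : t ∈ Icc 0 τ) (hx : x ∈ D) (hlt : |d x t| < η) : x ∈ O := by
  by_contra hxO
  by_cases hU : x ∈ U t
  · have h1 := hext.inside t ht x hx hU hxO
    have h2 := (abs_lt.1 hlt).1
    linarith
  · have h1 := hext.outside t ht x hx hU hxO
    have h2 := (abs_lt.1 hlt).2
    linarith

/-- Near the surface, the extended distance almost solves the forced heat equation. -/
lemma IsDistanceExtension.near (hext : IsDistanceExtension D O U η L τ d) {g : ℝ → ℝ}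
    (hflow : IsForcedCurvatureFlow D O U g N η τ) (hn : 2 ≤ n) (hD : Bornology.IsBounded D)
    (hη : 0 < η) (hN : 0 < N) (ht : t ∈ Ioo 0 τ) (hxO : x ∈ O) (hlt : |d x t| ≤ 1 / (2 * N)) :
    ‖∇ (fun y => d y t) x‖ = 1 ∧
    |deriv (fun s => d x s) t - (Δ fun y => d y t) x + g t| ≤ 2 * n * N ^ 2 * |d x t| := by
  have ht' : t ∈ Icc 0 τ := ⟨ht.1.le, ht.2.le⟩
  have hdx : d x t = signedDist (U t) x := hext.eq_signedDist t ht' x hxO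
  have e1 : (fun y => d y t) =ᶠ[𝓝 x] signedDist (U t) := by
    filter_upwards [hflow.isOpen.mem_nhds hxO] with y hy using hext.eq_signedDist t ht' y hy
  have e2 : (fun s => d x s) =ᶠ[𝓝 t] fun s => signedDist (U s) x := by
    filter_upwards [Ioo_mem_nhds ht.1 ht.2] with s hs
    exact hext.eq_signedDist s ⟨hs.1.le, hs.2.le⟩ x hxO
  have e3 : (Δ fun y => d y t) x = (Δ (signedDist (U t))) x :=
    (InnerProductSpace.laplacian_congr_nhds e1).eq_of_nhds
  rw [e1.gradient_eq, e2.deriv_eq, e3, hdx]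
  rw [hdx] at hlt
  refine ⟨hflow.norm_gradient hn hD hη ht' hxO, ?_⟩
  refine hflow.abs_deriv_sub_laplacian_le hn hD hη hN ht hxO ?_
  calc N * |signedDist (U t) x| ≤ N * (1 / (2 * N)) := by gcongr
    _ = 1 / 2 := by field_simp

lemma mul_exp_neg_le {y : ℝ} (hl : 0 < l) : y * Real.exp (-l * y) ≤ 1 / l := by
  have h1 := Real.add_one_le_exp (l * y)
  have h2 : Real.exp (-l * y) * Real.exp (l * y) = 1 := by rw [← Real.exp_add]; simp
  have h3 := Real.exp_pos (-l * y)
  rw [le_div_iff₀ hl]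
  nlinarith

set_option maxHeartbeats 1000000 in
/-- For small `ε` the barrier with sign `σ = ±1` satisfies the differential inequality of a
super- or subsolution. -/
lemma sign_mul_residual_barrier_nonneg (hn : 2 ≤ n) (hD : Bornology.IsBounded D) (hDo : IsOpen D)
    (hN : 0 < N) (hm : IsTravellingWave δ₀ mMinus mPlus m c) (hδ₁ : δ₁ < δ₀) (hA : 0 < A)
    (hl : 0 < l) (hwave : ∀ δ ∈ Icc (-δ₁) δ₁, |c δ| ≤ A ∧ ∀ x, 0 ≤ deriv (fun y => m y δ) x ∧
        deriv (fun y => m y δ) x ≤ A * Real.exp (-l * |x|) ∧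
        |deriv (deriv fun y => m y δ) x| ≤ A * Real.exp (-l * |x|) ∧
        |deriv (fun s => m x s) δ| ≤ A)
    (hσ : |σ| = 1) (hη : 0 < η) (hε : 0 < ε) (hξ : Differentiable ℝ ξ)
    (hδt : ε * ξ t + σ * ε ^ β ∈ Icc (-δ₁) δ₁) (hξt : |ε * deriv ξ t| ≤ Cξ)
    (hc₁ : c₁ = 2 * n * N ^ 2)
    (hflow : IsForcedCurvatureFlow D O U (forcing c σ β ε ξ) N η τ)
    (hext : IsDistanceExtension D O U η L τ d) (ht : t ∈ Ioo 0 τ) (hτ : τ ≤ T) (hx : x ∈ D)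
    (hnear : A * Cξ + c₁ * (A / l) ≤ ε ^ β * (ε ^ 2)⁻¹)
    (hshift : ε ^ a * Real.exp (c₁ * T) ≤ min η (1 / (2 * N)) / 2)
    (hfar : A * Cξ + A * Real.exp (-l * (min η (1 / (2 * N)) / 2 / ε)) *
      (ε⁻¹ * (2 * L + ε⁻¹ * A) + (ε ^ 2)⁻¹) ≤ ε ^ β * (ε ^ 2)⁻¹) :
    0 ≤ σ * residual ε ξ (barrier m σ a c₁ β ε ξ d) x t := by
  have ht' : t ∈ Icc 0 τ := ⟨ht.1.le, ht.2.le⟩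
  have hσσ : σ * σ = 1 := by rw [← abs_mul_abs_self, hσ, one_mul]
  have hσx : ∀ y : ℝ, -|y| ≤ σ * y := fun y => by
    have := neg_abs_le (σ * y); rwa [abs_mul, hσ, one_mul] at this
  have hδI : ε * ξ t + σ * ε ^ β ∈ Ioo (-δ₀) δ₀ := ⟨by linarith [hδt.1], by linarith [hδt.2]⟩
  have hdx : ContDiffAt ℝ 2 (fun y => d y t) x :=
    (hext.classical.space t ht).contDiffAt (hDo.mem_nhds hx)
  set z := (d x t + σ * (ε ^ a * Real.exp (c₁ * t))) / ε with hz
  set δ := ε * ξ t + σ * ε ^ β with hδ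
  rw [residual_barrier hm hε hδI (hξ t) (hext.classical.time t ht x hx) hdx hz hδ]
  obtain ⟨hcA, hwz⟩ := hwave δ hδt
  obtain ⟨hmx0, hmx, hmxx, hmδ⟩ := hwz z
  set mx := deriv (fun y => m y δ) z
  set mxx := deriv (deriv fun y => m y δ) z
  set md := deriv (fun s => m z s) δ
  set dt := deriv (fun s => d x s) t
  set lap := (Δ fun y => d y t) x
  set G := ‖∇ (fun y => d y t) x‖ with hG
  set S := ε ^ a * Real.exp (c₁ * t) with hS
  have hc₁0 : 0 ≤ c₁ := by rw [hc₁]; positivity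
  have hS0 : 0 ≤ S := by positivity
  have hST : S ≤ min η (1 / (2 * N)) / 2 := by
    refine le_trans ?_ hshift
    have : t ≤ T := ht.2.le.trans hτ
    rw [hS]; gcongr
  have hCξ : 0 ≤ Cξ := (abs_nonneg _).trans hξt
  have hmdξ : -(A * Cξ) ≤ σ * (md * (ε * deriv ξ t)) := by
    refine le_trans ?_ (hσx _)
    rw [abs_mul]
    exact neg_le_neg (mul_le_mul hmδ hξt (abs_nonneg _) hA.le)
  have hdz : d x t = ε * z - σ * S := by rw [hz]; field_simp; ring
  have hexpand : σ * (σ * (ε ^ β * (ε ^ 2)⁻¹) + md * (ε * deriv ξ t)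
      + mx * ε⁻¹ * (dt - lap + ε⁻¹ * c δ + σ * (c₁ * S)) + mxx * (ε ^ 2)⁻¹ * (1 - G ^ 2))
      = ε ^ β * (ε ^ 2)⁻¹ + σ * (md * (ε * deriv ξ t))
        + mx * ε⁻¹ * (σ * (dt - lap + ε⁻¹ * c δ) + c₁ * S)
        + σ * (mxx * (ε ^ 2)⁻¹ * (1 - G ^ 2)) := by
    linear_combination (ε ^ β * (ε ^ 2)⁻¹ + mx * ε⁻¹ * (c₁ * S)) * hσσ
  rw [hexpand]
  have hmxε : 0 ≤ mx * ε⁻¹ := by positivity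
  -- Below `η` the point lies in `O`; below `1 / (2N)` the curvature expansion is valid.
  by_cases hlt : |d x t| < min η (1 / (2 * N))
  · have hxO := hext.mem_of_abs_lt ht' hx (hlt.trans_le (min_le_left _ _))
    obtain ⟨hG1, hheat⟩ := hext.near hflow hn hD hη hN ht hxO (hlt.le.trans (min_le_right _ _))
    rw [← hc₁] at hheat
    simp only [forcing] at hheat
    have hG0 : σ * (mxx * (ε ^ 2)⁻¹ * (1 - G ^ 2)) = 0 := by rw [hG, hG1]; ring
    rw [hG0, add_zero]
    have h1 : |d x t| ≤ ε * |z| + S := by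
      rw [hdz]
      refine (abs_sub _ _).trans ?_
      rw [abs_mul, abs_mul, hσ, abs_of_pos hε, abs_of_nonneg hS0, one_mul]
    -- The growth `c₁ S` of the shift cancels its contribution to the error `c₁ |d| ≤ c₁ (ε |z| +
    -- S)`.
    have h2 : -(c₁ * (ε * |z|)) ≤ σ * (dt - lap + ε⁻¹ * c δ) + c₁ * S := by
      have h3 := hσx (dt - lap + ε⁻¹ * c δ)
      have h4 : c₁ * |d x t| ≤ c₁ * (ε * |z| + S) := by gcongr
      linarith
    have h5 : -(c₁ * (A / l)) ≤ mx * ε⁻¹ * (σ * (dt - lap + ε⁻¹ * c δ) + c₁ * S) := by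
      refine le_trans ?_ (mul_le_mul_of_nonneg_left h2 hmxε)
      have h6 : mx * ε⁻¹ * -(c₁ * (ε * |z|)) = -(c₁ * (mx * |z|)) := by field_simp
      rw [h6]
      have h7 : mx * |z| ≤ A / l := by
        calc mx * |z| ≤ A * Real.exp (-l * |z|) * |z| := by gcongr
          _ = A * (|z| * Real.exp (-l * |z|)) := by ring
          _ ≤ A * (1 / l) := by gcongr; exact mul_exp_neg_le hl
          _ = A / l := by ring
      have h8 : c₁ * (mx * |z|) ≤ c₁ * (A / l) := by gcongr
      linarith
    linarith
  · push Not at hlt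
    set E := Real.exp (-l * (min η (1 / (2 * N)) / 2 / ε)) with hE
    have hEpos : 0 < E := Real.exp_pos _
    -- The shift uses up at most half of the distance threshold.
    have hzlow : min η (1 / (2 * N)) / 2 / ε ≤ |z| := by
      rw [div_le_iff₀ hε]
      have h1 : |d x t| ≤ ε * |z| + S := by
        rw [hdz]
        refine (abs_sub _ _).trans ?_
        rw [abs_mul, abs_mul, hσ, abs_of_pos hε, abs_of_nonneg hS0, one_mul]
      linarith
    have hexpz : Real.exp (-l * |z|) ≤ E := by
      rw [hE]; apply Real.exp_le_exp.2
      have := mul_le_mul_of_nonneg_left hzlow hl.le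
      linarith
    have hmxE : mx ≤ A * E := hmx.trans (by gcongr)
    have hmxxE : |mxx| ≤ A * E := hmxx.trans (by gcongr)
    have hdt : |dt| ≤ L := hext.time_le t ht x hx
    have hlap : |lap| ≤ L := hext.laplacian_le t ht x hx
    have hG1 : G ≤ 1 := hext.gradient_le t ht x hx
    have hG0 : 0 ≤ G := norm_nonneg _
    have hL : 0 ≤ L := (abs_nonneg _).trans hdt
    have h1 : |dt - lap + ε⁻¹ * c δ| ≤ 2 * L + ε⁻¹ * A := by
      calc |dt - lap + ε⁻¹ * c δ| ≤ |dt - lap| + |ε⁻¹ * c δ| := abs_add_le _ _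
        _ ≤ (|dt| + |lap|) + ε⁻¹ * |c δ| := by
          rw [abs_mul, abs_of_pos (inv_pos.2 hε)]; gcongr; exact abs_sub _ _
        _ ≤ (L + L) + ε⁻¹ * A := by gcongr
        _ = _ := by ring
    have h2 : -(A * E * ε⁻¹ * (2 * L + ε⁻¹ * A))
        ≤ mx * ε⁻¹ * (σ * (dt - lap + ε⁻¹ * c δ) + c₁ * S) := by
      have h3 : -(2 * L + ε⁻¹ * A) ≤ σ * (dt - lap + ε⁻¹ * c δ) + c₁ * S := by
        have := hσx (dt - lap + ε⁻¹ * c δ)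
        have := mul_nonneg hc₁0 hS0
        linarith
      refine le_trans ?_ (mul_le_mul_of_nonneg_left h3 hmxε)
      have h4 : mx * ε⁻¹ * (2 * L + ε⁻¹ * A) ≤ A * E * ε⁻¹ * (2 * L + ε⁻¹ * A) := by gcongr
      linarith
    have h5 : -(A * E * (ε ^ 2)⁻¹) ≤ σ * (mxx * (ε ^ 2)⁻¹ * (1 - G ^ 2)) := by
      refine le_trans ?_ (hσx _)
      have h6 : |1 - G ^ 2| ≤ 1 := abs_le.2 ⟨by nlinarith, by nlinarith⟩
      rw [abs_mul, abs_mul, abs_of_pos (show 0 < (ε ^ 2)⁻¹ by positivity)]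
      have h7 : |mxx| * (ε ^ 2)⁻¹ * |1 - G ^ 2| ≤ A * E * (ε ^ 2)⁻¹ * 1 := by gcongr
      linarith
    have h8 : A * E * (ε⁻¹ * (2 * L + ε⁻¹ * A) + (ε ^ 2)⁻¹)
        = A * E * ε⁻¹ * (2 * L + ε⁻¹ * A) + A * E * (ε ^ 2)⁻¹ := by ring
    rw [h8] at hfar
    linarith

/-- The requirements on the size of `ε`. -/
lemma eventually_small {γ δ₁ : ℝ} (hγ : 0 < γ) (hβ : 1 < β) (hβ' : β < 2) (hδ₁ : 0 < δ₁)
    (hl : 0 < l) {η' : ℝ} (hη' : 0 < η') (Q A Cξ K c₁ T : ℝ) (p : ℕ) :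
    ∀ᶠ ε in 𝓝[>] (0 : ℝ), 0 < ε ∧ Cξ * ε ^ γ + ε ^ β ≤ δ₁ ∧ Q ≤ ε ^ β * (ε ^ 2)⁻¹ ∧
      ε ^ (1 : ℝ) * Real.exp (c₁ * T) ≤ η' ∧
      A * Cξ + A * Real.exp (-l * (η' / ε)) *
        (ε⁻¹ * (2 * (K * (ε ^ p)⁻¹) + ε⁻¹ * A) + (ε ^ 2)⁻¹) ≤ ε ^ β * (ε ^ 2)⁻¹ := by
  have hpow : ∀ k : ℝ, 0 < k → Tendsto (fun ε : ℝ => ε ^ k) (𝓝[>] 0) (𝓝 0) := by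
    intro k hk
    have := (Real.continuousAt_rpow_const 0 k (Or.inr hk.le)).tendsto
    rw [Real.zero_rpow hk.ne'] at this
    exact this.mono_left nhdsWithin_le_nhds
  have hinv : Tendsto (fun ε : ℝ => ε⁻¹) (𝓝[>] 0) atTop := tendsto_inv_nhdsGT_zero
  have hbig : Tendsto (fun ε : ℝ => ε ^ β * (ε ^ 2)⁻¹) (𝓝[>] 0) atTop := by
    have h1 := (tendsto_rpow_atTop (show 0 < 2 - β by linarith)).comp hinv
    refine h1.congr' ?_
    filter_upwards [self_mem_nhdsWithin] with ε hε
    have hε : 0 < ε := hε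
    simp only [Function.comp]
    rw [Real.inv_rpow hε.le, ← Real.rpow_neg hε.le, ← Real.rpow_natCast, ← Real.rpow_neg hε.le,
      ← Real.rpow_add hε]
    congr 1; push_cast; ring
  -- Exponential decay in `1/ε` beats every power, hence also the bound `K ε^{-p}` on the
  -- derivatives of the extension.
  have hexp : ∀ k : ℕ, Tendsto (fun ε : ℝ => ε⁻¹ ^ k * Real.exp (-l * (η' / ε))) (𝓝[>] 0) (𝓝 0) := by
    intro k
    have h1 := (tendsto_rpow_mul_exp_neg_mul_atTop_nhds_zero k (l * η') (by positivity)).comp hinv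
    refine h1.congr fun ε => ?_
    simp only [Function.comp, Real.rpow_natCast]
    congr 2; rw [div_eq_mul_inv]; ring
  have hsum : Tendsto (fun ε : ℝ => Cξ * ε ^ γ + ε ^ β) (𝓝[>] 0) (𝓝 0) := by
    simpa using ((hpow γ hγ).const_mul Cξ).add (hpow β (by linarith))
  have hsh : Tendsto (fun ε : ℝ => ε ^ (1 : ℝ) * Real.exp (c₁ * T)) (𝓝[>] 0) (𝓝 0) := by
    simpa using (hpow 1 one_pos).mul_const (Real.exp (c₁ * T))
  have hfar : Tendsto (fun ε : ℝ => A * Cξ + A * Real.exp (-l * (η' / ε)) *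
      (ε⁻¹ * (2 * (K * (ε ^ p)⁻¹) + ε⁻¹ * A) + (ε ^ 2)⁻¹)) (𝓝[>] 0) (𝓝 (A * Cξ)) := by
    have h1 := (((hexp (p + 1)).const_mul (A * (2 * K))).add
      ((hexp 2).const_mul (A * (A + 1)))).const_add (A * Cξ)
    simp only [mul_zero, add_zero] at h1
    refine h1.congr fun ε => ?_
    rw [pow_succ, inv_pow, inv_pow]
    ring
  filter_upwards [self_mem_nhdsWithin, hsum.eventually (ge_mem_nhds hδ₁),
    hbig.eventually_ge_atTop Q, hsh.eventually (ge_mem_nhds hη'),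
    hfar.eventually (ge_mem_nhds (show A * Cξ < A * Cξ + 1 by linarith)),
    hbig.eventually_ge_atTop (A * Cξ + 1)] with ε h1 h2 h3 h4 h5 h6
  exact ⟨h1, h2, h3, h4, h5.trans h6⟩

end Sign

end AllenCahn

/-! ### Proof of the theorem. -/

theorem mainTheorem2 {n : ℕ} (hn : 2 ≤ n)
    (D : Set (EuclideanSpace ℝ (Fin n))) (r : EuclideanSpace ℝ (Fin n) → ℝ)
    (hD : Bornology.IsBounded D) (hr : AllenCahn.IsDefiningFunction r D)
    {Ω : Type*} [MeasurableSpace Ω] (P : Measure Ω) [IsProbabilityMeasure P]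
    (B B' : ℝ≥0 → Ω → ℝ) (hB : IsBrownianReal B P) (hB' : IsBrownianReal B' P)
    (hBB' : IndepFun (fun ω t => B t ω) (fun ω t => B' t ω) P)
    (ρ : ℝ → ℝ) (hρ : AllenCahn.IsMollifier ρ)
    (γ : ℝ) (hγ : 0 < γ) (hγ' : γ < 2 / 3)
    (δ₀ : ℝ) (mMinus mPlus : ℝ → ℝ) (m : ℝ → ℝ → ℝ) (c : ℝ → ℝ)
    (hm : AllenCahn.IsTravellingWave δ₀ mMinus mPlus m c)
    (β : ℝ) (hβ : 1 < β) (hβ' : β < 2) (N : ℝ) (hN : 0 < N) :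
    ∃ a : ℝ, 0 < a ∧ ∃ c₁ : ℝ, 0 < c₁ ∧ ∀ᵐ ω ∂P,
      ∀ (η K T : ℝ) (p : ℕ), 0 < η → 0 < K → 0 < T → ∃ ε₀ : ℝ, 0 < ε₀ ∧ ∀ ε ∈ Ioc 0 ε₀,
        ∀ ξ : ℝ → ℝ, ξ = AllenCahn.noise ρ γ (fun t => AllenCahn.twoSided B B' t ω) ε →
        ∀ (τm τp : ℝ) (Om Op : Set (EuclideanSpace ℝ (Fin n)))
          (Um Up : ℝ → Set (EuclideanSpace ℝ (Fin n)))
          (dm dp : EuclideanSpace ℝ (Fin n) → ℝ → ℝ),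
          τm ∈ Icc 0 T → τp ∈ Icc 0 T →
          AllenCahn.IsForcedCurvatureFlow D Om Um (AllenCahn.forcing c (-1) β ε ξ) N η τm →
          AllenCahn.IsForcedCurvatureFlow D Op Up (AllenCahn.forcing c 1 β ε ξ) N η τp →
          AllenCahn.IsDistanceExtension D Om Um η (K * (ε ^ p)⁻¹) τm dm →
          AllenCahn.IsDistanceExtension D Op Up η (K * (ε ^ p)⁻¹) τp dp →
          ∀ um up : EuclideanSpace ℝ (Fin n) → ℝ → ℝ,
          um = AllenCahn.barrier m (-1) a c₁ β ε ξ dm →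
          up = AllenCahn.barrier m 1 a c₁ β ε ξ dp →
          AllenCahn.IsSubsolution D r ε ξ τm um ∧
          AllenCahn.IsSupersolution D r ε ξ τp up ∧
          ∀ (τ : ℝ) (u : EuclideanSpace ℝ (Fin n) → ℝ → ℝ),
            AllenCahn.IsSolution D r ε ξ τ u →
            (∀ x ∈ D, um x 0 ≤ u x 0 ∧ u x 0 ≤ up x 0) →
            ∀ x ∈ D, ∀ t ∈ Icc 0 τ,
              (t ≤ τm → um x t ≤ u x t) ∧ (t ≤ τp → u x t ≤ up x t) := by
  obtain ⟨δ₁, hδ₁, hδ₁₀, A, hA, l, hl, hwave⟩ := hm.exists_bounds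
  have hn0 : (0 : ℝ) < n := by exact_mod_cast (by omega : 0 < n)
  set c₁ : ℝ := 2 * n * N ^ 2 with hc₁
  -- The shift merely has to vanish as `ε → 0`, so `a = 1` serves; `c₁` is the constant of the error
  -- `2 n N² |d|` in the heat equation for the distance.
  refine ⟨1, one_pos, c₁, by positivity, ?_⟩
  filter_upwards [AllenCahn.noise_bounds hB hB' hρ hγ hγ'] with ω hω η K T p hη hK hT
  obtain ⟨Cξ, hCξ, hnoise⟩ := hω T hT
  have hη' : 0 < min η (1 / (2 * N)) / 2 := by positivity
  obtain ⟨ε₀, hε₀, hε₀sub⟩ := mem_nhdsGT_iff_exists_Ioc_subset.1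
    (hnoise.and (AllenCahn.eventually_small hγ hβ hβ' hδ₁ hl hη' (A * Cξ + c₁ * (A / l)) A Cξ K c₁ T p))
  refine ⟨ε₀, hε₀, ?_⟩
  intro ε hε ξ hξ τm τp Om Op Um Up dm dp hτm hτp hfm hfp hem hep um up hum hup
  obtain ⟨⟨hdiff, hbd⟩, hεpos, hsmall, hnear, hshift, hfar⟩ := hε₀sub hε
  rw [← hξ] at hdiff hbd
  have hδ : ∀ σ : ℝ, |σ| = 1 → ∀ t ∈ Icc 0 T, ε * ξ t + σ * ε ^ β ∈ Icc (-δ₁) δ₁ := by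
    intro σ hσ t ht
    rw [mem_Icc, ← abs_le]
    have h1 := (hbd t ht).1
    have h2 : |σ * ε ^ β| = ε ^ β := by
      rw [abs_mul, hσ, one_mul, abs_of_pos (by positivity)]
    linarith [abs_add_le (ε * ξ t) (σ * ε ^ β)]
  have key : ∀ (σ τ : ℝ) (O : Set (EuclideanSpace ℝ (Fin n)))
      (U : ℝ → Set (EuclideanSpace ℝ (Fin n))) (d : EuclideanSpace ℝ (Fin n) → ℝ → ℝ),
      |σ| = 1 → τ ∈ Icc 0 T →
      AllenCahn.IsForcedCurvatureFlow D O U (AllenCahn.forcing c σ β ε ξ) N η τ →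
      AllenCahn.IsDistanceExtension D O U η (K * (ε ^ p)⁻¹) τ d →
      AllenCahn.IsClassical D τ (AllenCahn.barrier m σ 1 c₁ β ε ξ d) ∧
      (∀ t ∈ Ioo 0 τ, ∀ x ∈ D,
        0 ≤ σ * AllenCahn.residual ε ξ (AllenCahn.barrier m σ 1 c₁ β ε ξ d) x t) ∧
      ∀ t ∈ Ioo 0 τ, ∀ x ∈ frontier D, AllenCahn.HasOuterNormalDeriv r
        (fun y => AllenCahn.barrier m σ 1 c₁ β ε ξ d y t) x 0 := by
    intro σ τ O U d hσ hτ hflow hext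
    refine ⟨?_, ?_, ?_⟩
    · refine AllenCahn.barrier_isClassical hm hr.isOpen hext.classical hdiff fun t ht => ?_
      have := hδ σ hσ t ⟨ht.1, ht.2.trans hτ.2⟩
      exact ⟨by linarith [this.1], by linarith [this.2]⟩
    · intro t ht x hx
      have htT : t ∈ Icc 0 T := ⟨ht.1.le, ht.2.le.trans hτ.2⟩
      exact AllenCahn.sign_mul_residual_barrier_nonneg hn hD hr.isOpen hN hm hδ₁₀ hA hl hwave hσ hη
        hεpos hdiff (hδ σ hσ t htT) (hbd t htT).2 hc₁ hflow hext ht hτ.2 hx hnear hshift hfar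
    · intro t ht x hx
      exact AllenCahn.barrier_neumann hr hx (hext.const_near t ⟨ht.1.le, ht.2.le⟩ x hx)
  have hsub : AllenCahn.IsSubsolution D r ε ξ τm um := by
    obtain ⟨h1, h2, h3⟩ := key (-1) τm Om Um dm (by simp) hτm hfm hem
    rw [hum]
    exact ⟨h1, fun t ht x hx => by linarith [h2 t ht x hx], fun t ht x hx => ⟨0, h3 t ht x hx, le_rfl⟩⟩
  have hsup : AllenCahn.IsSupersolution D r ε ξ τp up := by
    obtain ⟨h1, h2, h3⟩ := key 1 τp Op Up dp (by simp) hτp hfp hep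
    rw [hup]
    exact ⟨h1, fun t ht x hx => by linarith [h2 t ht x hx], fun t ht x hx => ⟨0, h3 t ht x hx, le_rfl⟩⟩
  refine ⟨hsub, hsup, fun τ u hu h0 x hx t ht => ⟨fun htm => ?_, fun htp => ?_⟩⟩
  -- The barrier and `u` live on different time intervals and are compared on the common one.
  · exact AllenCahn.comparison hD hr (hsub.mono (min_le_right τ τm))
      (hu.isSupersolution.mono (min_le_left τ τm)) (fun y hy => (h0 y hy).1) x hx t
      ⟨ht.1, le_min ht.2 htm⟩
  · exact AllenCahn.comparison hD hr (hu.isSubsolution.mono (min_le_left τ τp))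
      (hsup.mono (min_le_right τ τp)) (fun y hy => (h0 y hy).2) x hx t
      ⟨ht.1, le_min ht.2 htp⟩
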